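/- Let $M$ be an open orientable topological $n$-manifold (Hausdorff, second countable, without boundary; open means that no connected component of $M$ is compact), and let $K_0\subseteq K_1\subseteq\cdots$ be an exhaustion of $M$ by compact sets with $K_i\subseteq \mathrm{Int}\,K_{i+1}$. An end of $M$ is a decreasing sequence $U_0\supseteq U_1\supseteq\cdots$ in which $U_i$ is a connected component of $M\setminus K_i$. For $V\subseteq M$ let $\partial_\infty V$ be the set of ends with $U_i\subseteq V$ for all large $i$. When $V$ has compact topological boundary, let $$C_*(M,\partial_\infty V)=\varprojlim_i C_*(M,V\setminus K_i),\qquad C^*(M,\partial_\infty V)=\varinjlim_i C^*(M,V\setminus K_i)$$ (singular chains and cochains with integer coefficients), with homology $H_*(M,\partial_\infty V)$ and cohomology $H^*(M,\partial_\infty V)$; write $H_*(M,\partial_\infty M)$ for the case $V=M$. A fundamental class is an element $[M]\in H_n(M,\partial_\infty M)$ whose image in $H_n(M,M\setminus\{x\})\cong\mathbb Z$ is a generator for every $x\in M$. Theorem. Let $A,B\subseteq M$ be subsets with compact boundaries that give an ends-decomposition $\partial_\infty M=\partial_\infty A\sqcup\partial_\infty B$. Then $M$ has a fundamental class, and for every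 fundamental class $[M]\in H_n(M,\partial_\infty M)$ the cap product $$D_M\colon H^k(M,\partial_\infty A)\to H_{n-k}(M,\partial_\infty B),\qquad \alpha\mapsto [M]\frown\alpha,$$ is an isomorphism for every integer $k$. (For $k$ outside $\{0,\dots,n\}$ this says that $H^k(M,\partial_\infty A)=0$ for $k>n$ and $H_m(M,\partial_\infty B)=0$ for $m>n$.) -/

import Mathlib

open Set Topology

noncomputable section

namespace EndsDuality

universe u v w

section Complexes

variable {R : Type} [CommRing R]
variable {C : ℕ → Type v} [∀ n, AddCommGroup (C n)] [∀ n, Module R (C n)]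

/-- The cycles in degree `n` of `⋯ → C 2 → C 1 → C 0 → 0`. -/
def cycles (d : ∀ n, C (n + 1) →ₗ[R] C n) : ∀ n, Submodule R (C n)
  | 0 => ⊤
  | n + 1 => LinearMap.ker (d n)

/-- The boundaries in degree `n`. -/
def boundaries (d : ∀ n, C (n + 1) →ₗ[R] C n) (n : ℕ) : Submodule R (C n) :=
  LinearMap.range (d n)

/-- The `n`-th homology group of `⋯ → C 2 → C 1 → C 0 → 0`: cycles modulo boundaries. -/
abbrev Homology (d : ∀ n, C (n + 1) →ₗ[R] C n) (n : ℕ) : Type v :=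
  cycles d n ⧸ (boundaries d n).submoduleOf (cycles d n)

/-- The cocycles in degree `n` of `0 → C 0 → C 1 → C 2 → ⋯`. -/
def cocycles (d : ∀ n, C n →ₗ[R] C (n + 1)) (n : ℕ) : Submodule R (C n) :=
  LinearMap.ker (d n)

/-- The coboundaries in degree `n` of `0 → C 0 → C 1 → C 2 → ⋯`. -/
def coboundaries (d : ∀ n, C n →ₗ[R] C (n + 1)) : ∀ n, Submodule R (C n)
  | 0 => ⊥
  | n + 1 => LinearMap.range (d n)

/-- The `n`-th cohomology group of `0 → C 0 → C 1 → C 2 → ⋯`: cocycles modulo coboundaries. -/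
abbrev Cohomology (d : ∀ n, C n →ₗ[R] C (n + 1)) (n : ℕ) : Type v :=
  cocycles d n ⧸ (coboundaries d n).submoduleOf (cocycles d n)

variable {C' : ℕ → Type w} [∀ n, AddCommGroup (C' n)] [∀ n, Module R (C' n)]

theorem map_mem_cycles {d : ∀ n, C (n + 1) →ₗ[R] C n} {d' : ∀ n, C' (n + 1) →ₗ[R] C' n}
    (f : ∀ n, C n →ₗ[R] C' n) (hf : ∀ n x, d' n (f (n + 1) x) = f n (d n x)) (n : ℕ)
    (x : C n) (hx : x ∈ cycles d n) : f n x ∈ cycles d' n := by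
  cases n with
  | zero => trivial
  | succ n =>
    have hx' : d n x = 0 := hx
    change d' n (f (n + 1) x) = 0
    rw [hf, hx', map_zero]

/-- The map induced on homology by a chain map. -/
def Homology.map {d : ∀ n, C (n + 1) →ₗ[R] C n} {d' : ∀ n, C' (n + 1) →ₗ[R] C' n}
    (f : ∀ n, C n →ₗ[R] C' n) (hf : ∀ n x, d' n (f (n + 1) x) = f n (d n x)) (n : ℕ) :
    Homology d n →ₗ[R] Homology d' n :=
  Submodule.mapQ _ _ ((f n).restrict (map_mem_cycles f hf n)) (by
    rintro ⟨x, hx⟩ hy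
    obtain ⟨y, hy⟩ := hy
    exact ⟨f (n + 1) y, by rw [hf, hy]; rfl⟩)

end Complexes

section SingularChains

variable {R : Type} [CommRing R] {X : Type u} [TopologicalSpace X]

/-- Singular `n`-simplices of `X`. -/
abbrev Simp (X : Type u) [TopologicalSpace X] (n : ℕ) : Type u :=
  C(stdSimplex ℝ (Fin (n + 1)), X)

/-- Reparametrisation of a singular simplex by a map of vertices. -/
def pull {n k : ℕ} (f : Fin (k + 1) → Fin (n + 1)) (σ : Simp X n) : Simp X k :=
  σ.comp ⟨stdSimplex.map f, stdSimplex.continuous_map f⟩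

/-- Singular chains with coefficients in `R`. -/
abbrev Chain (R : Type) [CommRing R] (X : Type u) [TopologicalSpace X] (n : ℕ) : Type u :=
  Simp X n →₀ R

/-- The singular boundary `∂σ = ∑ᵢ (-1)ⁱ σ|[v₀, …, v̂ᵢ, …, vₙ₊₁]`. -/
def bd (R : Type) [CommRing R] (X : Type u) [TopologicalSpace X] (n : ℕ) :
    Chain R X (n + 1) →ₗ[R] Chain R X n :=
  Finsupp.lift (Chain R X n) R (Simp X (n + 1)) fun σ =>
    ∑ i : Fin (n + 2), (-1 : R) ^ (i : ℕ) • Finsupp.single (pull i.succAbove σ) 1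

/-- The simplices of `X` with image in `U`. -/
def simplicesIn (U : Set X) (n : ℕ) : Set (Simp X n) := {σ | ∀ t, σ t ∈ U}

/-- `C_n(U)` as a submodule of `C_n(X)`. -/
def chainsIn (R : Type) [CommRing R] (U : Set X) (n : ℕ) : Submodule R (Chain R X n) :=
  Finsupp.supported R R (simplicesIn U n)

/-- The front `k`-face `[v₀, …, v_k]` of an `n`-simplex, `k + m = n`. -/
def front {n k m : ℕ} (h : k + m = n) : Fin (k + 1) → Fin (n + 1) :=
  fun i => ⟨i, by omega⟩

/-- The back `m`-face `[v_k, …, v_n]` of an `n`-simplex, `k + m = n`. -/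
def back {n k m : ℕ} (h : k + m = n) : Fin (m + 1) → Fin (n + 1) :=
  fun i => ⟨k + i, by omega⟩

/-- Singular `k`-cochains with coefficients in `R`. -/
def Cochain (R : Type) [CommRing R] (X : Type u) [TopologicalSpace X] (k : ℕ) : Type u :=
  Chain R X k →ₗ[R] R

instance (k : ℕ) : AddCommGroup (Cochain R X k) :=
  inferInstanceAs (AddCommGroup (Chain R X k →ₗ[R] R))

instance (k : ℕ) : Module R (Cochain R X k) :=
  inferInstanceAs (Module R (Chain R X k →ₗ[R] R))

instance (k : ℕ) : FunLike (Cochain R X k) (Chain R X k) R :=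
  inferInstanceAs (FunLike (Chain R X k →ₗ[R] R) (Chain R X k) R)

instance (k : ℕ) : LinearMapClass (Cochain R X k) R (Chain R X k) R :=
  inferInstanceAs (LinearMapClass (Chain R X k →ₗ[R] R) R (Chain R X k) R)

/-- Evaluation of cochains on a chain. -/
def Cochain.eval {k : ℕ} (c : Chain R X k) : Cochain R X k →ₗ[R] R where
  toFun φ := φ c
  map_add' _ _ := rfl
  map_smul' _ _ := rfl

/-- The coboundary `δφ = φ ∘ ∂`. -/
def cobd (R : Type) [CommRing R] (X : Type u) [TopologicalSpace X] (k : ℕ) :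
    Cochain R X k →ₗ[R] Cochain R X (k + 1) where
  toFun φ := LinearMap.comp (show Chain R X k →ₗ[R] R from φ) (bd R X k)
  map_add' _ _ := rfl
  map_smul' _ _ := rfl

/-- The chain-level cap product `σ ⌢ φ = φ(σ|[v₀, …, v_k]) σ|[v_k, …, v_n]`. -/
def cap {n k m : ℕ} (h : k + m = n) : Chain R X n →ₗ[R] Cochain R X k →ₗ[R] Chain R X m :=
  Finsupp.lift (Cochain R X k →ₗ[R] Chain R X m) R (Simp X n) fun σ =>
    (LinearMap.toSpanSingleton R (Chain R X m) (Finsupp.single (pull (back h) σ) 1)).comp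
      (Cochain.eval (Finsupp.single (pull (front h) σ) 1))

theorem pull_pull {n k l : ℕ} (f : Fin (k + 1) → Fin (n + 1)) (g : Fin (l + 1) → Fin (k + 1))
    (σ : Simp X n) : pull g (pull f σ) = pull (f ∘ g) σ := by
  ext t
  simp [pull, stdSimplex.map_comp_apply]

theorem bd_single {n : ℕ} (σ : Simp X (n + 1)) :
    bd R X n (Finsupp.single σ 1) =
      ∑ i : Fin (n + 2), (-1 : R) ^ (i : ℕ) • Finsupp.single (pull i.succAbove σ) 1 := by
  simp [bd]

theorem cap_single {n k m : ℕ} (h : k + m = n) (σ : Simp X n) (φ : Cochain R X k) :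
    cap h (Finsupp.single σ 1) φ =
      φ (Finsupp.single (pull (front h) σ) 1) • Finsupp.single (pull (back h) σ) 1 := by
  simp only [cap, Finsupp.lift_apply, Finsupp.sum_single_index, zero_smul, one_smul]
  rfl

theorem pull_mem {U : Set X} {n k : ℕ} (f : Fin (k + 1) → Fin (n + 1)) {σ : Simp X n}
    (hσ : σ ∈ simplicesIn U n) : pull f σ ∈ simplicesIn U k := fun _ => hσ _

theorem single_mem {U : Set X} {n : ℕ} {σ : Simp X n} (hσ : σ ∈ simplicesIn U n) (a : R) :
    Finsupp.single σ a ∈ chainsIn R U n :=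
  Finsupp.single_mem_supported R a hσ

theorem chainsIn_le {U : Set X} {n : ℕ} {P : Submodule R (Chain R X n)}
    (h : ∀ σ ∈ simplicesIn U n, Finsupp.single σ 1 ∈ P) : chainsIn R U n ≤ P := by
  rw [chainsIn, Finsupp.supported_eq_span_single, Submodule.span_le]
  rintro _ ⟨σ, hσ, rfl⟩
  exact h σ hσ

theorem chainsIn_mono {U V : Set X} (h : U ⊆ V) (n : ℕ) : chainsIn R U n ≤ chainsIn R V n :=
  Finsupp.supported_mono fun _ hσ t => h (hσ t)

theorem bd_mem (U : Set X) (n : ℕ) : chainsIn R U (n + 1) ≤ (chainsIn R U n).comap (bd R X n) := by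
  refine chainsIn_le fun σ hσ => ?_
  rw [Submodule.mem_comap, bd_single]
  exact Submodule.sum_mem _ fun i _ => Submodule.smul_mem _ _ (single_mem (pull_mem _ hσ) 1)

/-- `Fin.succAbove` with the omitted index given as a natural number. -/
def skip (n i : ℕ) : Fin (n + 1) → Fin (n + 2) :=
  fun j => if (j : ℕ) < i then j.castSucc else j.succ

theorem skip_val (n i : ℕ) (j : Fin (n + 1)) :
    (skip n i j : ℕ) = if (j : ℕ) < i then (j : ℕ) else j + 1 := by
  unfold skip; split_ifs <;> rfl

theorem bd_single' {n : ℕ} (σ : Simp X (n + 1)) :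
    bd R X n (Finsupp.single σ 1) =
      ∑ i ∈ Finset.range (n + 2), (-1 : R) ^ i • Finsupp.single (pull (skip n i) σ) 1 := by
  rw [bd_single, ← Fin.sum_univ_eq_sum_range
    (fun i => (-1 : R) ^ i • Finsupp.single (pull (skip n i) σ) (1 : R))]
  rfl

theorem bd_bd (n : ℕ) (c : Chain R X (n + 2)) : bd R X n (bd R X (n + 1) c) = 0 := by
  induction c using Finsupp.induction_linear with
  | zero => simp
  | add x y hx hy => simp only [map_add, hx, hy, add_zero]
  | single σ a =>
    have ha : Finsupp.single σ a = a • Finsupp.single σ (1 : R) := by simp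
    rw [ha, map_smul, map_smul, bd_single', map_sum]
    simp only [map_smul, bd_single', pull_pull, Finset.smul_sum, smul_smul]
    rw [← Finset.sum_product']
    let g : ℕ × ℕ → ℕ × ℕ := fun p => if p.2 < p.1 then (p.2, p.1 - 1) else (p.2 + 1, p.1)
    refine Finset.sum_involution (fun p _ => g p) ?_ ?_ ?_ ?_
    · rintro ⟨i, j⟩ hp
      have hs : skip (n + 1) i ∘ skip n j = skip (n + 1) (g (i, j)).1 ∘ skip n (g (i, j)).2 := by
        funext x
        simp only [Function.comp, Fin.ext_iff, skip_val, g]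
        split_ifs <;> simp_all <;> omega
      rw [hs, ← add_smul]
      have : a * ((-1 : R) ^ i * (-1) ^ j) +
          a * ((-1) ^ (g (i, j)).1 * (-1) ^ (g (i, j)).2) = 0 := by
        simp only [g]
        split_ifs with h
        · obtain ⟨i, rfl⟩ : ∃ t, i = t + 1 := ⟨i - 1, by omega⟩
          simp only [Nat.add_sub_cancel]; ring
        · simp only; ring
      simp only at this ⊢
      simp only [← mul_add] at this ⊢
      simp [this]
    · rintro ⟨i, j⟩ _ _ h
      simp only [g] at h
      split_ifs at h with h' <;> simp_all <;> omega
    · rintro ⟨i, j⟩ hp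
      simp only [g, Finset.mem_product, Finset.mem_range] at hp ⊢
      split_ifs with h <;> simp_all <;> omega
    · rintro ⟨i, j⟩ _
      simp only [g]
      split_ifs <;> simp_all <;> omega

/-- The Leibniz rule `∂(c ⌢ φ) = (-1)ᵏ (∂c ⌢ φ - c ⌢ δφ)`. -/
theorem bd_cap {n k m : ℕ} (h : k + m = n) (h₁ : k + (m + 1) = n + 1) (h₂ : k + 1 + m = n + 1)
    (c : Chain R X (n + 1)) (φ : Cochain R X k) :
    bd R X m (cap h₁ c φ) =
      (-1 : R) ^ k • (cap h (bd R X n c) φ - cap h₂ c (cobd R X k φ)) := by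
  induction c using Finsupp.induction_linear with
  | zero => simp
  | add x y hx hy => simp only [map_add, LinearMap.add_apply, hx, hy, ← smul_add]; congr 1; abel
  | single σ a =>
    have ha : Finsupp.single σ a = a • Finsupp.single σ (1 : R) := by simp
    rw [ha]
    simp only [map_smul, LinearMap.smul_apply]
    rw [← smul_sub, smul_comm ((-1 : R) ^ k) a]
    congr 1
    subst h
    rw [cap_single, cap_single, map_smul, bd_single', bd_single', map_sum, LinearMap.sum_apply]
    have e1 : cobd R X k φ (Finsupp.single (pull (front h₂) σ) 1) =
        φ (bd R X k (Finsupp.single (pull (front h₂) σ) 1)) := rfl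
    rw [e1, bd_single', map_sum]
    simp only [map_smul, LinearMap.smul_apply, cap_single, pull_pull]
    have f1 : ∀ i ≤ k, skip (k + m) i ∘ front (rfl : k + m = k + m) = front h₂ ∘ skip k i := by
      intro i hi; funext j; simp only [skip_val, front, Function.comp, Fin.ext_iff]
    have f2 : ∀ i ≤ k, skip (k + m) i ∘ back (rfl : k + m = k + m) = back h₂ := by
      intro i hi; funext j; simp only [skip_val, back, Function.comp, Fin.ext_iff]
      split_ifs <;> omega
    have f3 : ∀ i, skip (k + m) (k + 1 + i) ∘ front (rfl : k + m = k + m) = front h₁ := by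
      intro i; funext j; simp only [skip_val, front, Function.comp, Fin.ext_iff]
      split_ifs <;> omega
    have f4 : ∀ i, skip (k + m) (k + 1 + i) ∘ back (rfl : k + m = k + m) =
        back h₁ ∘ skip m (i + 1) := by
      intro i; funext j; simp only [skip_val, back, Function.comp, Fin.ext_iff]
      split_ifs <;> omega
    have f5 : front h₂ ∘ skip k (k + 1) = front h₁ := by
      funext j; simp only [skip_val, front, Function.comp, Fin.ext_iff]
      split_ifs <;> omega
    have f6 : back h₂ = back h₁ ∘ skip m 0 := by
      funext j; simp only [skip_val, back, Function.comp, Fin.ext_iff]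
      split_ifs <;> omega
    have s1 : Finset.range (k + m + 2) = Finset.range ((k + 1) + (m + 1)) := by
      congr 1; omega
    rw [s1, Finset.sum_range_add _ (k + 1) (m + 1), Finset.sum_range_succ _ (k + 1), add_smul, Finset.sum_smul,
      Finset.sum_range_succ' _ (m + 1)]
    have t1 : ∑ x ∈ Finset.range (k + 1), (-1 : R) ^ x •
          φ (Finsupp.single (pull (skip (k + m) x ∘ front (rfl : k + m = k + m)) σ) 1) •
            Finsupp.single (pull (skip (k + m) x ∘ back (rfl : k + m = k + m)) σ) (1 : R) =
        ∑ i ∈ Finset.range (k + 1),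
          ((-1 : R) ^ i • φ (Finsupp.single (pull (front h₂ ∘ skip k i) σ) 1)) •
            Finsupp.single (pull (back h₂) σ) (1 : R) := by
      refine Finset.sum_congr rfl fun i hi => ?_
      have hi' : i ≤ k := by simpa [Nat.lt_succ_iff] using hi
      rw [f1 i hi', f2 i hi', smul_assoc]
    rw [t1, f5, f6]
    simp only [f3, f4, smul_add, smul_sub, Finset.smul_sum]
    have hk : ((-1 : R) ^ k) * (-1) ^ k = 1 := by rw [← mul_pow]; simp
    have t2 : ∀ x, (-1 : R) ^ k • (-1 : R) ^ (k + 1 + x) •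
          φ (Finsupp.single (pull (front h₁) σ) 1) •
            Finsupp.single (pull (back h₁ ∘ skip m (x + 1)) σ) (1 : R) =
        φ (Finsupp.single (pull (front h₁) σ) 1) • (-1 : R) ^ (x + 1) •
            Finsupp.single (pull (back h₁ ∘ skip m (x + 1)) σ) (1 : R) := by
      intro x
      simp only [smul_smul]
      congr 1
      linear_combination (-1 : R) ^ (x + 1) * φ (Finsupp.single (pull (front h₁) σ) 1) * hk
    have t3 : (-1 : R) ^ k • ((-1 : R) ^ (k + 1) • φ (Finsupp.single (pull (front h₁) σ) 1)) •
          Finsupp.single (pull (back h₁ ∘ skip m 0) σ) (1 : R) =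
        - (φ (Finsupp.single (pull (front h₁) σ) 1) • (-1 : R) ^ 0 •
          Finsupp.single (pull (back h₁ ∘ skip m 0) σ) (1 : R)) := by
      rw [← neg_smul]
      simp only [smul_smul, smul_eq_mul]
      congr 1
      linear_combination (- φ (Finsupp.single (pull (front h₁) σ) 1)) * hk
    rw [t3, Finset.sum_congr rfl fun x _ => t2 x]
    abel

end SingularChains

section Ends

variable {X : Type u} [TopologicalSpace X]

/-- An end of `X` with respect to an exhaustion `K 0 ⊆ K 1 ⊆ ⋯` by compact sets: a decreasing
sequence whose `i`-th term is a connected component of `X \ K i`. -/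
structure EndOf (K : CompactExhaustion X) where
  toFun : ℕ → Set X
  isComponent : ∀ i, ∃ x ∈ (K i)ᶜ, toFun i = connectedComponentIn (K i)ᶜ x
  antitone : Antitone toFun

/-- `∂_∞ V`: the ends `(U i)` of `X` with `U i ⊆ V` for all sufficiently large `i`. -/
def endsOf (K : CompactExhaustion X) (V : Set X) : Set (EndOf K) :=
  {e | ∃ i₀, ∀ i ≥ i₀, e.toFun i ⊆ V}

/-- `∂_∞ X = ∂_∞ A ⊔ ∂_∞ B`, where `A` and `B` are subsets of `X` with compact boundary. -/
structure IsEndsDecomposition (K : CompactExhaustion X) (A B : Set X) : Prop where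
  isCompact_frontier_left : IsCompact (frontier A)
  isCompact_frontier_right : IsCompact (frontier B)
  union_eq : endsOf K A ∪ endsOf K B = endsOf K univ
  disjoint : Disjoint (endsOf K A) (endsOf K B)

/-- Far out, `A` and `B` are open, disjoint and cover `X`. -/
def SeparatedAtInfinity (K : CompactExhaustion X) (A B : Set X) : Prop :=
  ∃ i₀, ∀ i ≥ i₀, IsOpen (A \ K i) ∧ IsOpen (B \ K i) ∧ Disjoint (A \ K i) (B \ K i) ∧
    (K i)ᶜ ⊆ A ∪ B

theorem subset_of_disjoint_frontier {S W : Set X} (hW : IsPreconnected W)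
    (h : Disjoint W (frontier S)) {x : X} (hxW : x ∈ W) (hxS : x ∈ S) : W ⊆ S := by
  have h1 : W ⊆ interior S ∪ (closure S)ᶜ := by
    intro y hy
    by_cases hyi : y ∈ interior S
    · exact Or.inl hyi
    · exact Or.inr fun hyc => Set.disjoint_left.1 h hy ⟨hyc, hyi⟩
  have hxi : x ∈ interior S := by
    rcases h1 hxW with h2 | h2
    · exact h2
    · exact absurd (subset_closure hxS) h2
  refine (hW.subset_left_of_subset_union isOpen_interior isClosed_closure.isOpen_compl ?_ h1
    ⟨x, hxW, hxi⟩).trans interior_subset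
  exact Set.disjoint_compl_right_iff_subset.2 (interior_subset.trans subset_closure)

theorem exists_unbounded_component [T2Space X] [LocallyConnectedSpace X]
    (hX : ∀ x : X, ¬ IsCompact (connectedComponent x)) (K : CompactExhaustion X) (i : ℕ)
    {P : Set X} (hPK : P ⊆ (K i)ᶜ) (hP : ∀ j, ¬ P ⊆ K j) :
    ∃ x ∈ P, ∀ j, ¬ connectedComponentIn (K i)ᶜ x ⊆ K j := by
  by_contra! hb
  have hKc : ∀ j, IsClosed (K j) := fun j => (K.isCompact j).isClosed
  set F := frontier (K (i + 1)) with hF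
  have hFc : IsCompact F := (K.isCompact _).of_isClosed_subset isClosed_frontier
    (hKc _).frontier_subset
  have hFK : F ⊆ (K i)ᶜ := fun y hy hyK => hy.2 (K.subset_interior_succ i hyK)
  have key : ∀ x ∈ P, x ∉ K (i + 1) → (connectedComponentIn (K i)ᶜ x ∩ F).Nonempty := by
    intro x hxP hxK
    by_contra hne
    set W := connectedComponentIn (K i)ᶜ x with hW
    have hxW : x ∈ W := mem_connectedComponentIn (hPK hxP)
    have hWd : Disjoint W (frontier (K (i + 1))ᶜ) := by
      rw [frontier_compl, Set.disjoint_iff_inter_eq_empty]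
      exact Set.not_nonempty_iff_eq_empty.1 hne
    have hWK : W ⊆ (K (i + 1))ᶜ :=
      subset_of_disjoint_frontier isPreconnected_connectedComponentIn hWd hxW hxK
    have hcl : closure W ⊆ W := by
      refine IsPreconnected.subset_connectedComponentIn
        isPreconnected_connectedComponentIn.closure (subset_closure hxW) ?_
      intro y hy hyK
      have h2 := closure_mono hWK hy
      rw [closure_compl] at h2
      exact h2 (K.subset_interior_succ i hyK)
    have hWclopen : IsClopen W :=
      ⟨isClosed_of_closure_subset hcl, (hKc i).isOpen_compl.connectedComponentIn⟩
    obtain ⟨j, hj⟩ := hb x hxP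
    exact hX x ((K.isCompact j).of_isClosed_subset isClosed_connectedComponent
      ((hWclopen.connectedComponent_subset hxW).trans hj))
  obtain ⟨t, ht⟩ := hFc.elim_finite_subcover
    (fun y : X => connectedComponentIn (K i)ᶜ y)
    (fun y => (hKc i).isOpen_compl.connectedComponentIn)
    (fun y hy => mem_iUnion.2 ⟨y, mem_connectedComponentIn (hFK hy)⟩)
  classical
  let J : X → ℕ := fun y =>
    if h : ∃ j, connectedComponentIn (K i)ᶜ y ⊆ K j then h.choose else 0
  have hJ : ∀ y, (∃ j, connectedComponentIn (K i)ᶜ y ⊆ K j) →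
      connectedComponentIn (K i)ᶜ y ⊆ K (J y) := by
    intro y h
    simp only [J, dif_pos h]
    exact h.choose_spec
  refine hP (max (i + 1) (t.sup J)) fun x hxP => ?_
  by_cases hxK : x ∈ K (i + 1)
  · exact K.subset (le_max_left _ _) hxK
  · obtain ⟨z, hzx, hzF⟩ := key x hxP hxK
    obtain ⟨y, hyt, hzy⟩ := mem_iUnion₂.1 (ht hzF)
    have hxy : connectedComponentIn (K i)ᶜ x = connectedComponentIn (K i)ᶜ y :=
      (connectedComponentIn_eq hzx).trans (connectedComponentIn_eq hzy).symm
    have h1 := hJ y (hxy ▸ hb x hxP)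
    exact K.subset ((Finset.le_sup hyt).trans (le_max_right _ _))
      (h1 (hxy ▸ mem_connectedComponentIn (hPK hxP)))

theorem exists_end_subset [T2Space X] [LocallyConnectedSpace X]
    (hX : ∀ x : X, ¬ IsCompact (connectedComponent x)) (K : CompactExhaustion X) {S : Set X}
    {i₀ : ℕ} (hS : frontier S ⊆ K i₀) (hSu : ∀ j, ¬ S ⊆ K j) :
    ∃ e : EndOf K, ∀ i ≥ i₀, e.toFun i ⊆ S := by
  let Q : ℕ → X → Prop := fun i y =>
    y ∈ (K i)ᶜ ∧ ∀ j, ¬ connectedComponentIn (K i)ᶜ y ⊆ K j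
  have start : ∃ y, y ∈ S ∧ Q i₀ y := by
    obtain ⟨x, hx, hx'⟩ := exists_unbounded_component hX K i₀ (P := S \ K i₀)
      (fun y hy => hy.2) (fun j hj => hSu (max i₀ j) fun y hy => by
        by_cases hyK : y ∈ K i₀
        · exact K.subset (le_max_left _ _) hyK
        · exact K.subset (le_max_right _ _) (hj ⟨hy, hyK⟩))
    exact ⟨x, hx.1, hx.2, hx'⟩
  have step : ∀ i y, Q i y → ∃ y', Q (i + 1) y' ∧ y' ∈ connectedComponentIn (K i)ᶜ y := by
    intro i y hy
    obtain ⟨x, hx, hx'⟩ := exists_unbounded_component hX K (i + 1)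
      (P := connectedComponentIn (K i)ᶜ y \ K (i + 1))
      (fun y hy => hy.2) (fun j hj => hy.2 (max (i + 1) j) fun z hz => by
        by_cases hzK : z ∈ K (i + 1)
        · exact K.subset (le_max_left _ _) hzK
        · exact K.subset (le_max_right _ _) (hj ⟨hz, hzK⟩))
    exact ⟨x, ⟨hx.2, hx'⟩, hx.1⟩
  obtain ⟨y₀, hy₀S, hy₀⟩ := start
  choose! next hnext hmem using step
  let s : ℕ → X := fun k => Nat.rec y₀ (fun k y => next (i₀ + k) y) k
  have hs : ∀ k, Q (i₀ + k) (s k) := by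
    intro k
    induction k with
    | zero => exact hy₀
    | succ k ih => exact hnext _ _ ih
  have hs' : ∀ k, s (k + 1) ∈ connectedComponentIn (K (i₀ + k))ᶜ (s k) :=
    fun k => hmem _ _ (hs k)
  let U : ℕ → Set X := fun i => connectedComponentIn (K i)ᶜ (s (i - i₀))
  have hanti : Antitone U := by
    refine antitone_nat_of_succ_le fun i => ?_
    have hKK : (K (i + 1) : Set X)ᶜ ⊆ (K i)ᶜ := compl_subset_compl.2 (K.subset_succ i)
    rcases lt_or_ge i i₀ with hi | hi
    · have e1 : i + 1 - i₀ = i - i₀ := by omega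
      simp only [U, e1]
      exact connectedComponentIn_mono _ hKK
    · obtain ⟨k, rfl⟩ := Nat.exists_eq_add_of_le hi
      have e1 : i₀ + k + 1 - i₀ = k + 1 := by omega
      have e2 : i₀ + k - i₀ = k := by omega
      simp only [U, e1, e2]
      rw [connectedComponentIn_eq (hs' k)]
      exact connectedComponentIn_mono _ hKK
  refine ⟨⟨U, fun i => ⟨s (i - i₀), ?_, rfl⟩, hanti⟩, fun i hi => (hanti hi).trans ?_⟩
  · intro h
    exact (hs (i - i₀)).1 (K.subset (by omega) h)
  · simp only [U, Nat.sub_self]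
    refine subset_of_disjoint_frontier isPreconnected_connectedComponentIn ?_
      (mem_connectedComponentIn hy₀.1) hy₀S
    exact Set.disjoint_left.2 fun z hz hzF => connectedComponentIn_subset _ _ hz (hS hzF)

theorem IsEndsDecomposition.separatedAtInfinity [T2Space X] [LocallyConnectedSpace X]
    (hX : ∀ x : X, ¬ IsCompact (connectedComponent x)) {K : CompactExhaustion X} {A B : Set X}
    (h : IsEndsDecomposition K A B) : SeparatedAtInfinity K A B := by
  obtain ⟨a, ha⟩ := K.exists_superset_of_isCompact
    (h.isCompact_frontier_left.union h.isCompact_frontier_right)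
  have haA : frontier A ⊆ K a := subset_union_left.trans ha
  have haB : frontier B ⊆ K a := subset_union_right.trans ha
  have hne : ∀ (e : EndOf K) i, (e.toFun i).Nonempty := by
    intro e i
    obtain ⟨x, hx, he⟩ := e.isComponent i
    exact he ▸ ⟨x, mem_connectedComponentIn hx⟩
  have h1 : ∃ j, A ∩ B ⊆ K j := by
    by_contra! hu
    obtain ⟨e, he⟩ := exists_end_subset hX K (S := A ∩ B) (i₀ := a) (by
      intro x hx
      rcases frontier_inter_subset A B hx with h2 | h2
      · exact haA h2.1
      · exact haB h2.2) hu
    exact Set.disjoint_left.1 h.disjoint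
      (⟨a, fun i hi => (he i hi).trans inter_subset_left⟩ : e ∈ endsOf K A)
      ⟨a, fun i hi => (he i hi).trans inter_subset_right⟩
  have h2 : ∃ j, (A ∪ B)ᶜ ⊆ K j := by
    by_contra! hu
    obtain ⟨e, he⟩ := exists_end_subset hX K (S := (A ∪ B)ᶜ) (i₀ := a) (by
      intro x hx
      rw [frontier_compl] at hx
      rcases frontier_union_subset A B hx with h2 | h2
      · exact haA h2.1
      · exact haB h2.2) hu
    have hmem : e ∈ endsOf K A ∪ endsOf K B := by
      rw [h.union_eq]
      exact ⟨0, fun i _ => subset_univ _⟩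
    rcases hmem with ⟨j, hj⟩ | ⟨j, hj⟩
    · obtain ⟨x, hx⟩ := hne e (max a j)
      exact he _ (le_max_left _ _) hx (Or.inl (hj _ (le_max_right _ _) hx))
    · obtain ⟨x, hx⟩ := hne e (max a j)
      exact he _ (le_max_left _ _) hx (Or.inr (hj _ (le_max_right _ _) hx))
  obtain ⟨b, hb⟩ := h1
  obtain ⟨c, hc⟩ := h2
  have hop : ∀ S : Set X, frontier S ⊆ K a → ∀ i ≥ a, IsOpen (S \ K i) := by
    intro S hS i hi
    have : S \ K i = interior S \ K i := by
      ext x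
      constructor
      · rintro ⟨hx, hxK⟩
        refine ⟨?_, hxK⟩
        by_contra hxi
        exact hxK (K.subset hi (hS ⟨subset_closure hx, hxi⟩))
      · rintro ⟨hx, hxK⟩
        exact ⟨interior_subset hx, hxK⟩
    rw [this]
    exact isOpen_interior.sdiff (K.isCompact i).isClosed
  refine ⟨max a (max b c), fun i hi => ?_⟩
  have hia : a ≤ i := by omega
  have hib : b ≤ i := by omega
  have hic : c ≤ i := by omega
  refine ⟨hop A haA i hia, hop B haB i hia, ?_, ?_⟩
  · exact Set.disjoint_left.2 fun x hx hx' => hx.2 (K.subset hib (hb ⟨hx.1, hx'.1⟩))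
  · intro x hx
    by_contra hxn
    exact hx (K.subset hic (hc hxn))

end Ends

section Relative

variable (R : Type) [CommRing R] {X : Type u} [TopologicalSpace X]

/-- `C_n(X, U) = C_n(X) / C_n(U)`. -/
abbrev RelChain (U : Set X) (n : ℕ) : Type u := Chain R X n ⧸ chainsIn R U n

/-- The boundary of `C_*(X, U)`. -/
def relBd (U : Set X) (n : ℕ) : RelChain R U (n + 1) →ₗ[R] RelChain R U n :=
  Submodule.mapQ _ _ (bd R X n) (bd_mem U n)

/-- The map `C_n(X, U) → C_n(X, V)` for `U ⊆ V`. -/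
def relMap {U V : Set X} (h : U ⊆ V) (n : ℕ) : RelChain R U n →ₗ[R] RelChain R V n :=
  Submodule.factor (chainsIn_mono h n)

/-- The relative homology group `H_n(X, U)`. -/
abbrev RelHomology (U : Set X) (n : ℕ) : Type u :=
  Homology (R := R) (C := fun n => RelChain R U n) (relBd R U) n

variable {R}

theorem relBd_relMap {U V : Set X} (h : U ⊆ V) (n : ℕ) (x : RelChain R U (n + 1)) :
    relBd R V n (relMap R h (n + 1) x) = relMap R h n (relBd R U n x) := by
  obtain ⟨c, rfl⟩ := Submodule.mkQ_surjective _ x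
  rfl

/-- The map `H_n(X, U) → H_n(X, V)` for `U ⊆ V`. -/
def RelHomology.map {U V : Set X} (h : U ⊆ V) (n : ℕ) :
    RelHomology R U n →ₗ[R] RelHomology R V n :=
  Homology.map (relMap R h) (relBd_relMap h) n

end Relative

section AtInfinity

variable (R : Type) [CommRing R] {X : Type u} [TopologicalSpace X] (K : CompactExhaustion X)

theorem diff_subset_diff_of_le (V : Set X) {i j : ℕ} (h : i ≤ j) : V \ K j ⊆ V \ K i :=
  sdiff_subset_sdiff_right (K.subset h)

/-- Families of chains, the `i`-th one in `C_n(X, V \ K i)`. -/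
def EndFamily (V : Set X) (n : ℕ) : Type u := ∀ i, RelChain R (V \ K i) n

instance (V : Set X) (n : ℕ) : AddCommGroup (EndFamily R K V n) :=
  inferInstanceAs (AddCommGroup (∀ i, RelChain R (V \ K i) n))

instance (V : Set X) (n : ℕ) : Module R (EndFamily R K V n) :=
  inferInstanceAs (Module R (∀ i, RelChain R (V \ K i) n))

/-- The `i`-th member of a family. -/
def EndFamily.proj (V : Set X) (i n : ℕ) : EndFamily R K V n →ₗ[R] RelChain R (V \ K i) n where
  toFun c := c i
  map_add' _ _ := rfl
  map_smul' _ _ := rfl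

/-- The memberwise boundary of a family. -/
def EndFamily.bd (V : Set X) (n : ℕ) : EndFamily R K V (n + 1) →ₗ[R] EndFamily R K V n where
  toFun c i := relBd R (V \ K i) n (c i)
  map_add' _ _ := funext fun _ => map_add _ _ _
  map_smul' r c := funext fun i => (relBd R (V \ K i) n).map_smul r (c i)

/-- `C_n(X, ∂_∞ V)`, the inverse limit of the groups `C_n(X, V \ K i)`, realised as the group
of compatible families. -/
def EndChain (V : Set X) (n : ℕ) : Submodule R (EndFamily R K V n) where
  carrier := {c | ∀ i j (h : i ≤ j), relMap R (diff_subset_diff_of_le K V h) n (c j) = c i}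
  zero_mem' := fun i j h => map_zero _
  add_mem' := fun {a b} ha hb i j h => by
    have e : relMap R (diff_subset_diff_of_le K V h) n (a j + b j) = a i + b i := by
      rw [map_add, ha i j h, hb i j h]
    exact e
  smul_mem' := fun r a ha i j h => by
    have e : relMap R (diff_subset_diff_of_le K V h) n (r • a j) = r • a i := by
      rw [map_smul, ha i j h]
    exact e

/-- The boundary of `C_*(X, ∂_∞ V)`. -/
def endBd (V : Set X) (n : ℕ) : EndChain R K V (n + 1) →ₗ[R] EndChain R K V n :=
  (EndFamily.bd R K V n).restrict (by
    intro c hc i j h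
    change relMap R _ n (relBd R _ n (c j)) = relBd R _ n (c i)
    rw [← relBd_relMap, hc i j h])

/-- `H_n(X, ∂_∞ V)`. -/
abbrev EndHomology (V : Set X) (n : ℕ) : Type u :=
  Homology (R := R) (C := fun n => EndChain R K V n) (endBd R K V) n

/-- `C^k(X, ∂_∞ V)`, the direct limit of the groups `C^k(X, V \ K i)` of cochains vanishing on
`C_k(V \ K i)`. The transition maps are inclusions of submodules of `C^k(X)`, so that the direct
limit is the increasing union. -/
def EndCochain (V : Set X) (k : ℕ) : Submodule R (Cochain R X k) where
  carrier := {φ | ∃ i, ∀ c ∈ chainsIn R (V \ K i) k, φ c = 0}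
  zero_mem' := ⟨0, fun c _ => rfl⟩
  add_mem' := by
    rintro φ ψ ⟨i, hi⟩ ⟨j, hj⟩
    refine ⟨max i j, fun c hc => ?_⟩
    change φ c + ψ c = 0
    rw [hi c (chainsIn_mono (diff_subset_diff_of_le K V (le_max_left i j)) k hc),
      hj c (chainsIn_mono (diff_subset_diff_of_le K V (le_max_right i j)) k hc), add_zero]
  smul_mem' := by
    rintro r φ ⟨i, hi⟩
    exact ⟨i, fun c hc => (congrArg (r • ·) (hi c hc)).trans (smul_zero r)⟩

/-- The coboundary of `C^*(X, ∂_∞ V)`. -/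
def endCobd (V : Set X) (k : ℕ) : EndCochain R K V k →ₗ[R] EndCochain R K V (k + 1) :=
  (cobd R X k).restrict (by
    rintro φ ⟨i, hi⟩
    exact ⟨i, fun c hc => hi _ (bd_mem _ _ hc)⟩)

/-- `H^k(X, ∂_∞ V)`. -/
abbrev EndCohomology (V : Set X) (k : ℕ) : Type u :=
  Cohomology (R := R) (C := fun k => EndCochain R K V k) (endCobd R K V) k

variable {R}

/-- The projection `H_n(X, ∂_∞ V) → H_n(X, V \ K i)`. -/
def EndHomology.proj (V : Set X) (i n : ℕ) :
    EndHomology R K V n →ₗ[R] RelHomology R (V \ K i) n :=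
  Homology.map (C := fun n => EndChain R K V n) (C' := fun n => RelChain R (V \ K i) n)
    (fun n => (EndFamily.proj R K V i n).comp (EndChain R K V n).subtype) (fun _ _ => rfl) n

theorem univ_diff_subset_compl {x : X} {i : ℕ} (h : x ∈ K i) : univ \ K i ⊆ ({x}ᶜ : Set X) := by
  rintro y hy rfl
  exact hy.2 h

/-- A fundamental class: an element of `H_n(X, ∂_∞ X)` which for every point `x` restricts to a
generator of `H_n(X, X \ {x})`. -/
def IsFundamentalClass {n : ℕ} (μ : EndHomology R K univ n) : Prop :=
  ∀ (x : X) (i : ℕ) (h : x ∈ K i),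
    Submodule.span R {RelHomology.map (univ_diff_subset_compl K h) n
      (EndHomology.proj K univ i n μ)} = ⊤

end AtInfinity

/-- A topological `n`-manifold is orientable if generators of the local homology groups
`H_n(M, M \ {x})` can be chosen consistently: near every point they are the restrictions of one
class in `H_n(M, M \ U)`. -/
def IsOrientable (n : ℕ) (M : Type u) [TopologicalSpace M] : Prop :=
  ∃ o : ∀ x : M, RelHomology ℤ ({x}ᶜ : Set M) n,
    (∀ x, Submodule.span ℤ {o x} = ⊤) ∧
    ∀ x, ∃ U ∈ 𝓝 x, ∃ β : RelHomology ℤ (Uᶜ : Set M) n,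
      ∀ (y : M) (hy : y ∈ U),
        RelHomology.map (compl_subset_compl.2 (singleton_subset_iff.2 hy)) n β = o y

section Cap

variable {R : Type} [CommRing R] {X : Type u} [TopologicalSpace X] {K : CompactExhaustion X}

theorem simplex_mem_or {U V W : Set X} (hU : IsOpen U) (hV : IsOpen V) (hd : Disjoint U V)
    (hW : W ⊆ U ∪ V) {n : ℕ} {σ : Simp X n} (hσ : σ ∈ simplicesIn W n) :
    σ ∈ simplicesIn U n ∨ σ ∈ simplicesIn V n := by
  have hpre : IsPreconnected (range σ) := isPreconnected_range σ.continuous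
  rcases hpre.subset_or_subset hU hV hd (by
    rintro _ ⟨t, rfl⟩
    exact hW (hσ t)) with h | h
  · exact Or.inl fun t => h ⟨t, rfl⟩
  · exact Or.inr fun t => h ⟨t, rfl⟩

/-- If a cochain vanishes on `A`, then capping sends chains in `A ⊔ B` to chains in `B`. -/
theorem cap_mem {U V W : Set X} (hU : IsOpen U) (hV : IsOpen V) (hd : Disjoint U V)
    (hW : W ⊆ U ∪ V) {n k m : ℕ} (h : k + m = n) {φ : Cochain R X k}
    (hφ : ∀ c ∈ chainsIn R U k, φ c = 0) {c : Chain R X n} (hc : c ∈ chainsIn R W n) :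
    cap h c φ ∈ chainsIn R V m := by
  have key : chainsIn R W n ≤ (chainsIn R V m).comap ((cap (R := R) (X := X) h).flip φ) := by
    refine chainsIn_le fun σ hσ => ?_
    rw [Submodule.mem_comap, LinearMap.flip_apply, cap_single]
    rcases simplex_mem_or hU hV hd hW hσ with h' | h'
    · rw [hφ _ (single_mem (pull_mem _ h') 1), zero_smul]
      exact Submodule.zero_mem _
    · exact Submodule.smul_mem _ _ (single_mem (pull_mem _ h') 1)
  exact key hc

variable {A B : Set X}

/-- A level beyond which `A` and `B` are separated and `φ` vanishes on `A`. -/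
theorem exists_level (hAB : SeparatedAtInfinity K A B) {k : ℕ} {φ : Cochain R X k}
    (hφ : φ ∈ EndCochain R K A k) :
    ∃ l, ∀ i ≥ l, (IsOpen (A \ K i) ∧ IsOpen (B \ K i) ∧ Disjoint (A \ K i) (B \ K i) ∧
      (K i)ᶜ ⊆ A ∪ B) ∧ ∀ c ∈ chainsIn R (A \ K i) k, φ c = 0 := by
  obtain ⟨i₀, h₀⟩ := hAB
  obtain ⟨i₁, h₁⟩ := hφ
  exact ⟨max i₀ i₁, fun i hi => ⟨h₀ i (le_trans (le_max_left _ _) hi), fun c hc =>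
    h₁ c (chainsIn_mono (diff_subset_diff_of_le K A (le_trans (le_max_right _ _) hi)) k hc)⟩⟩

theorem cap_level {n k m : ℕ} (h : k + m = n) {φ : Cochain R X k} {i j l : ℕ} (hjl : j ≤ l)
    (hli : l ≤ i)
    (hl : (IsOpen (A \ K l) ∧ IsOpen (B \ K l) ∧ Disjoint (A \ K l) (B \ K l) ∧
      (K l)ᶜ ⊆ A ∪ B) ∧ ∀ c ∈ chainsIn R (A \ K l) k, φ c = 0)
    {c : EndFamily R K univ n} (hc : c ∈ EndChain R K univ n) {a b : Chain R X n}
    (ha : (chainsIn R (univ \ K i) n).mkQ a = c i) (hb : (chainsIn R (univ \ K l) n).mkQ b = c l) :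
    (chainsIn R (B \ K j) m).mkQ (cap h a φ) = (chainsIn R (B \ K j) m).mkQ (cap h b φ) := by
  have h1 : (chainsIn R (univ \ K l) n).mkQ a = (chainsIn R (univ \ K l) n).mkQ b := by
    rw [hb, ← hc l i hli, ← ha]
    rfl
  have h2 : a - b ∈ chainsIn R (univ \ K l) n := (Submodule.Quotient.eq _).1 h1
  refine (Submodule.Quotient.eq _).2 ?_
  have h3 : cap h a φ - cap h b φ = cap h (a - b) φ :=
    (((cap (R := R) (X := X) h).flip φ).map_sub a b).symm
  rw [h3]
  refine chainsIn_mono (diff_subset_diff_of_le K B hjl) m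
    (cap_mem hl.1.1 hl.1.2.1 hl.1.2.2.1 ?_ h hl.2 h2)
  rintro x ⟨-, hx⟩
  rcases hl.1.2.2.2 hx with h' | h'
  · exact Or.inl ⟨h', hx⟩
  · exact Or.inr ⟨h', hx⟩

/-- The `j`-th component of `c ⌢ φ`: cap a representative of a component of `c` far out. -/
def capFun (hAB : SeparatedAtInfinity K A B) {n k m : ℕ} (h : k + m = n)
    (c : EndChain R K univ n) (φ : EndCochain R K A k) (j : ℕ) : RelChain R (B \ K j) m :=
  (chainsIn R (B \ K j) m).mkQ
    (cap h (Submodule.mkQ_surjective _ (c.1 (max j (exists_level hAB φ.2).choose))).choose φ.1)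

/-- The `j`-th component of `c ⌢ φ` may be computed from any representative of any component of
`c` that is far enough out. -/
theorem capFun_eq (hAB : SeparatedAtInfinity K A B) {n k m : ℕ} (h : k + m = n)
    (c : EndChain R K univ n) (φ : EndCochain R K A k) :
    ∃ l₀, ∀ j l, l₀ ≤ l → j ≤ l → ∀ a : Chain R X n,
      (chainsIn R (univ \ K l) n).mkQ a = c.1 l →
        capFun hAB h c φ j = (chainsIn R (B \ K j) m).mkQ (cap h a φ.1) := by
  set l₀ := (exists_level hAB φ.2).choose with hl₀
  have hsp := (exists_level hAB φ.2).choose_spec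
  refine ⟨l₀, fun j l hl hj a ha => ?_⟩
  exact (cap_level h (le_max_left j l₀) (max_le hj hl) (hsp _ (le_max_right j l₀)) c.2 ha
    (Submodule.mkQ_surjective _ (c.1 (max j l₀))).choose_spec).symm

theorem capFun_mem (hAB : SeparatedAtInfinity K A B) {n k m : ℕ} (h : k + m = n)
    (c : EndChain R K univ n) (φ : EndCochain R K A k) :
    (capFun hAB h c φ : EndFamily R K B m) ∈ EndChain R K B m := by
  obtain ⟨l₀, hl₀⟩ := capFun_eq hAB h c φ
  intro i j hij
  obtain ⟨a, ha⟩ := Submodule.mkQ_surjective _ (c.1 (max j l₀))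
  rw [hl₀ j _ (le_max_right _ _) (le_max_left _ _) a ha,
    hl₀ i _ (le_max_right _ _) (hij.trans (le_max_left _ _)) a ha]
  rfl

/-- The cap product `C_n(X, ∂_∞ X) × C^k(X, ∂_∞ A) → C_m(X, ∂_∞ B)` of chains and cochains. -/
def endCap (hAB : SeparatedAtInfinity K A B) {n k m : ℕ} (h : k + m = n) :
    EndChain R K univ n →ₗ[R] EndCochain R K A k →ₗ[R] EndChain R K B m :=
  LinearMap.mk₂ R (fun c φ => ⟨capFun hAB h c φ, capFun_mem hAB h c φ⟩)
    (by
      intro c c' φ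
      refine Subtype.ext (funext fun j => ?_)
      obtain ⟨l₁, h₁⟩ := capFun_eq hAB h c φ
      obtain ⟨l₂, h₂⟩ := capFun_eq hAB h c' φ
      obtain ⟨l₃, h₃⟩ := capFun_eq hAB h (c + c') φ
      obtain ⟨l, e1, e2, e3, e4⟩ : ∃ l, l₁ ≤ l ∧ l₂ ≤ l ∧ l₃ ≤ l ∧ j ≤ l :=
        ⟨l₁ + l₂ + l₃ + j, by omega, by omega, by omega, by omega⟩
      obtain ⟨a, ha⟩ := Submodule.mkQ_surjective _ (c.1 l)
      obtain ⟨b, hb⟩ := Submodule.mkQ_surjective _ (c'.1 l)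
      change capFun hAB h (c + c') φ j = capFun hAB h c φ j + capFun hAB h c' φ j
      rw [h₁ j l e1 e4 a ha, h₂ j l e2 e4 b hb,
        h₃ j l e3 e4 (a + b) (by rw [map_add, ha, hb]; rfl), ← map_add, map_add (cap h)]
      rfl)
    (by
      intro r c φ
      refine Subtype.ext (funext fun j => ?_)
      obtain ⟨l₁, h₁⟩ := capFun_eq hAB h c φ
      obtain ⟨l₂, h₂⟩ := capFun_eq hAB h (r • c) φ
      obtain ⟨l, e1, e2, e4⟩ : ∃ l, l₁ ≤ l ∧ l₂ ≤ l ∧ j ≤ l :=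
        ⟨l₁ + l₂ + j, by omega, by omega, by omega⟩
      obtain ⟨a, ha⟩ := Submodule.mkQ_surjective _ (c.1 l)
      change capFun hAB h (r • c) φ j = r • capFun hAB h c φ j
      rw [h₁ j l e1 e4 a ha, h₂ j l e2 e4 (r • a) (by rw [map_smul, ha]; rfl), ← map_smul,
        map_smul (cap h)]
      rfl)
    (by
      intro c φ ψ
      refine Subtype.ext (funext fun j => ?_)
      obtain ⟨l₁, h₁⟩ := capFun_eq hAB h c φ
      obtain ⟨l₂, h₂⟩ := capFun_eq hAB h c ψ
      obtain ⟨l₃, h₃⟩ := capFun_eq hAB h c (φ + ψ)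
      obtain ⟨l, e1, e2, e3, e4⟩ : ∃ l, l₁ ≤ l ∧ l₂ ≤ l ∧ l₃ ≤ l ∧ j ≤ l :=
        ⟨l₁ + l₂ + l₃ + j, by omega, by omega, by omega, by omega⟩
      obtain ⟨a, ha⟩ := Submodule.mkQ_surjective _ (c.1 l)
      change capFun hAB h c (φ + ψ) j = capFun hAB h c φ j + capFun hAB h c ψ j
      rw [h₁ j l e1 e4 a ha, h₂ j l e2 e4 a ha, h₃ j l e3 e4 a ha, ← map_add, ← map_add]
      rfl)
    (by
      intro r c φ
      refine Subtype.ext (funext fun j => ?_)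
      obtain ⟨l₁, h₁⟩ := capFun_eq hAB h c φ
      obtain ⟨l₂, h₂⟩ := capFun_eq hAB h c (r • φ)
      obtain ⟨l, e1, e2, e4⟩ : ∃ l, l₁ ≤ l ∧ l₂ ≤ l ∧ j ≤ l :=
        ⟨l₁ + l₂ + j, by omega, by omega, by omega⟩
      obtain ⟨a, ha⟩ := Submodule.mkQ_surjective _ (c.1 l)
      change capFun hAB h c (r • φ) j = r • capFun hAB h c φ j
      rw [h₁ j l e1 e4 a ha, h₂ j l e2 e4 a ha, ← map_smul, ← map_smul]
      rfl)

/-- The Leibniz rule for the cap product at infinity. -/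
theorem endBd_endCap (hAB : SeparatedAtInfinity K A B) {n k m : ℕ} (h : k + m = n)
    (h₁ : k + (m + 1) = n + 1) (h₂ : k + 1 + m = n + 1)
    (c : EndChain R K univ (n + 1)) (φ : EndCochain R K A k) :
    endBd R K B m (endCap hAB h₁ c φ) = (-1 : R) ^ k •
      (endCap hAB h (endBd R K univ n c) φ - endCap hAB h₂ c (endCobd R K A k φ)) := by
  refine Subtype.ext (funext fun j => ?_)
  obtain ⟨l₁, e₁⟩ := capFun_eq hAB h₁ c φ
  obtain ⟨l₂, e₂⟩ := capFun_eq hAB h (endBd R K univ n c) φ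
  obtain ⟨l₃, e₃⟩ := capFun_eq hAB h₂ c (endCobd R K A k φ)
  obtain ⟨l, f1, f2, f3, f4⟩ : ∃ l, l₁ ≤ l ∧ l₂ ≤ l ∧ l₃ ≤ l ∧ j ≤ l :=
    ⟨l₁ + l₂ + l₃ + j, by omega, by omega, by omega, by omega⟩
  obtain ⟨a, ha⟩ := Submodule.mkQ_surjective _ (c.1 l)
  change relBd R (B \ K j) m (capFun hAB h₁ c φ j) = (-1 : R) ^ k •
    (capFun hAB h (endBd R K univ n c) φ j - capFun hAB h₂ c (endCobd R K A k φ) j)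
  have hda : (chainsIn R (univ \ K l) n).mkQ (bd R X n a) = (endBd R K univ n c).1 l := by
    change _ = relBd R (univ \ K l) n (c.1 l)
    rw [← ha]
    rfl
  rw [e₁ j l f1 f4 a ha, e₂ j l f2 f4 _ hda, e₃ j l f3 f4 a ha, ← map_sub, ← map_smul]
  change (chainsIn R (B \ K j) m).mkQ (bd R X m (cap h₁ a φ.1)) = _
  rw [bd_cap h h₁ h₂]
  rfl

theorem endCap_mem_cycles (hAB : SeparatedAtInfinity K A B) {n k m : ℕ} (h : k + m = n)
    {c : EndChain R K univ n} (hc : c ∈ cycles (C := fun n => EndChain R K univ n)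
      (endBd R K univ) n)
    {φ : EndCochain R K A k} (hφ : endCobd R K A k φ = 0) :
    endCap hAB h c φ ∈ cycles (C := fun n => EndChain R K B n) (endBd R K B) m := by
  cases m with
  | zero => trivial
  | succ m =>
    obtain ⟨n, rfl⟩ : ∃ t, n = t + 1 := ⟨k + m, by omega⟩
    have hc' : endBd R K univ n c = 0 := hc
    change endBd R K B m (endCap hAB h c φ) = 0
    rw [endBd_endCap hAB (by omega) h (by omega), hc', hφ]
    simp

theorem endCap_boundary_left (hAB : SeparatedAtInfinity K A B) {n k m : ℕ} (h : k + m = n)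
    (c : EndChain R K univ (n + 1)) {φ : EndCochain R K A k} (hφ : endCobd R K A k φ = 0) :
    endCap hAB h (endBd R K univ n c) φ ∈ LinearMap.range (endBd R K B m) := by
  refine ⟨(-1 : R) ^ k • endCap hAB (by omega : k + (m + 1) = n + 1) c φ, ?_⟩
  rw [map_smul, endBd_endCap hAB h (by omega) (by omega), hφ, map_zero, sub_zero, smul_smul,
    ← mul_pow]
  simp

theorem endCap_boundary_right (hAB : SeparatedAtInfinity K A B) {n k m : ℕ}
    (h : k + 1 + m = n + 1) {c : EndChain R K univ (n + 1)} (hc : endBd R K univ n c = 0)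
    (φ : EndCochain R K A k) :
    endCap hAB h c (endCobd R K A k φ) ∈ LinearMap.range (endBd R K B m) := by
  refine ⟨-(-1 : R) ^ k • endCap hAB (by omega : k + (m + 1) = n + 1) c φ, ?_⟩
  rw [map_smul, endBd_endCap hAB (by omega) (by omega) h, hc, map_zero, LinearMap.zero_apply,
    zero_sub, smul_smul, neg_mul, ← mul_pow]
  simp

/-- The chain-level cap product on cycles and cocycles. -/
def cycleCap (hAB : SeparatedAtInfinity K A B) {n k m : ℕ} (h : k + m = n) :
    cycles (C := fun n => EndChain R K univ n) (endBd R K univ) n →ₗ[R]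
      cocycles (C := fun k => EndCochain R K A k) (endCobd R K A) k →ₗ[R]
        cycles (C := fun n => EndChain R K B n) (endBd R K B) m :=
  LinearMap.mk₂ R (fun c φ => ⟨endCap hAB h c.1 φ.1, endCap_mem_cycles hAB h c.2 φ.2⟩)
    (fun c c' φ => Subtype.ext (by simp))
    (fun r c φ => Subtype.ext (by simp))
    (fun c φ ψ => Subtype.ext (by simp))
    (fun r c φ => Subtype.ext (by simp))

/-- The cap product `H_n(X, ∂_∞ X) × H^k(X, ∂_∞ A) → H_m(X, ∂_∞ B)`, `k + m = n`. -/
def capProduct (hAB : SeparatedAtInfinity K A B) {n k m : ℕ} (h : k + m = n) :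
    EndHomology R K univ n →ₗ[R] EndCohomology R K A k →ₗ[R] EndHomology R K B m :=
  LinearMap.liftQ₂ _ _ ((cycleCap hAB h).compr₂ (Submodule.mkQ _))
    (by
      rintro ⟨c, hc⟩ hb
      obtain ⟨b, rfl⟩ : ∃ b, endBd R K univ n b = c := hb
      rw [LinearMap.mem_ker]
      ext ⟨φ, hφ⟩ : 1
      refine (Submodule.Quotient.mk_eq_zero _).2 ?_
      exact endCap_boundary_left hAB h b hφ)
    (by
      rintro ⟨φ, hφ⟩ hb
      rw [LinearMap.mem_ker]
      ext ⟨c, hc⟩ : 1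
      refine (Submodule.Quotient.mk_eq_zero _).2 ?_
      cases k with
      | zero =>
        have hφ0 : φ = 0 := hb
        subst hφ0
        have h0 : endCap hAB h c (0 : EndCochain R K A 0) ∈ LinearMap.range (endBd R K B m) := by
          rw [map_zero]
          exact Submodule.zero_mem _
        exact h0
      | succ k =>
        obtain ⟨ψ, rfl⟩ : ∃ ψ, endCobd R K A k ψ = φ := hb
        obtain ⟨n, rfl⟩ : ∃ t, n = t + 1 := ⟨k + m, by omega⟩
        exact endCap_boundary_right hAB h hc ψ)

end Cap

section Duality

variable {n : ℕ} {M : Type u} [TopologicalSpace M] [T2Space M]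
  [ChartedSpace (EuclideanSpace ℝ (Fin n)) M]

/-- Capping with `μ ∈ H_n(M, ∂_∞ M)` as a map `H^k(M, ∂_∞ A) → H_m(M, ∂_∞ B)`, `k + m = n`, for a
manifold `M` without compact components and an ends-decomposition `∂_∞ M = ∂_∞ A ⊔ ∂_∞ B`. -/
def dualityMap (hM : ∀ x : M, ¬ IsCompact (connectedComponent x)) {K : CompactExhaustion M}
    {A B : Set M} (hAB : IsEndsDecomposition K A B) (μ : EndHomology ℤ K univ n) {k m : ℕ}
    (h : k + m = n) : EndCohomology ℤ K A k →ₗ[ℤ] EndHomology ℤ K B m :=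
  haveI : LocallyConnectedSpace M :=
    ChartedSpace.locallyConnectedSpace (EuclideanSpace ℝ (Fin n)) M
  capProduct (hAB.separatedAtInfinity hM) h μ

end Duality

end EndsDuality

end

/-! The theorem is deduced from a duality over closed sets C. On one side stand cochains modulo
those that vanish on small simplices near the points of C (`locZero C`), on the other side chains
modulo chains off C; capping with a fundamental class should be an equivalence. A cochain that is
locally zero on C caps a chain off C only after the chain has been subdivided often enough, and how
often depends on the cochain. So a single fundamental chain is replaced by a sequence `μ i`, the
i-th chain being subdivided i times, with homotopies `ν i` from each term to the next, and chains
are replaced by sequences of chains modulo those that eventually leave every compact part of C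
(`evOut`). Two such sequences linked by the shift recover ordinary relative chains when C is
compact: on sequences modulo eventually vanishing ones, shift minus identity is onto and its kernel
consists of the constant sequences. `coneBd` is the boundary of the mapping cone of this cap
product, and local duality, `exists_sub_coneBd_mem`, says that the cone modulo `coneNull K C` is
acyclic for every closed C.

For compact C this is a Mayer–Vietoris induction, `CompactInduction.all`: inside a chart a compact
set is sliced by one coordinate after another until only points are left, and slices are thickened
to slabs by continuity (`coneBd_nhds`) and then glued (`acyclic_union`, `acyclic_coneNull_inter`).
At a point, `coneBd_point` compares the Poincaré lemma `exists_sub_augTot_mem_locZero` with the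
local homology computed in `exists_isGen_local`. For closed C the solutions over the compact sets C
∩ K j are corrected by boundaries until they are compatible, and then glued.

To reach the ends, local duality is applied to all of M and to a tail of A, the part of A outside
the interior of some K i. The difference of the two is duality for cochains that are zero near the
tail and chains off the tail (`exists_sub_coneBd_mem_relative`). Such cochains, modulo locally zero
ones, are turned into cochains vanishing on A far out (`SeparatedFrom.exists_primitive`); off the
tail of A and far out means far out in B, and `exists_telescope` turns sequences into elements of
the inverse limit. This gives injectivity (`SeparatedFrom.exists_dDual_eq`) and surjectivity
(`SeparatedFrom.exists_capTot_eq`). All degrees are treated at once, so the vanishing outside 0, …,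
n follows from the same two lemmas: an n-chain has no caps there.

A fundamental class is assembled from local orientations over larger and larger compact sets. The
gluing rests on `compactInduction_bounds`: relative cycles of degree at least n are detected at
points. -/

noncomputable section

namespace EndsDuality

universe u v w

/-! ### The singular complex with all degrees in one group. -/

section TotalComplex

variable {X : Type u} [TopologicalSpace X]

/-- Singular simplices of all dimensions. -/
abbrev Simplex (X : Type u) [TopologicalSpace X] : Type u := Σ n, Simp X n

/-- Integral singular chains of all degrees. -/
abbrev Tot (X : Type u) [TopologicalSpace X] : Type u := Simplex X →₀ ℤ

/-- The inclusion of the `n`-chains. -/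
def ofDeg (X : Type u) [TopologicalSpace X] (n : ℕ) : Chain ℤ X n →ₗ[ℤ] Tot X :=
  Finsupp.lmapDomain ℤ ℤ (Sigma.mk n)

/-- The component of degree `n`. -/
def toDeg (X : Type u) [TopologicalSpace X] (n : ℕ) : Tot X →ₗ[ℤ] Chain ℤ X n :=
  Finsupp.lcomapDomain (Sigma.mk n) sigma_mk_injective

@[simp] theorem ofDeg_single (n : ℕ) (σ : Simp X n) (a : ℤ) :
    ofDeg X n (Finsupp.single σ a) = Finsupp.single ⟨n, σ⟩ a :=
  Finsupp.mapDomain_single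

theorem toDeg_ofDeg (n : ℕ) (c : Chain ℤ X n) : toDeg X n (ofDeg X n c) = c := by
  ext σ
  exact Finsupp.mapDomain_apply sigma_mk_injective _ _

theorem toDeg_ofDeg_of_ne {n m : ℕ} (h : n ≠ m) (c : Chain ℤ X n) :
    toDeg X m (ofDeg X n c) = 0 := by
  ext σ
  refine Finsupp.mapDomain_of_notMem_range _ _ ?_
  rintro ⟨τ, hτ⟩
  exact h (congrArg Sigma.fst hτ)

/-- The boundary of the total complex. -/
def dTot (X : Type u) [TopologicalSpace X] : Tot X →ₗ[ℤ] Tot X :=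
  Finsupp.linearCombination ℤ fun s : Simplex X =>
    match s with
    | ⟨0, _⟩ => 0
    | ⟨n + 1, σ⟩ => ofDeg X n (bd ℤ X n (Finsupp.single σ 1))

theorem dTot_ofDeg_zero (c : Chain ℤ X 0) : dTot X (ofDeg X 0 c) = 0 := by
  induction c using Finsupp.induction_linear with
  | zero => simp
  | add x y hx hy => simp only [map_add, hx, hy, add_zero]
  | single σ a => simp [dTot]

theorem dTot_ofDeg_succ (n : ℕ) (c : Chain ℤ X (n + 1)) :
    dTot X (ofDeg X (n + 1) c) = ofDeg X n (bd ℤ X n c) := by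
  induction c using Finsupp.induction_linear with
  | zero => simp
  | add x y hx hy => simp only [map_add, hx, hy]
  | single σ a =>
    have : Finsupp.single σ a = a • Finsupp.single σ (1 : ℤ) := by simp
    rw [this, map_smul, map_smul, map_smul, map_smul, ofDeg_single]
    simp [dTot]

theorem tot_induction {p : Tot X → Prop} (h0 : p 0) (hadd : ∀ x y, p x → p y → p (x + y))
    (h : ∀ n (c : Chain ℤ X n), p (ofDeg X n c)) (c : Tot X) : p c := by
  induction c using Finsupp.induction_linear with
  | zero => exact h0
  | add x y hx hy => exact hadd x y hx hy
  | single s a => exact ofDeg_single s.1 s.2 a ▸ h s.1 (Finsupp.single s.2 a)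

theorem linearMap_ext_single {N : Type*} [AddCommGroup N] {f g : Tot X →ₗ[ℤ] N}
    (h : ∀ n (σ : Simp X n), f (Finsupp.single ⟨n, σ⟩ 1) = g (Finsupp.single ⟨n, σ⟩ 1)) :
    f = g :=
  Finsupp.lhom_ext' fun s => LinearMap.ext_ring (h s.1 s.2)

@[simp] theorem dTot_dTot (c : Tot X) : dTot X (dTot X c) = 0 := by
  induction c using tot_induction with
  | h0 => simp
  | hadd x y hx hy => simp only [map_add, hx, hy, add_zero]
  | h n c =>
    rcases n with _ | _ | n
    · rw [dTot_ofDeg_zero, map_zero]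
    · rw [dTot_ofDeg_succ, dTot_ofDeg_zero]
    · rw [dTot_ofDeg_succ, dTot_ofDeg_succ, bd_bd, map_zero]

theorem toDeg_dTot (n : ℕ) (c : Tot X) : toDeg X n (dTot X c) = bd ℤ X n (toDeg X (n + 1) c) := by
  induction c using tot_induction with
  | h0 => simp
  | hadd x y hx hy => simp only [map_add, hx, hy]
  | h m c =>
    by_cases hm : m = n + 1
    · subst hm
      rw [dTot_ofDeg_succ, toDeg_ofDeg, toDeg_ofDeg]
    · rw [toDeg_ofDeg_of_ne hm, map_zero]
      rcases m with _ | m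
      · rw [dTot_ofDeg_zero, map_zero]
      · rw [dTot_ofDeg_succ, toDeg_ofDeg_of_ne (by omega)]

/-- Chains of all degrees in `U`. -/
def totIn (U : Set X) : Submodule ℤ (Tot X) :=
  Finsupp.supported ℤ ℤ {s : Simplex X | ∀ t, s.2 t ∈ U}

theorem totIn_mono {U V : Set X} (h : U ⊆ V) : totIn U ≤ totIn V :=
  Finsupp.supported_mono fun _ hs t => h (hs t)

theorem single_mem_totIn {U : Set X} {n : ℕ} {σ : Simp X n} (h : ∀ t, σ t ∈ U) (a : ℤ) :
    Finsupp.single ⟨n, σ⟩ a ∈ totIn U :=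
  Finsupp.single_mem_supported ℤ a h

theorem supported_le {α : Type*} {s : Set α} {P : Submodule ℤ (α →₀ ℤ)}
    (h : ∀ x ∈ s, Finsupp.single x 1 ∈ P) : Finsupp.supported ℤ ℤ s ≤ P := by
  rw [Finsupp.supported_eq_span_single, Submodule.span_le]
  rintro _ ⟨x, hx, rfl⟩
  exact h x hx

theorem map_supported_mem {α N : Type*} [AddCommGroup N] {s : Set α} {f : (α →₀ ℤ) →ₗ[ℤ] N}
    {P : Submodule ℤ N} (h : ∀ x ∈ s, f (Finsupp.single x 1) ∈ P) {c : α →₀ ℤ}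
    (hc : c ∈ Finsupp.supported ℤ ℤ s) : f c ∈ P :=
  supported_le (P := P.comap f) h hc

theorem map_totIn_mem {N : Type*} [AddCommGroup N] {U : Set X} {f : Tot X →ₗ[ℤ] N}
    {P : Submodule ℤ N} (h : ∀ n (σ : Simp X n), (∀ t, σ t ∈ U) → f (Finsupp.single ⟨n, σ⟩ 1) ∈ P)
    {c : Tot X} (hc : c ∈ totIn U) : f c ∈ P :=
  map_supported_mem (s := {s : Simplex X | ∀ t, s.2 t ∈ U}) (fun s hs => h s.1 s.2 hs) hc

theorem totIn_le {U : Set X} {P : Submodule ℤ (Tot X)}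
    (h : ∀ n (σ : Simp X n), (∀ t, σ t ∈ U) → Finsupp.single ⟨n, σ⟩ 1 ∈ P) : totIn U ≤ P :=
  supported_le fun s hs => h s.1 s.2 hs

theorem ofDeg_mem {U : Set X} {n : ℕ} {c : Chain ℤ X n} (h : c ∈ chainsIn ℤ U n) :
    ofDeg X n c ∈ totIn U := by
  refine map_supported_mem (fun σ hσ => ?_) h
  rw [ofDeg_single]
  exact single_mem_totIn hσ 1

theorem toDeg_mem {U : Set X} {n : ℕ} {c : Tot X} (h : c ∈ totIn U) :
    toDeg X n c ∈ chainsIn ℤ U n := by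
  refine (Finsupp.mem_supported' ℤ _).2 fun σ hσ => ?_
  exact (Finsupp.mem_supported' ℤ _).1 h ⟨n, σ⟩ hσ

theorem ofDeg_mem_iff {U : Set X} {n : ℕ} {c : Chain ℤ X n} :
    ofDeg X n c ∈ totIn U ↔ c ∈ chainsIn ℤ U n :=
  ⟨fun h => toDeg_ofDeg n c ▸ toDeg_mem h, ofDeg_mem⟩

theorem totIn_inter (U V : Set X) : totIn (U ∩ V) = totIn U ⊓ totIn V := by
  rw [totIn, totIn, totIn, ← Finsupp.supported_inter]
  congr 1
  ext s
  exact forall_and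

theorem mem_totIn_inter {U V : Set X} {c : Tot X} (hU : c ∈ totIn U) (hV : c ∈ totIn V) :
    c ∈ totIn (U ∩ V) := by
  rw [totIn_inter]
  exact ⟨hU, hV⟩

theorem mem_totIn_univ (c : Tot X) : c ∈ totIn (univ : Set X) :=
  (Finsupp.mem_supported ℤ c).2 fun _ _ _ => mem_univ _

theorem totIn_empty {c : Tot X} (h : c ∈ totIn (∅ : Set X)) : c = 0 := by
  ext s
  refine (Finsupp.mem_supported' ℤ _).1 h s fun hs => ?_
  exact hs (Classical.arbitrary _)

theorem dTot_mem {U : Set X} {c : Tot X} (h : c ∈ totIn U) : dTot X c ∈ totIn U := by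
  refine map_totIn_mem (fun n σ hσ => ?_) h
  rw [← ofDeg_single]
  rcases n with _ | n
  · rw [dTot_ofDeg_zero]
    exact Submodule.zero_mem _
  · rw [dTot_ofDeg_succ]
    exact ofDeg_mem (bd_mem _ _ (single_mem hσ 1))

theorem exists_isCompact_mem_totIn (c : Tot X) : ∃ Q : Set X, IsCompact Q ∧ c ∈ totIn Q := by
  refine ⟨⋃ s ∈ c.support, range s.2, ?_, ?_⟩
  · exact c.support.isCompact_biUnion fun s _ => isCompact_range s.2.continuous
  · refine (Finsupp.mem_supported ℤ c).2 fun s hs t => ?_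
    exact mem_biUnion hs ⟨t, rfl⟩

/-- The augmentation: the sum of the coefficients in degree zero. -/
def augTot (X : Type u) [TopologicalSpace X] : Tot X →ₗ[ℤ] ℤ :=
  Finsupp.linearCombination ℤ fun s : Simplex X => if s.1 = 0 then 1 else 0

theorem augTot_single (n : ℕ) (σ : Simp X n) :
    augTot X (Finsupp.single ⟨n, σ⟩ 1) = if n = 0 then 1 else 0 := by
  simp [augTot]

theorem augTot_ofDeg_of_ne {n : ℕ} (hn : n ≠ 0) (c : Chain ℤ X n) :
    augTot X (ofDeg X n c) = 0 := by
  induction c using Finsupp.induction_linear with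
  | zero => simp
  | add x y hx hy => simp only [map_add, hx, hy, add_zero]
  | single σ a => simp [augTot, hn]

theorem augTot_dTot (c : Tot X) : augTot X (dTot X c) = 0 := by
  have : (augTot X).comp (dTot X) = 0 := linearMap_ext_single fun n σ => by
    rw [LinearMap.comp_apply, ← ofDeg_single]
    rcases n with _ | _ | n
    · rw [dTot_ofDeg_zero, map_zero]; rfl
    · rw [dTot_ofDeg_succ, bd_single]
      simp [Fin.sum_univ_two, augTot]
    · rw [dTot_ofDeg_succ, augTot_ofDeg_of_ne (by omega)]; rfl
  exact LinearMap.congr_fun this c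

/-- A linear map defined on simplices that is local preserves the chains in `U`. -/
theorem linearCombination_mem {U : Set X} {f : Simplex X → Tot X}
    (hf : ∀ n (σ : Simp X n), (∀ t, σ t ∈ U) → f ⟨n, σ⟩ ∈ totIn U) {c : Tot X}
    (h : c ∈ totIn U) : Finsupp.linearCombination ℤ f c ∈ totIn U := by
  refine map_totIn_mem (fun n σ hσ => ?_) h
  rw [Finsupp.linearCombination_single, one_smul]
  exact hf n σ hσ

end TotalComplex

/-! ### Affine simplices in a standard simplex. -/

section AffineSimplices

/-- The affine simplex in a standard simplex with given vertices. -/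
def affineSimplex {k n : ℕ} (v : Fin (k + 1) → stdSimplex ℝ (Fin (n + 1))) :
    C(stdSimplex ℝ (Fin (k + 1)), stdSimplex ℝ (Fin (n + 1))) where
  toFun t := ⟨∑ i, t.1 i • (v i).1, (convex_stdSimplex ℝ _).sum_mem (fun i _ => t.2.1 i) t.2.2
    fun i _ => (v i).2⟩
  continuous_toFun := Continuous.subtype_mk (continuous_finsetSum _ fun i _ =>
    ((continuous_apply i).comp continuous_subtype_val).smul continuous_const) _

theorem affineSimplex_coe {k n : ℕ} (v : Fin (k + 1) → stdSimplex ℝ (Fin (n + 1)))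
    (t : stdSimplex ℝ (Fin (k + 1))) :
    (affineSimplex v t).1 = ∑ i, t.1 i • (v i).1 := rfl

theorem affineSimplex_apply {k n : ℕ} (v : Fin (k + 1) → stdSimplex ℝ (Fin (n + 1)))
    (t : stdSimplex ℝ (Fin (k + 1))) (j : Fin (n + 1)) :
    (affineSimplex v t).1 j = ∑ i, t.1 i * (v i).1 j := by
  rw [affineSimplex_coe, Finset.sum_apply]
  rfl

theorem affineSimplex_affineSimplex {k m n : ℕ} (w : Fin (m + 1) → stdSimplex ℝ (Fin (n + 1)))
    (v : Fin (k + 1) → stdSimplex ℝ (Fin (m + 1))) (t : stdSimplex ℝ (Fin (k + 1))) :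
    affineSimplex w (affineSimplex v t) = affineSimplex (affineSimplex w ∘ v) t := by
  refine Subtype.ext (funext fun j => ?_)
  simp only [affineSimplex_apply, Function.comp_apply, Finset.sum_mul, Finset.mul_sum]
  rw [Finset.sum_comm]
  simp only [mul_assoc]

theorem affineSimplex_map {k m n : ℕ} (v : Fin (m + 1) → stdSimplex ℝ (Fin (n + 1)))
    (f : Fin (k + 1) → Fin (m + 1)) (t : stdSimplex ℝ (Fin (k + 1))) :
    affineSimplex v (stdSimplex.map f t) = affineSimplex (v ∘ f) t := by
  refine Subtype.ext (funext fun j => ?_)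
  rw [affineSimplex_apply, affineSimplex_apply]
  have : ∀ i, (stdSimplex.map f t).1 i = ∑ j with f j = i, t.1 j :=
    fun i => FunOnFinite.linearMap_apply_apply ℝ ℝ f t.1 i
  simp only [this, Finset.sum_mul]
  rw [← Finset.sum_fiberwise Finset.univ f]
  refine Finset.sum_congr rfl fun x _ => Finset.sum_congr rfl fun i hi => ?_
  rw [Function.comp_apply, (Finset.mem_filter.1 hi).2]

theorem affineSimplex_vertex {k n : ℕ} (v : Fin (k + 1) → stdSimplex ℝ (Fin (n + 1)))
    (i : Fin (k + 1)) : affineSimplex v (stdSimplex.vertex i) = v i := by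
  refine Subtype.ext (funext fun j => ?_)
  rw [affineSimplex_apply]
  simp [Pi.single_apply]

theorem affineSimplex_vertices (n : ℕ) :
    affineSimplex (fun i : Fin (n + 1) => (stdSimplex.vertex i : stdSimplex ℝ (Fin (n + 1)))) =
      ContinuousMap.id _ := by
  ext t : 1
  refine Subtype.ext (funext fun j => ?_)
  rw [affineSimplex_apply]
  simp [Pi.single_apply]

theorem dist_affineSimplex_le {k n : ℕ} (v : Fin (k + 1) → stdSimplex ℝ (Fin (n + 1)))
    (t : stdSimplex ℝ (Fin (k + 1))) {p : stdSimplex ℝ (Fin (n + 1))} {r : ℝ}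
    (h : ∀ i, dist (v i) p ≤ r) : dist (affineSimplex v t) p ≤ r := by
  have hc : (affineSimplex v t).1 ∈ Metric.closedBall p.1 r :=
    (convex_closedBall p.1 r).sum_mem (fun i _ => t.2.1 i) t.2.2 fun i _ => h i
  exact hc

/-- The barycenter of an affine simplex. -/
def baryPt {k n : ℕ} (v : Fin (k + 1) → stdSimplex ℝ (Fin (n + 1))) :
    stdSimplex ℝ (Fin (n + 1)) := affineSimplex v stdSimplex.barycenter

/-- The difference of a vertex and the barycenter is the average of its differences with all k + 1
vertices, one of which is zero. -/
theorem dist_baryPt_le {k n : ℕ} (v : Fin (k + 1) → stdSimplex ℝ (Fin (n + 1))) {δ : ℝ}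
    (h : ∀ i j, dist (v i) (v j) ≤ δ) (i : Fin (k + 1)) :
    dist (v i) (baryPt v) ≤ k / (k + 1) * δ := by
  have e : (baryPt v).1 = ∑ j, ((k : ℝ) + 1)⁻¹ • (v j).1 := by
    rw [baryPt, affineSimplex_coe]
    simp
  have hk : (0 : ℝ) < k + 1 := by positivity
  have e2 : (v i).1 - (baryPt v).1 = ∑ j, ((k : ℝ) + 1)⁻¹ • ((v i).1 - (v j).1) := by
    simp only [smul_sub, Finset.sum_sub_distrib]
    rw [← e, Finset.sum_const, Finset.card_univ, Fintype.card_fin, ← Nat.cast_smul_eq_nsmul ℝ,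
      smul_smul]
    push_cast
    rw [mul_inv_cancel₀ hk.ne', one_smul]
  rw [Subtype.dist_eq, dist_eq_norm, e2, ← Finset.add_sum_erase _ _ (Finset.mem_univ i),
    sub_self, smul_zero, zero_add]
  refine (norm_sum_le _ _).trans ?_
  have hb : ∀ j ∈ Finset.univ.erase i, ‖((k : ℝ) + 1)⁻¹ • ((v i).1 - (v j).1)‖ ≤
      ((k : ℝ) + 1)⁻¹ * δ := fun j _ => by
    rw [norm_smul, Real.norm_of_nonneg (by positivity), ← dist_eq_norm]
    exact mul_le_mul_of_nonneg_left (h i j) (by positivity)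
  refine (Finset.sum_le_card_nsmul _ _ _ hb).trans ?_
  rw [Finset.card_erase_of_mem (Finset.mem_univ _), Finset.card_univ, Fintype.card_fin,
    nsmul_eq_mul]
  simp only [Nat.add_sub_cancel]
  apply le_of_eq
  field_simp

end AffineSimplices

/-! ### Barycentric subdivision of formal tuples of vertices. -/

section AffineChains

/-- Tuples of points of a standard simplex, the vertices of affine simplices. -/
abbrev Tuple (n : ℕ) : Type := Σ k, (Fin (k + 1) → stdSimplex ℝ (Fin (n + 1)))

/-- Formal combinations of tuples. -/
abbrev TupleChain (n : ℕ) : Type := Tuple n →₀ ℤ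

variable {n : ℕ}

theorem tupleChain_ext {N : Type*} [AddCommGroup N] {f g : TupleChain n →ₗ[ℤ] N}
    (h : ∀ k (v : Fin (k + 1) → stdSimplex ℝ (Fin (n + 1))),
      f (Finsupp.single ⟨k, v⟩ 1) = g (Finsupp.single ⟨k, v⟩ 1)) : f = g :=
  Finsupp.lhom_ext' fun s => LinearMap.ext_ring (h s.1 s.2)

/-- The boundary of a tuple. -/
def tupleBd : TupleChain n →ₗ[ℤ] TupleChain n :=
  Finsupp.linearCombination ℤ fun s : Tuple n =>
    match s with
    | ⟨0, _⟩ => 0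
    | ⟨k + 1, v⟩ => ∑ i : Fin (k + 2), (-1 : ℤ) ^ (i : ℕ) •
        Finsupp.single (⟨k, v ∘ i.succAbove⟩ : Tuple n) 1

/-- The cone on a tuple. -/
def tupleCone (b : stdSimplex ℝ (Fin (n + 1))) : TupleChain n →ₗ[ℤ] TupleChain n :=
  Finsupp.linearCombination ℤ fun s : Tuple n =>
    Finsupp.single (⟨s.1 + 1, Fin.cons b s.2⟩ : Tuple n) 1

/-- The sum of the coefficients of the points. -/
def tupleAug : TupleChain n →ₗ[ℤ] ℤ :=
  Finsupp.linearCombination ℤ fun s : Tuple n => if s.1 = 0 then 1 else 0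

theorem tupleBd_zero (v : Fin 1 → stdSimplex ℝ (Fin (n + 1))) :
    tupleBd (Finsupp.single (⟨0, v⟩ : Tuple n) 1) = 0 := by
  simp [tupleBd]

theorem tupleBd_succ {k : ℕ} (v : Fin (k + 2) → stdSimplex ℝ (Fin (n + 1))) :
    tupleBd (Finsupp.single (⟨k + 1, v⟩ : Tuple n) 1) =
      ∑ i : Fin (k + 2), (-1 : ℤ) ^ (i : ℕ) •
        Finsupp.single (⟨k, v ∘ i.succAbove⟩ : Tuple n) 1 := by
  simp [tupleBd]

theorem tupleCone_single (b : stdSimplex ℝ (Fin (n + 1))) (s : Tuple n) :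
    tupleCone b (Finsupp.single s 1) =
      Finsupp.single (⟨s.1 + 1, Fin.cons b s.2⟩ : Tuple n) 1 := by
  simp [tupleCone]

theorem tupleAug_single (s : Tuple n) :
    tupleAug (Finsupp.single s 1) = if s.1 = 0 then 1 else 0 := by
  simp [tupleAug]

theorem tupleAug_cone (b : stdSimplex ℝ (Fin (n + 1))) (c : TupleChain n) :
    tupleAug (tupleCone b c) = 0 := by
  have : tupleAug ∘ₗ tupleCone b = 0 := tupleChain_ext fun k v => by
    simp [tupleCone_single, tupleAug_single]
  exact LinearMap.congr_fun this c

theorem cons_comp_succAbove_succ {α : Type*} {k : ℕ} (b : α) (v : Fin (k + 2) → α)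
    (i : Fin (k + 2)) :
    (Fin.cons b v : Fin (k + 3) → α) ∘ i.succ.succAbove = Fin.cons b (v ∘ i.succAbove) := by
  funext j
  refine Fin.cases ?_ (fun j => ?_) j <;> simp

/-- Face 0 of a cone is its base, and the other faces are cones on the faces of the base. A cone on
a single point has the apex as its remaining face, which accounts for the augmentation term. -/
theorem tupleBd_cone (b : stdSimplex ℝ (Fin (n + 1))) (c : TupleChain n) :
    tupleBd (tupleCone b c) =
      c - tupleCone b (tupleBd c) - tupleAug c • Finsupp.single (⟨0, fun _ => b⟩ : Tuple n) 1 := by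
  have : tupleBd ∘ₗ tupleCone b = LinearMap.id - tupleCone b ∘ₗ tupleBd -
      (LinearMap.toSpanSingleton ℤ _ (Finsupp.single (⟨0, fun _ => b⟩ : Tuple n) 1)) ∘ₗ
        tupleAug := by
    refine tupleChain_ext fun k v => ?_
    simp only [LinearMap.comp_apply, LinearMap.sub_apply, LinearMap.id_apply,
      LinearMap.toSpanSingleton_apply, tupleCone_single, tupleAug_single, tupleBd_succ]
    rw [Fin.sum_univ_succ]
    have h0 : (Fin.cons b v : Fin (k + 2) → _) ∘ (0 : Fin (k + 2)).succAbove = v := by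
      funext j
      simp
    rw [h0]
    rcases k with _ | k
    · have h1 : (Fin.cons b v : Fin 2 → _) ∘ (Fin.succ 0 : Fin 2).succAbove = fun _ => b := by
        funext j
        fin_cases j
        rfl
      rw [tupleBd_zero, Fin.sum_univ_one, h1]
      simp [sub_eq_add_neg]
    · rw [tupleBd_succ, map_sum]
      simp only [map_smul, tupleCone_single, cons_comp_succAbove_succ]
      simp [pow_succ, sub_eq_add_neg]
  exact LinearMap.congr_fun this c

theorem tuple_induction {p : ∀ k, (Fin (k + 1) → stdSimplex ℝ (Fin (n + 1))) → Prop}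
    (h0 : ∀ v, p 0 v) (hs : ∀ k b v, p k v → p (k + 1) (Fin.cons b v)) (k : ℕ)
    (v : Fin (k + 1) → stdSimplex ℝ (Fin (n + 1))) : p k v := by
  induction k with
  | zero => exact h0 v
  | succ k ih =>
    rw [← Fin.cons_self_tail v]
    exact hs k _ _ (ih _)

/-- A tuple of positive dimension is the cone on its tail, so both identities follow from the cone
formula. They are proved together because the second one needs the first one for the tail. -/
theorem tupleAug_bd_and_tupleBd_bd (k : ℕ) (v : Fin (k + 1) → stdSimplex ℝ (Fin (n + 1))) :
    tupleAug (tupleBd (Finsupp.single ⟨k, v⟩ 1)) = 0 ∧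
      tupleBd (tupleBd (Finsupp.single ⟨k, v⟩ 1)) = 0 := by
  induction k, v using tuple_induction with
  | h0 v => simp [tupleBd_zero]
  | hs k b v ih =>
    have e : (Finsupp.single (⟨k + 1, Fin.cons b v⟩ : Tuple n) 1) =
      tupleCone b (Finsupp.single ⟨k, v⟩ (1 : ℤ)) := by rw [tupleCone_single]
    rw [e, tupleBd_cone]
    constructor
    · simp only [map_sub, tupleAug_cone, map_smul, tupleAug_single]
      simp
    · simp only [map_sub, map_smul, tupleBd_cone, ih.1, ih.2, tupleBd_zero]
      simp

theorem tupleBd_bd (c : TupleChain n) : tupleBd (tupleBd c) = 0 := by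
  have : (tupleBd ∘ₗ tupleBd : TupleChain n →ₗ[ℤ] _) = 0 :=
    tupleChain_ext fun k v => (tupleAug_bd_and_tupleBd_bd k v).2
  exact LinearMap.congr_fun this c

theorem tupleAug_bd (c : TupleChain n) : tupleAug (tupleBd c) = 0 := by
  have : (tupleAug ∘ₗ tupleBd : TupleChain n →ₗ[ℤ] _) = 0 :=
    tupleChain_ext fun k v => (tupleAug_bd_and_tupleBd_bd k v).1
  exact LinearMap.congr_fun this c

/-- The barycentric subdivision of a tuple. -/
def tupleSdAux : ∀ k, (Fin (k + 1) → stdSimplex ℝ (Fin (n + 1))) → TupleChain n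
  | 0, v => Finsupp.single ⟨0, v⟩ 1
  | k + 1, v => tupleCone (baryPt v)
      (∑ i : Fin (k + 2), (-1 : ℤ) ^ (i : ℕ) • tupleSdAux k (v ∘ i.succAbove))

/-- The barycentric subdivision of a chain of tuples. -/
def tupleSd : TupleChain n →ₗ[ℤ] TupleChain n :=
  Finsupp.linearCombination ℤ fun s : Tuple n => tupleSdAux s.1 s.2

/-- The homotopy between a tuple and its barycentric subdivision. -/
def tupleHtAux : ∀ k, (Fin (k + 1) → stdSimplex ℝ (Fin (n + 1))) → TupleChain n
  | 0, _ => 0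
  | k + 1, v => tupleCone (baryPt v) (Finsupp.single ⟨k + 1, v⟩ 1 -
      ∑ i : Fin (k + 2), (-1 : ℤ) ^ (i : ℕ) • tupleHtAux k (v ∘ i.succAbove))

/-- The homotopy between a chain of tuples and its barycentric subdivision. -/
def tupleHt : TupleChain n →ₗ[ℤ] TupleChain n :=
  Finsupp.linearCombination ℤ fun s : Tuple n => tupleHtAux s.1 s.2

theorem tupleSd_zero (v : Fin 1 → stdSimplex ℝ (Fin (n + 1))) :
    tupleSd (Finsupp.single (⟨0, v⟩ : Tuple n) 1) = Finsupp.single ⟨0, v⟩ 1 := by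
  simp [tupleSd, tupleSdAux]

theorem tupleSd_succ {k : ℕ} (v : Fin (k + 2) → stdSimplex ℝ (Fin (n + 1))) :
    tupleSd (Finsupp.single (⟨k + 1, v⟩ : Tuple n) 1) =
      tupleCone (baryPt v) (tupleSd (tupleBd (Finsupp.single ⟨k + 1, v⟩ 1))) := by
  rw [tupleBd_succ]
  simp [tupleSd, tupleSdAux]

theorem tupleHt_zero (v : Fin 1 → stdSimplex ℝ (Fin (n + 1))) :
    tupleHt (Finsupp.single (⟨0, v⟩ : Tuple n) 1) = 0 := by
  simp [tupleHt, tupleHtAux]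

theorem tupleHt_succ {k : ℕ} (v : Fin (k + 2) → stdSimplex ℝ (Fin (n + 1))) :
    tupleHt (Finsupp.single (⟨k + 1, v⟩ : Tuple n) 1) =
      tupleCone (baryPt v) (Finsupp.single ⟨k + 1, v⟩ 1 -
        tupleHt (tupleBd (Finsupp.single ⟨k + 1, v⟩ 1))) := by
  rw [tupleBd_succ]
  simp [tupleHt, tupleHtAux]

theorem tupleAug_sd (c : TupleChain n) : tupleAug (tupleSd c) = tupleAug c := by
  have : tupleAug ∘ₗ tupleSd = (tupleAug : TupleChain n →ₗ[ℤ] ℤ) := tupleChain_ext fun k v => by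
    rcases k with _ | k
    · simp [tupleSd_zero]
    · simp [tupleSd_succ, tupleAug_cone, tupleAug_single]
  exact LinearMap.congr_fun this c

theorem tupleAug_ht (c : TupleChain n) : tupleAug (tupleHt c) = 0 := by
  have : tupleAug ∘ₗ tupleHt = (0 : TupleChain n →ₗ[ℤ] ℤ) := tupleChain_ext fun k v => by
    rcases k with _ | k
    · simp [tupleHt_zero]
    · simp [tupleHt_succ, tupleAug_cone]
  exact LinearMap.congr_fun this c

/-- Two linear maps that agree on `k`-tuples agree on the boundary of `(k + 1)`-tuples. -/
theorem congr_tupleBd {N : Type*} [AddCommGroup N] {k : ℕ} {f g : TupleChain n →ₗ[ℤ] N}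
    (h : ∀ v : Fin (k + 1) → stdSimplex ℝ (Fin (n + 1)),
      f (Finsupp.single ⟨k, v⟩ 1) = g (Finsupp.single ⟨k, v⟩ 1))
    (v : Fin (k + 2) → stdSimplex ℝ (Fin (n + 1))) :
    f (tupleBd (Finsupp.single ⟨k + 1, v⟩ 1)) = g (tupleBd (Finsupp.single ⟨k + 1, v⟩ 1)) := by
  rw [tupleBd_succ, map_sum, map_sum]
  simp only [map_smul, h]

/-- The cone formula yields the subdivided boundary, minus a cone on the boundary of the latter.
That boundary is zero by the inductive hypothesis and `tupleBd_bd`. -/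
theorem tupleBd_sd (c : TupleChain n) : tupleBd (tupleSd c) = tupleSd (tupleBd c) := by
  have : tupleBd ∘ₗ tupleSd = (tupleSd ∘ₗ tupleBd : TupleChain n →ₗ[ℤ] _) :=
    tupleChain_ext fun k => by
      induction k with
      | zero => intro v; simp [tupleSd_zero, tupleBd_zero]
      | succ k ih =>
        intro v
        have h := congr_tupleBd ih v
        simp only [LinearMap.comp_apply] at h ⊢
        rw [tupleSd_succ, tupleBd_cone, h, tupleBd_bd, tupleAug_sd, tupleAug_bd]
        simp
  exact LinearMap.congr_fun this c

/-- Write S and T for subdivision and homotopy. By induction v - T∂v has boundary S∂v, so coning it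
off from the barycenter produces v - T∂v minus the cone on S∂v, and that cone is Sv. -/
theorem tupleBd_ht (c : TupleChain n) :
    tupleBd (tupleHt c) = c - tupleSd c - tupleHt (tupleBd c) := by
  have : tupleBd ∘ₗ tupleHt =
      (LinearMap.id - tupleSd - tupleHt ∘ₗ tupleBd : TupleChain n →ₗ[ℤ] _) :=
    tupleChain_ext fun k => by
      induction k with
      | zero => intro v; simp [tupleSd_zero, tupleHt_zero, tupleBd_zero]
      | succ k ih =>
        intro v
        have h := congr_tupleBd ih v
        simp only [LinearMap.comp_apply, LinearMap.sub_apply, LinearMap.id_apply] at h ⊢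
        rw [tupleHt_succ, tupleBd_cone, map_sub, map_sub tupleAug, h, tupleBd_bd, tupleAug_ht,
          tupleAug_single, tupleSd_succ]
        simp only [map_zero, sub_zero, sub_sub_cancel, Nat.succ_ne_zero, if_false, zero_smul]
        abel
  exact LinearMap.congr_fun this c

/-- The image of a tuple under an affine map. -/
def tuplePush {m : ℕ} (w : Fin (m + 1) → stdSimplex ℝ (Fin (n + 1))) :
    TupleChain m →ₗ[ℤ] TupleChain n :=
  Finsupp.linearCombination ℤ fun s : Tuple m =>
    Finsupp.single (⟨s.1, affineSimplex w ∘ s.2⟩ : Tuple n) 1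

theorem tuplePush_single {m k : ℕ} (w : Fin (m + 1) → stdSimplex ℝ (Fin (n + 1)))
    (v : Fin (k + 1) → stdSimplex ℝ (Fin (m + 1))) :
    tuplePush w (Finsupp.single ⟨k, v⟩ 1) = Finsupp.single ⟨k, affineSimplex w ∘ v⟩ 1 := by
  simp [tuplePush]

theorem tuplePush_cone {m : ℕ} (w : Fin (m + 1) → stdSimplex ℝ (Fin (n + 1)))
    (b : stdSimplex ℝ (Fin (m + 1))) (c : TupleChain m) :
    tuplePush w (tupleCone b c) = tupleCone (affineSimplex w b) (tuplePush w c) := by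
  have : tuplePush w ∘ₗ tupleCone b = tupleCone (affineSimplex w b) ∘ₗ tuplePush w :=
    tupleChain_ext fun k v => by
      simp only [LinearMap.comp_apply, tupleCone_single, tuplePush_single]
      congr 2
      funext j
      refine Fin.cases ?_ (fun j => ?_) j <;> simp
  exact LinearMap.congr_fun this c

theorem tuplePush_bd {m : ℕ} (w : Fin (m + 1) → stdSimplex ℝ (Fin (n + 1))) (c : TupleChain m) :
    tuplePush w (tupleBd c) = tupleBd (tuplePush w c) := by
  have : tuplePush w ∘ₗ tupleBd = tupleBd ∘ₗ tuplePush w := tupleChain_ext fun k v => by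
    rcases k with _ | k
    · simp [tupleBd_zero, tuplePush_single]
    · simp only [LinearMap.comp_apply, tuplePush_single, tupleBd_succ, map_sum, map_smul]
      rfl
  exact LinearMap.congr_fun this c

theorem affineSimplex_baryPt {m k : ℕ} (w : Fin (m + 1) → stdSimplex ℝ (Fin (n + 1)))
    (v : Fin (k + 1) → stdSimplex ℝ (Fin (m + 1))) :
    affineSimplex w (baryPt v) = baryPt (affineSimplex w ∘ v) :=
  affineSimplex_affineSimplex w v _

theorem tuplePush_sd {m : ℕ} (w : Fin (m + 1) → stdSimplex ℝ (Fin (n + 1))) (c : TupleChain m) :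
    tuplePush w (tupleSd c) = tupleSd (tuplePush w c) := by
  have : tuplePush w ∘ₗ tupleSd = tupleSd ∘ₗ tuplePush w := tupleChain_ext fun k => by
    induction k with
    | zero => intro v; simp [tupleSd_zero, tuplePush_single]
    | succ k ih =>
      intro v
      have h := congr_tupleBd ih v
      simp only [LinearMap.comp_apply] at h ⊢
      rw [tupleSd_succ, tuplePush_cone, h, tuplePush_bd, tuplePush_single, tupleSd_succ,
        affineSimplex_baryPt]
  exact LinearMap.congr_fun this c

theorem tuplePush_ht {m : ℕ} (w : Fin (m + 1) → stdSimplex ℝ (Fin (n + 1))) (c : TupleChain m) :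
    tuplePush w (tupleHt c) = tupleHt (tuplePush w c) := by
  have : tuplePush w ∘ₗ tupleHt = tupleHt ∘ₗ tuplePush w := tupleChain_ext fun k => by
    induction k with
    | zero => intro v; simp [tupleHt_zero, tuplePush_single]
    | succ k ih =>
      intro v
      have h := congr_tupleBd ih v
      simp only [LinearMap.comp_apply] at h ⊢
      rw [tupleHt_succ, tuplePush_cone, map_sub, h, tuplePush_bd, tuplePush_single, tupleHt_succ,
        affineSimplex_baryPt]
  exact LinearMap.congr_fun this c

end AffineChains

/-! ### Iterated subdivision makes tuples small. -/

section SmallTuples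

variable {n : ℕ}

/-- Tuples of at most `N + 1` points with pairwise distances at most `δ`. -/
def smallTuples (n N : ℕ) (δ : ℝ) : Set (Tuple n) :=
  {s | s.1 ≤ N ∧ ∀ i j, dist (s.2 i) (s.2 j) ≤ δ}

theorem range_affineSimplex_comp {k l : ℕ} (v : Fin (k + 1) → stdSimplex ℝ (Fin (n + 1)))
    (f : Fin (l + 1) → Fin (k + 1)) :
    range (affineSimplex (v ∘ f)) ⊆ range (affineSimplex v) := by
  rintro _ ⟨t, rfl⟩
  exact ⟨_, affineSimplex_map v f t⟩

/-- The contraction factor depends on a bound N for the dimension and not on k, so that it can be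
iterated over chains of mixed dimension. That the new vertices stay in the old simplex is carried
along in order to bound the edges ending at the barycenter. -/
theorem tupleSdAux_mem {N : ℕ} {δ : ℝ} (k : ℕ) (hk : k ≤ N)
    (v : Fin (k + 1) → stdSimplex ℝ (Fin (n + 1))) (hv : ∀ i j, dist (v i) (v j) ≤ δ) :
    tupleSdAux k v ∈ Finsupp.supported ℤ ℤ {s : Tuple n | s.1 = k ∧
      (∀ i, s.2 i ∈ range (affineSimplex v)) ∧
        ∀ i j, dist (s.2 i) (s.2 j) ≤ (N / (N + 1) : ℝ) * δ} := by
  have hδ : 0 ≤ δ := dist_nonneg.trans (hv 0 0)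
  have hN : (0 : ℝ) ≤ N / (N + 1) * δ := by positivity
  induction k with
  | zero =>
    refine Finsupp.single_mem_supported ℤ 1 ⟨rfl, fun i => ?_, fun i j => ?_⟩
    · exact ⟨_, affineSimplex_vertex v i⟩
    · have : i = j := Subsingleton.elim (α := Fin 1) i j
      simpa [this] using hN
  | succ k ih =>
    rw [tupleSdAux, map_sum]
    refine Submodule.sum_mem _ fun i _ => ?_
    rw [map_smul]
    refine Submodule.smul_mem _ _ ?_
    refine map_supported_mem ?_ (ih (by omega) (v ∘ i.succAbove) fun _ _ => hv _ _)
    rintro ⟨k', w⟩ ⟨hk', hw, hd⟩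
    simp only at hk'
    subst hk'
    rw [tupleCone_single]
    have hb : ∀ j, dist (w j) (baryPt v) ≤ N / (N + 1) * δ := fun j => by
      obtain ⟨t, ht⟩ : w j ∈ range (affineSimplex v) := range_affineSimplex_comp v _ (hw j)
      rw [← ht]
      -- Distances to the barycenter are largest at the vertices of the simplex. The factor k/(k+1)
      -- increases with k and is bounded by its value at N.
      refine dist_affineSimplex_le v t fun l => (dist_baryPt_le v hv l).trans ?_
      refine mul_le_mul_of_nonneg_right ?_ hδ
      have : ((k' + 1 : ℕ) : ℝ) ≤ N := by exact_mod_cast hk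
      rw [div_le_div_iff₀ (by positivity) (by positivity)]
      linarith
    refine Finsupp.single_mem_supported ℤ 1 ⟨rfl, fun j => ?_, fun j l => ?_⟩
    · refine Fin.cases ?_ (fun j => ?_) j
      · exact ⟨_, rfl⟩
      · exact range_affineSimplex_comp v _ (hw j)
    · refine Fin.cases ?_ (fun j => ?_) j <;> refine Fin.cases ?_ (fun l => ?_) l
      · simpa using hN
      · simpa [dist_comm] using hb l
      · simpa using hb j
      · simpa using hd j l

theorem tupleSd_mem {N : ℕ} {δ : ℝ} {c : TupleChain n}
    (hc : c ∈ Finsupp.supported ℤ ℤ (smallTuples n N δ)) :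
    tupleSd c ∈ Finsupp.supported ℤ ℤ (smallTuples n N (N / (N + 1) * δ)) := by
  refine map_supported_mem ?_ hc
  rintro ⟨k, v⟩ ⟨hk, hv⟩
  rw [tupleSd, Finsupp.linearCombination_single, one_smul]
  refine Finsupp.supported_mono ?_ (tupleSdAux_mem k hk v hv)
  rintro ⟨k', w⟩ ⟨hk', -, hd⟩
  exact ⟨hk'.trans_le hk, hd⟩

theorem tupleSd_pow_mem {N : ℕ} {δ : ℝ} {c : TupleChain n}
    (hc : c ∈ Finsupp.supported ℤ ℤ (smallTuples n N δ)) (m : ℕ) :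
    (tupleSd^[m]) c ∈ Finsupp.supported ℤ ℤ (smallTuples n N ((N / (N + 1)) ^ m * δ)) := by
  induction m with
  | zero => simpa using hc
  | succ m ih =>
    rw [Function.iterate_succ_apply', pow_succ', mul_assoc]
    exact tupleSd_mem ih

theorem exists_tupleSd_pow_mem (c : TupleChain n) {ε : ℝ} (hε : 0 < ε) :
    ∃ m₀, ∀ m ≥ m₀, (tupleSd^[m]) c ∈
      Finsupp.supported ℤ ℤ {s : Tuple n | ∀ i j, dist (s.2 i) (s.2 j) < ε} := by
  obtain ⟨N, δ, hc⟩ : ∃ N δ, c ∈ Finsupp.supported ℤ ℤ (smallTuples n N δ) := by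
    refine ⟨c.support.sup Sigma.fst, Metric.diam (univ : Set (stdSimplex ℝ (Fin (n + 1)))), ?_⟩
    refine (Finsupp.mem_supported ℤ c).2 fun s hs => ⟨Finset.le_sup (f := Sigma.fst) hs, ?_⟩
    exact fun i j => Metric.dist_le_diam_of_mem isCompact_univ.isBounded (mem_univ _) (mem_univ _)
  have hr : Filter.Tendsto (fun m : ℕ => ((N : ℝ) / (N + 1)) ^ m * δ) Filter.atTop (𝓝 (0 * δ)) :=
    (tendsto_pow_atTop_nhds_zero_of_lt_one (by positivity)
      ((div_lt_one (by positivity)).2 (by linarith))).mul_const _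
  rw [zero_mul] at hr
  obtain ⟨m₀, hm₀⟩ := Filter.eventually_atTop.1 (hr.eventually_lt_const hε)
  refine ⟨m₀, fun m hm => Finsupp.supported_mono ?_ (tupleSd_pow_mem hc m)⟩
  exact fun s hs i j => (hs.2 i j).trans_lt (hm₀ m hm)

end SmallTuples

/-! ### Subdivision of singular chains and excision. -/

section Subdivision

variable {X : Type u} [TopologicalSpace X] {n : ℕ}

/-- The singular chain obtained by restricting a singular simplex to affine simplices. -/
def realize (σ : Simp X n) : TupleChain n →ₗ[ℤ] Tot X :=
  Finsupp.linearCombination ℤ fun s : Tuple n =>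
    Finsupp.single (⟨s.1, σ.comp (affineSimplex s.2)⟩ : Simplex X) 1

/-- The tuple of vertices of a standard simplex. -/
def vertexTuple (n : ℕ) : TupleChain n :=
  Finsupp.single ⟨n, fun i => stdSimplex.vertex i⟩ 1

theorem realize_single (σ : Simp X n) (s : Tuple n) :
    realize σ (Finsupp.single s 1) =
      Finsupp.single (⟨s.1, σ.comp (affineSimplex s.2)⟩ : Simplex X) 1 := by
  simp [realize]

theorem realize_vertexTuple (σ : Simp X n) :
    realize σ (vertexTuple n) = Finsupp.single ⟨n, σ⟩ 1 := by
  rw [vertexTuple, realize_single]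
  congr 2
  rw [affineSimplex_vertices]
  rfl

theorem tuplePush_vertexTuple {m : ℕ} (w : Fin (m + 1) → stdSimplex ℝ (Fin (n + 1))) :
    tuplePush w (vertexTuple m) = Finsupp.single ⟨m, w⟩ 1 := by
  rw [vertexTuple, tuplePush_single]
  congr 2
  funext i
  exact affineSimplex_vertex w i

theorem realize_tuplePush {m : ℕ} (σ : Simp X n) (w : Fin (m + 1) → stdSimplex ℝ (Fin (n + 1)))
    (c : TupleChain m) : realize σ (tuplePush w c) = realize (σ.comp (affineSimplex w)) c := by
  have : realize σ ∘ₗ tuplePush w = realize (σ.comp (affineSimplex w)) :=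
    tupleChain_ext fun k v => by
      simp only [LinearMap.comp_apply, tuplePush_single, realize_single]
      congr 2
      ext t : 1
      exact congrArg σ (affineSimplex_affineSimplex w v t).symm
  exact LinearMap.congr_fun this c

theorem dTot_realize (σ : Simp X n) (c : TupleChain n) :
    dTot X (realize σ c) = realize σ (tupleBd c) := by
  have : dTot X ∘ₗ realize σ = realize σ ∘ₗ tupleBd := tupleChain_ext fun k v => by
    simp only [LinearMap.comp_apply, realize_single]
    rw [← ofDeg_single]
    rcases k with _ | k
    · rw [dTot_ofDeg_zero, tupleBd_zero, map_zero]
    · rw [dTot_ofDeg_succ, bd_single, tupleBd_succ, map_sum, map_sum]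
      refine Finset.sum_congr rfl fun i _ => ?_
      rw [map_smul, map_smul, ofDeg_single, realize_single]
      congr 4
      ext t : 1
      exact congrArg σ (affineSimplex_map v _ t)
  exact LinearMap.congr_fun this c

/-- The extension of a natural operation on tuples to singular chains. -/
def naturalExt (X : Type u) [TopologicalSpace X] (F : ∀ n, TupleChain n →ₗ[ℤ] TupleChain n) :
    Tot X →ₗ[ℤ] Tot X :=
  Finsupp.linearCombination ℤ fun s : Simplex X => realize s.2 (F s.1 (vertexTuple s.1))

theorem naturalExt_single (F : ∀ n, TupleChain n →ₗ[ℤ] TupleChain n) (σ : Simp X n) :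
    naturalExt X F (Finsupp.single ⟨n, σ⟩ 1) = realize σ (F n (vertexTuple n)) := by
  simp [naturalExt]

/-- Every tuple is the affine image of a vertex tuple, and on vertex tuples the claim is the
definition. Through this, identities between natural operations on tuples become identities between
operations on singular chains. -/
theorem naturalExt_realize {F : ∀ n, TupleChain n →ₗ[ℤ] TupleChain n}
    (hF : ∀ {m n} (w : Fin (m + 1) → stdSimplex ℝ (Fin (n + 1))) (c : TupleChain m),
      tuplePush w (F m c) = F n (tuplePush w c)) (σ : Simp X n) (c : TupleChain n) :
    naturalExt X F (realize σ c) = realize σ (F n c) := by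
  have : naturalExt X F ∘ₗ realize σ = realize σ ∘ₗ F n := tupleChain_ext fun k v => by
    simp only [LinearMap.comp_apply, realize_single, naturalExt_single]
    rw [← realize_tuplePush, hF, tuplePush_vertexTuple]
  exact LinearMap.congr_fun this c

theorem realize_mem {U : Set X} {σ : Simp X n} (hσ : ∀ t, σ t ∈ U) (c : TupleChain n) :
    realize σ c ∈ totIn U := by
  refine map_supported_mem (s := univ) (fun s _ => ?_) ((Finsupp.mem_supported ℤ c).2 (subset_univ _))
  rw [realize_single]
  exact single_mem_totIn (σ := σ.comp (affineSimplex s.2)) (fun t => hσ _) 1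

theorem naturalExt_mem (F : ∀ n, TupleChain n →ₗ[ℤ] TupleChain n) {U : Set X} {c : Tot X}
    (hc : c ∈ totIn U) : naturalExt X F c ∈ totIn U :=
  linearCombination_mem (fun _ _ hσ => realize_mem hσ _) hc

/-- Barycentric subdivision of singular chains. -/
def sd (X : Type u) [TopologicalSpace X] : Tot X →ₗ[ℤ] Tot X := naturalExt X fun _ => tupleSd

/-- The homotopy between the identity and barycentric subdivision. -/
def sdHt (X : Type u) [TopologicalSpace X] : Tot X →ₗ[ℤ] Tot X := naturalExt X fun _ => tupleHt

theorem sd_realize (σ : Simp X n) (c : TupleChain n) :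
    sd X (realize σ c) = realize σ (tupleSd c) :=
  naturalExt_realize (F := fun _ => tupleSd) tuplePush_sd σ c

theorem sdHt_realize (σ : Simp X n) (c : TupleChain n) :
    sdHt X (realize σ c) = realize σ (tupleHt c) :=
  naturalExt_realize (F := fun _ => tupleHt) tuplePush_ht σ c

theorem dTot_sd (c : Tot X) : dTot X (sd X c) = sd X (dTot X c) := by
  have : dTot X ∘ₗ sd X = sd X ∘ₗ dTot X := linearMap_ext_single fun n σ => by
    simp only [LinearMap.comp_apply]
    rw [← realize_vertexTuple, dTot_realize, sd_realize, sd_realize, dTot_realize, tupleBd_sd]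
  exact LinearMap.congr_fun this c

theorem dTot_sdHt (c : Tot X) : dTot X (sdHt X c) = c - sd X c - sdHt X (dTot X c) := by
  have : dTot X ∘ₗ sdHt X = LinearMap.id - sd X - sdHt X ∘ₗ dTot X :=
    linearMap_ext_single fun n σ => by
      simp only [LinearMap.comp_apply, LinearMap.sub_apply, LinearMap.id_apply]
      rw [← realize_vertexTuple, dTot_realize, sd_realize, sdHt_realize, sdHt_realize,
        dTot_realize, tupleBd_ht, map_sub, map_sub]
  exact LinearMap.congr_fun this c

theorem sd_mem {U : Set X} {c : Tot X} (hc : c ∈ totIn U) : sd X c ∈ totIn U :=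
  naturalExt_mem _ hc

theorem sdHt_mem {U : Set X} {c : Tot X} (hc : c ∈ totIn U) : sdHt X c ∈ totIn U :=
  naturalExt_mem _ hc

/-- The simplices that lie in a member of a cover. -/
def smallSimplices {ι : Type*} (W : ι → Set X) : Set (Simplex X) :=
  {s | ∃ i, ∀ t, s.2 t ∈ W i}

theorem sd_pow_mem {U : Set X} {c : Tot X} (hc : c ∈ totIn U) (m : ℕ) :
    (sd X ^ m) c ∈ totIn U := by
  induction m with
  | zero => exact hc
  | succ m ih =>
    rw [pow_succ']
    exact sd_mem ih

theorem dTot_sd_pow (m : ℕ) (c : Tot X) : dTot X ((sd X ^ m) c) = (sd X ^ m) (dTot X c) := by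
  induction m with
  | zero => rfl
  | succ m ih =>
    rw [pow_succ', Module.End.mul_apply, Module.End.mul_apply, dTot_sd, ih]

/-- The chains for which some number of subdivisions suffices form a submodule, so it is enough to
treat one simplex, by a Lebesgue number of the pulled back cover. -/
theorem exists_sd_pow_small {ι : Type*} {W : ι → Set X} (hW : ∀ i, IsOpen (W i)) {c : Tot X}
    (hc : c ∈ totIn (⋃ i, W i)) :
    ∃ m₀, ∀ m ≥ m₀, (sd X ^ m) c ∈ Finsupp.supported ℤ ℤ (smallSimplices W) := by
  let P : Submodule ℤ (Tot X) :=
    { carrier := {c | ∃ m₀, ∀ m ≥ m₀,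
        (sd X ^ m) c ∈ Finsupp.supported ℤ ℤ (smallSimplices W)}
      zero_mem' := ⟨0, fun m _ => by rw [map_zero]; exact Submodule.zero_mem _⟩
      add_mem' := by
        rintro x y ⟨a, ha⟩ ⟨b, hb⟩
        refine ⟨max a b, fun m hm => ?_⟩
        rw [map_add]
        exact Submodule.add_mem _ (ha m (le_of_max_le_left hm)) (hb m (le_of_max_le_right hm))
      smul_mem' := by
        rintro r x ⟨a, ha⟩
        refine ⟨a, fun m hm => ?_⟩
        rw [map_smul]
        exact Submodule.smul_mem _ _ (ha m hm) }
  refine totIn_le (P := P) (fun n σ hσ => ?_) hc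
  obtain ⟨δ, hδ, h⟩ := lebesgue_number_lemma_of_metric (s := univ)
    (c := fun i => σ ⁻¹' W i) isCompact_univ (fun i => (hW i).preimage σ.continuous)
    fun t _ => mem_iUnion.2 (Set.mem_iUnion.1 (hσ t) :)
  -- With edges below half the Lebesgue number, each affine simplex lies in the ball around its
  -- first vertex.
  obtain ⟨m₀, hm₀⟩ := exists_tupleSd_pow_mem (vertexTuple n) (half_pos hδ)
  refine ⟨m₀, fun m hm => ?_⟩
  have e : (sd X ^ m) (Finsupp.single ⟨n, σ⟩ 1) =
      realize σ ((tupleSd^[m]) (vertexTuple n)) := by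
    clear hm
    induction m with
    | zero => exact (realize_vertexTuple σ).symm
    | succ m ih =>
      rw [pow_succ', Module.End.mul_apply, ih, sd_realize, Function.iterate_succ_apply']
  rw [e]
  refine map_supported_mem ?_ (hm₀ m hm)
  rintro ⟨k, v⟩ hv
  rw [realize_single]
  refine Finsupp.single_mem_supported ℤ 1 ?_
  obtain ⟨i, hi⟩ := h (v 0) (mem_univ _)
  refine ⟨i, fun t => hi ?_⟩
  rw [Metric.mem_ball]
  exact (dist_affineSimplex_le v t fun j => (hv j 0).le).trans_lt (half_lt_self hδ)

/-- The homotopy between the identity and the `m`-fold subdivision. -/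
def sdHtPow (X : Type u) [TopologicalSpace X] (m : ℕ) : Tot X →ₗ[ℤ] Tot X :=
  ∑ i ∈ Finset.range m, sdHt X ∘ₗ (sd X ^ i)

theorem sdHtPow_apply (m : ℕ) (c : Tot X) :
    sdHtPow X m c = ∑ i ∈ Finset.range m, sdHt X ((sd X ^ i) c) := by
  simp [sdHtPow, LinearMap.sum_apply]

theorem sdHtPow_mem {U : Set X} {c : Tot X} (hc : c ∈ totIn U) (m : ℕ) :
    sdHtPow X m c ∈ totIn U := by
  rw [sdHtPow_apply]
  exact Submodule.sum_mem _ fun i _ => sdHt_mem (sd_pow_mem hc i)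

theorem dTot_sdHtPow (m : ℕ) (c : Tot X) :
    dTot X (sdHtPow X m c) = c - (sd X ^ m) c - sdHtPow X m (dTot X c) := by
  induction m with
  | zero => simp [sdHtPow_apply]
  | succ m ih =>
    simp only [sdHtPow_apply] at ih ⊢
    rw [Finset.sum_range_succ, Finset.sum_range_succ, map_add, ih, dTot_sdHt, dTot_sd_pow,
      pow_succ', Module.End.mul_apply]
    abel

theorem small_pair_le (U V : Set X) :
    Finsupp.supported ℤ ℤ (smallSimplices fun b : Bool => if b then U else V) ≤
      totIn U ⊔ totIn V := by
  refine supported_le ?_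
  rintro ⟨n, σ⟩ ⟨b, hb⟩
  cases b
  · exact Submodule.mem_sup_right (single_mem_totIn (by simpa using hb) 1)
  · exact Submodule.mem_sup_left (single_mem_totIn (by simpa using hb) 1)

/-- Iterated subdivisions of a chain in the union of two open sets. -/
theorem exists_sd_pow_mem_sup {U V : Set X} (hU : IsOpen U) (hV : IsOpen V) {c : Tot X}
    (hc : c ∈ totIn (U ∪ V)) : ∃ m, (sd X ^ m) c ∈ totIn U ⊔ totIn V := by
  obtain ⟨m, hm⟩ := exists_sd_pow_small (W := fun b : Bool => if b then U else V)
    (by rintro (_ | _) <;> simpa) (c := c)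
    (totIn_mono (union_subset (subset_iUnion_of_subset true (by simp))
      (subset_iUnion_of_subset false (by simp))) hc)
  exact ⟨m, small_pair_le U V (hm m le_rfl)⟩

theorem sup_le_totIn (U V : Set X) : totIn U ⊔ totIn V ≤ totIn (U ∪ V) :=
  sup_le (totIn_mono subset_union_left) (totIn_mono subset_union_right)

/-- Excision: chains in the union of two open sets modulo sums of chains are acyclic. -/
theorem excision {U V : Set X} (hU : IsOpen U) (hV : IsOpen V) {c : Tot X}
    (hc : c ∈ totIn (U ∪ V)) (hd : dTot X c ∈ totIn U ⊔ totIn V) :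
    ∃ e ∈ totIn (U ∪ V), c - dTot X e ∈ totIn U ⊔ totIn V := by
  obtain ⟨m, hm⟩ := exists_sd_pow_mem_sup hU hV hc
  refine ⟨sdHtPow X m c, sdHtPow_mem hc m, ?_⟩
  rw [dTot_sdHtPow]
  have h : sdHtPow X m (dTot X c) ∈ totIn U ⊔ totIn V := by
    obtain ⟨a, ha, b, hb, e⟩ := Submodule.mem_sup.1 hd
    rw [← e, map_add]
    exact Submodule.add_mem_sup (sdHtPow_mem ha m) (sdHtPow_mem hb m)
  have e : c - (c - (sd X ^ m) c - sdHtPow X m (dTot X c)) =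
      (sd X ^ m) c + sdHtPow X m (dTot X c) := by abel
  rw [e]
  exact Submodule.add_mem _ hm h

end Subdivision

/-! ### The cap product in all degrees at once. -/

section TotalCap

variable {X : Type u} [TopologicalSpace X]

/-- Integral singular cochains of all degrees. -/
abbrev TotDual (X : Type u) [TopologicalSpace X] : Type u := Tot X →ₗ[ℤ] ℤ

/-- The sign `(-1)ⁿ` in degree `n`. -/
def sgn (X : Type u) [TopologicalSpace X] : Tot X →ₗ[ℤ] Tot X :=
  Finsupp.linearCombination ℤ fun s : Simplex X => Finsupp.single s ((-1 : ℤ) ^ s.1)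

theorem sgn_ofDeg (n : ℕ) (c : Chain ℤ X n) : sgn X (ofDeg X n c) = (-1 : ℤ) ^ n • ofDeg X n c := by
  induction c using Finsupp.induction_linear with
  | zero => simp
  | add x y hx hy => simp only [map_add, hx, hy, smul_add]
  | single σ a => simp [sgn, mul_comm]

theorem sgn_sgn (c : Tot X) : sgn X (sgn X c) = c := by
  induction c using tot_induction with
  | h0 => simp
  | hadd x y hx hy => simp only [map_add, hx, hy]
  | h n c => rw [sgn_ofDeg, map_smul, sgn_ofDeg, smul_smul, ← mul_pow]; simp

theorem dTot_sgn (c : Tot X) : dTot X (sgn X c) = -sgn X (dTot X c) := by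
  induction c using tot_induction with
  | h0 => simp
  | hadd x y hx hy => simp only [map_add, hx, hy, neg_add]
  | h n c =>
    rcases n with _ | n
    · rw [sgn_ofDeg, map_smul, dTot_ofDeg_zero]; simp
    · rw [sgn_ofDeg, map_smul, dTot_ofDeg_succ, sgn_ofDeg, pow_succ]; simp

theorem sgn_mem {U : Set X} {c : Tot X} (h : c ∈ totIn U) : sgn X c ∈ totIn U :=
  linearCombination_mem (fun _ _ hσ => single_mem_totIn hσ _) h

/-- The sign `(-1)ᵏ` on cochains of degree `k`. -/
def sgnDual (X : Type u) [TopologicalSpace X] : TotDual X →ₗ[ℤ] TotDual X :=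
  LinearMap.lcomp ℤ ℤ (sgn X)

/-- The coboundary of the total cochain complex, with the sign `(-1)ᵏ` in degree `k`. -/
def dDual (X : Type u) [TopologicalSpace X] : TotDual X →ₗ[ℤ] TotDual X :=
  LinearMap.lcomp ℤ ℤ (sgn X ∘ₗ dTot X)

theorem sgnDual_apply (φ : TotDual X) (c : Tot X) : sgnDual X φ c = φ (sgn X c) := rfl

theorem dDual_apply (φ : TotDual X) (c : Tot X) : dDual X φ c = φ (sgn X (dTot X c)) := rfl

@[simp] theorem sgnDual_sgnDual (φ : TotDual X) : sgnDual X (sgnDual X φ) = φ :=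
  LinearMap.ext fun c => by rw [sgnDual_apply, sgnDual_apply, sgn_sgn]

theorem dDual_sgnDual (φ : TotDual X) : dDual X (sgnDual X φ) = -sgnDual X (dDual X φ) :=
  LinearMap.ext fun c => by
    rw [LinearMap.neg_apply, dDual_apply, sgnDual_apply, sgnDual_apply, dDual_apply, dTot_sgn,
      map_neg, map_neg, neg_neg]

@[simp] theorem dDual_dDual (φ : TotDual X) : dDual X (dDual X φ) = 0 :=
  LinearMap.ext fun c => by
    rw [dDual_apply, dDual_apply, dTot_sgn, dTot_dTot]; simp

/-- The component of degree `k` of a cochain. -/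
def dualDeg (X : Type u) [TopologicalSpace X] (k : ℕ) : TotDual X →ₗ[ℤ] Cochain ℤ X k where
  toFun φ := φ ∘ₗ ofDeg X k
  map_add' _ _ := rfl
  map_smul' _ _ := rfl

theorem dualDeg_apply (k : ℕ) (φ : TotDual X) (c : Chain ℤ X k) :
    dualDeg X k φ c = φ (ofDeg X k c) := rfl

theorem cochain_ext {k : ℕ} {φ ψ : Cochain ℤ X k} (h : ∀ c, φ c = ψ c) : φ = ψ :=
  DFunLike.ext _ _ h

theorem dualDeg_dDual_zero (φ : TotDual X) : dualDeg X 0 (dDual X φ) = 0 :=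
  cochain_ext fun c => by
    rw [dualDeg_apply, dDual_apply, dTot_ofDeg_zero, map_zero, map_zero]; rfl

theorem dualDeg_dDual_succ (k : ℕ) (φ : TotDual X) :
    dualDeg X (k + 1) (dDual X φ) = (-1 : ℤ) ^ k • cobd ℤ X k (dualDeg X k φ) :=
  cochain_ext fun c => by
    rw [dualDeg_apply, dDual_apply, dTot_ofDeg_succ, sgn_ofDeg, map_smul]; rfl

theorem dualDeg_sgnDual (k : ℕ) (φ : TotDual X) :
    dualDeg X k (sgnDual X φ) = (-1 : ℤ) ^ k • dualDeg X k φ :=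
  cochain_ext fun c => by
    rw [dualDeg_apply, sgnDual_apply, sgn_ofDeg, map_smul]; rfl

/-- The cap product of `n`-chains with the component of degree `k` of a cochain. -/
def capPart {n k m : ℕ} (h : k + m = n) : Chain ℤ X n →ₗ[ℤ] TotDual X →ₗ[ℤ] Tot X :=
  ((cap (R := ℤ) (X := X) h).compl₂ (dualDeg X k)).compr₂ (ofDeg X m)

theorem capPart_apply {n k m : ℕ} (h : k + m = n) (c : Chain ℤ X n) (φ : TotDual X) :
    capPart h c φ = ofDeg X m (cap h c (dualDeg X k φ)) := rfl

theorem capPart_congr {n k m k' m' : ℕ} (h : k + m = n) (h' : k' + m' = n) (hk : k = k') :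
    capPart (X := X) h = capPart h' := by
  subst hk
  obtain rfl : m = m' := by omega
  rfl

theorem capPart_single {n k m : ℕ} (h : k + m = n) (σ : Simp X n) (φ : TotDual X) :
    capPart h (Finsupp.single σ 1) φ = φ (Finsupp.single ⟨k, pull (front h) σ⟩ 1) •
      Finsupp.single ⟨m, pull (back h) σ⟩ 1 := by
  rw [capPart_apply, cap_single, map_smul, ofDeg_single, dualDeg_apply, ofDeg_single]

theorem dTot_capPart_zero {n k : ℕ} (h : k + 0 = n) (c : Chain ℤ X n) (φ : TotDual X) :
    dTot X (capPart h c φ) = 0 := dTot_ofDeg_zero _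

theorem capPart_dDual_zero {n m : ℕ} (h : 0 + m = n) (c : Chain ℤ X n) (φ : TotDual X) :
    capPart h c (dDual X φ) = 0 := by
  rw [capPart_apply, dualDeg_dDual_zero, map_zero, map_zero]

theorem dTot_capPart {n k m : ℕ} (h : k + m = n) (h₁ : k + (m + 1) = n + 1)
    (h₂ : k + 1 + m = n + 1) (c : Chain ℤ X (n + 1)) (φ : TotDual X) :
    dTot X (capPart h₁ c φ) =
      capPart h (bd ℤ X n c) (sgnDual X φ) - capPart h₂ c (dDual X φ) := by
  simp only [capPart_apply]
  rw [dTot_ofDeg_succ, bd_cap h h₁ h₂, dualDeg_sgnDual, dualDeg_dDual_succ]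
  simp only [map_smul, map_zsmul, map_sub, smul_sub]

theorem capPart_augTot_zero {n : ℕ} (h : 0 + n = n) (σ : Simp X n) :
    capPart h (Finsupp.single σ 1) (augTot X) = Finsupp.single ⟨n, σ⟩ 1 := by
  have hb : back h = (id : Fin (n + 1) → Fin (n + 1)) := by
    funext i
    simp [back]
  have e : pull (back h) σ = σ := by
    ext t : 1
    rw [hb]
    change σ (stdSimplex.map id t) = σ t
    rw [stdSimplex.map_id_apply]
  rw [capPart_single, e, augTot_single, if_pos rfl, one_smul]

theorem capPart_augTot_succ {n k m : ℕ} (h : k + 1 + m = n) (σ : Simp X n) :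
    capPart h (Finsupp.single σ 1) (augTot X) = 0 := by
  rw [capPart_single, augTot_single, if_neg (by omega), zero_smul]

/-- The cap product of `n`-chains with cochains of all degrees. -/
def capDeg (X : Type u) [TopologicalSpace X] (n : ℕ) : Chain ℤ X n →ₗ[ℤ] TotDual X →ₗ[ℤ] Tot X :=
  ∑ k : Fin (n + 1), capPart (k := k) (m := n - k) (by omega)

theorem capDeg_apply (n : ℕ) (c : Chain ℤ X n) (φ : TotDual X) :
    capDeg X n c φ = ∑ k : Fin (n + 1), capPart (k := k) (m := n - k) (by omega) c φ := by
  simp only [capDeg, LinearMap.sum_apply]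

/-- The cap product of chains and cochains of all degrees. -/
def capTot (X : Type u) [TopologicalSpace X] : Tot X →ₗ[ℤ] TotDual X →ₗ[ℤ] Tot X :=
  Finsupp.linearCombination ℤ fun s : Simplex X => capDeg X s.1 (Finsupp.single s.2 1)

theorem capTot_single (n : ℕ) (σ : Simp X n) :
    capTot X (Finsupp.single ⟨n, σ⟩ 1) = capDeg X n (Finsupp.single σ 1) := by
  simp [capTot]

theorem capTot_ofDeg (n : ℕ) (c : Chain ℤ X n) : capTot X (ofDeg X n c) = capDeg X n c := by
  induction c using Finsupp.induction_linear with
  | zero => simp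
  | add x y hx hy => simp only [map_add, hx, hy]
  | single σ a =>
    have : Finsupp.single σ a = a • Finsupp.single σ (1 : ℤ) := by simp
    rw [this, map_smul, map_smul, map_smul, ofDeg_single, capTot_single]

/-- The sign (-1)ᵏ of the degreewise Leibniz rule has been absorbed into `sgnDual` and `dDual`, so a
single formula holds for inhomogeneous cochains. In the sum over degrees, caps of top degree are
points and have no boundary, and `dDual` has no component in degree 0; the remaining terms match
after a shift of the index. -/
theorem dTot_capTot (c : Tot X) (φ : TotDual X) :
    dTot X (capTot X c φ) = capTot X (dTot X c) (sgnDual X φ) - capTot X c (dDual X φ) := by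
  induction c using tot_induction with
  | h0 => simp
  | hadd x y hx hy =>
    simp only [map_add, LinearMap.add_apply, hx, hy]
    abel
  | h n c =>
    rcases n with _ | n
    · rw [dTot_ofDeg_zero, capTot_ofDeg, capDeg_apply, capDeg_apply, Fin.sum_univ_one,
        Fin.sum_univ_one, map_zero, LinearMap.zero_apply]
      refine (dTot_capPart_zero _ _ _).trans ?_
      rw [zero_sub, eq_comm, neg_eq_zero]
      exact capPart_dDual_zero _ _ _
    · rw [dTot_ofDeg_succ, capTot_ofDeg, capTot_ofDeg, capDeg_apply, capDeg_apply, capDeg_apply,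
        map_sum, Fin.sum_univ_castSucc, Fin.sum_univ_succ (n := n + 1)
          (f := fun k => capPart (k := k) (m := n + 1 - k) (by omega) c (dDual X φ))]
      have h0 : ∀ h, dTot X (capPart (k := (Fin.last (n + 1) : Fin (n + 2)))
          (m := n + 1 - (Fin.last (n + 1) : Fin (n + 2))) h c φ) = 0 := fun h => by
        rw [capPart_congr h (k' := n + 1) (m' := 0) rfl (by simp), dTot_capPart_zero]
      have h1 : ∀ h, capPart (k := (0 : Fin (n + 2))) (m := n + 1 - (0 : Fin (n + 2))) h c
          (dDual X φ) = 0 := fun h => by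
        rw [capPart_congr h (k' := 0) (m' := n + 1) (zero_add _) (by simp), capPart_dDual_zero]
      rw [h0, add_zero, h1, zero_add, ← Finset.sum_sub_distrib]
      refine Finset.sum_congr rfl fun k _ => ?_
      have h := k.2
      have h2 : ∀ h h', capPart (X := X) (n := n + 1) (k := k.castSucc) (m := n + 1 - k.castSucc) h
          = capPart (k := k) (m := n - k + 1) h' := fun h h' => capPart_congr _ _ rfl
      have h3 : ∀ h h', capPart (X := X) (n := n + 1) (k := k.succ) (m := n + 1 - k.succ) h
          = capPart (k := k + 1) (m := n - k) h' := fun h h' => capPart_congr _ _ (by simp)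
      rw [h2 _ (by omega), h3 _ (by omega)]
      exact dTot_capPart _ _ _ _ _

theorem capTot_mem {U : Set X} {c : Tot X} (h : c ∈ totIn U) (φ : TotDual X) :
    capTot X c φ ∈ totIn U := by
  refine map_totIn_mem (f := (capTot X).flip φ) (fun n σ hσ => ?_) h
  rw [LinearMap.flip_apply, capTot_single, capDeg_apply]
  refine Submodule.sum_mem _ fun k _ => ?_
  rw [capPart_single]
  exact Submodule.smul_mem _ _ (single_mem_totIn (pull_mem _ hσ) 1)

/-- The cochain vanishes on the chains in `U`. -/
def VanishesOn (U : Set X) (φ : TotDual X) : Prop := ∀ c ∈ totIn U, φ c = 0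

theorem vanishesOn_of_simplices {U : Set X} {φ : TotDual X}
    (h : ∀ n (σ : Simp X n), (∀ t, σ t ∈ U) → φ (Finsupp.single ⟨n, σ⟩ 1) = 0) :
    VanishesOn U φ := fun _ hc =>
  (Submodule.mem_bot ℤ).1 (map_totIn_mem (fun n σ hσ => (Submodule.mem_bot ℤ).2 (h n σ hσ)) hc)

theorem VanishesOn.mono {U V : Set X} {φ : TotDual X} (h : VanishesOn V φ) (hUV : U ⊆ V) :
    VanishesOn U φ := fun c hc => h c (totIn_mono hUV hc)

theorem VanishesOn.add {U : Set X} {φ ψ : TotDual X} (hφ : VanishesOn U φ) (hψ : VanishesOn U ψ) :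
    VanishesOn U (φ + ψ) := fun c hc => by
  rw [LinearMap.add_apply, hφ c hc, hψ c hc, add_zero]

theorem VanishesOn.sub {U : Set X} {φ ψ : TotDual X} (hφ : VanishesOn U φ) (hψ : VanishesOn U ψ) :
    VanishesOn U (φ - ψ) := fun c hc => by
  rw [LinearMap.sub_apply, hφ c hc, hψ c hc, sub_zero]

theorem VanishesOn.dDual {U : Set X} {φ : TotDual X} (h : VanishesOn U φ) :
    VanishesOn U (dDual X φ) := fun _ hc => h _ (sgn_mem (dTot_mem hc))

theorem VanishesOn.sgnDual {U : Set X} {φ : TotDual X} (h : VanishesOn U φ) :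
    VanishesOn U (sgnDual X φ) := fun _ hc => h _ (sgn_mem hc)

/-- Front faces of simplices in U lie in U. This is what lets a locally zero cochain discard the
part of a chain that it does not see. -/
theorem capTot_eq_zero {U : Set X} {c : Tot X} (h : c ∈ totIn U) {φ : TotDual X}
    (hφ : VanishesOn U φ) : capTot X c φ = 0 := by
  rw [← Submodule.mem_bot ℤ]
  refine map_totIn_mem (f := (capTot X).flip φ) (fun n σ hσ => ?_) h
  rw [LinearMap.flip_apply, capTot_single, capDeg_apply, Submodule.mem_bot]
  refine Finset.sum_eq_zero fun k _ => ?_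
  rw [capPart_single, hφ _ (single_mem_totIn (pull_mem _ hσ) 1), zero_smul]

theorem capTot_augTot (c : Tot X) : capTot X c (augTot X) = c := by
  have : (capTot X).flip (augTot X) = LinearMap.id := linearMap_ext_single fun n σ => by
    rw [LinearMap.flip_apply, capTot_single, capDeg_apply, Fin.sum_univ_succ]
    have h0 : ∀ h, capPart (X := X) (n := n) (k := (0 : Fin (n + 1))) (m := n - (0 : Fin (n + 1))) h
        = capPart (k := 0) (m := n) (zero_add n) := fun h => capPart_congr _ _ (by simp)
    rw [h0, capPart_augTot_zero, Finset.sum_eq_zero fun k _ => ?_, add_zero, LinearMap.id_apply]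
    have h1 : ∀ h h', capPart (X := X) (n := n) (k := k.succ) (m := n - k.succ) h
        = capPart (k := k + 1) (m := n - (k + 1)) h' := fun h h' => capPart_congr _ _ (by simp)
    rw [h1 _ (by omega), capPart_augTot_succ]
  exact LinearMap.congr_fun this c

end TotalCap

/-! ### Cochains that vanish near a set. -/

section LocallyZero

variable {X : Type u} [TopologicalSpace X]

/-- The cochains that vanish on the small simplices near the points of `C`. -/
def locZero (C : Set X) : Submodule ℤ (TotDual X) where
  carrier := {φ | ∀ x ∈ C, ∃ W, IsOpen W ∧ x ∈ W ∧ VanishesOn W φ}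
  zero_mem' := fun x _ => ⟨univ, isOpen_univ, mem_univ x, fun _ _ => rfl⟩
  add_mem' := by
    intro φ ψ hφ hψ x hx
    obtain ⟨W, hW, hxW, h⟩ := hφ x hx
    obtain ⟨W', hW', hxW', h'⟩ := hψ x hx
    exact ⟨W ∩ W', hW.inter hW', ⟨hxW, hxW'⟩,
      (h.mono inter_subset_left).add (h'.mono inter_subset_right)⟩
  smul_mem' := by
    intro r φ hφ x hx
    obtain ⟨W, hW, hxW, h⟩ := hφ x hx
    refine ⟨W, hW, hxW, fun c hc => ?_⟩
    rw [LinearMap.smul_apply, h c hc, smul_zero]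

theorem locZero_anti {C C' : Set X} (h : C ⊆ C') : locZero C' ≤ locZero C :=
  fun _ hφ x hx => hφ x (h hx)

theorem locZero_union {C C' : Set X} {φ : TotDual X} (h : φ ∈ locZero C) (h' : φ ∈ locZero C') :
    φ ∈ locZero (C ∪ C') := by
  rintro x (hx | hx)
  · exact h x hx
  · exact h' x hx

theorem dDual_mem_locZero {C : Set X} {φ : TotDual X} (h : φ ∈ locZero C) :
    dDual X φ ∈ locZero C := fun x hx => by
  obtain ⟨W, hW, hxW, h⟩ := h x hx
  exact ⟨W, hW, hxW, h.dDual⟩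

theorem sgnDual_mem_locZero {C : Set X} {φ : TotDual X} (h : φ ∈ locZero C) :
    sgnDual X φ ∈ locZero C := fun x hx => by
  obtain ⟨W, hW, hxW, h⟩ := h x hx
  exact ⟨W, hW, hxW, h.sgnDual⟩

theorem VanishesOn.mem_locZero {W C : Set X} {φ : TotDual X} (h : VanishesOn W φ) (hW : IsOpen W)
    (hC : C ⊆ W) : φ ∈ locZero C := fun _ hx => ⟨W, hW, hC hx, h⟩

theorem exists_isOpen_mem_locZero {C : Set X} {φ : TotDual X} (h : φ ∈ locZero C) :
    ∃ W, IsOpen W ∧ C ⊆ W ∧ φ ∈ locZero W := by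
  refine ⟨⋃₀ {W | IsOpen W ∧ VanishesOn W φ}, isOpen_sUnion fun W hW => hW.1, fun x hx => ?_, ?_⟩
  · obtain ⟨W, hW, hxW, h⟩ := h x hx
    exact ⟨W, ⟨hW, h⟩, hxW⟩
  · rintro x ⟨W, hW, hxW⟩
    exact ⟨W, hW.1, hxW, hW.2⟩

open Classical in
/-- The cochain that agrees with `φ` on the simplices satisfying `p` and vanishes on the others. -/
def cut (p : Simplex X → Prop) (φ : TotDual X) : TotDual X :=
  Finsupp.linearCombination ℤ fun s : Simplex X => if p s then φ (Finsupp.single s 1) else 0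

open Classical in
theorem cut_single (p : Simplex X → Prop) (φ : TotDual X) (s : Simplex X) :
    cut p φ (Finsupp.single s 1) = if p s then φ (Finsupp.single s 1) else 0 := by
  simp [cut]

theorem VanishesOn.cut {W : Set X} {φ : TotDual X} (h : VanishesOn W φ) (p : Simplex X → Prop) :
    VanishesOn W (cut p φ) := vanishesOn_of_simplices fun n σ hσ => by
  rw [cut_single, h _ (single_mem_totIn hσ 1), ite_self]

theorem vanishesOn_cut {W : Set X} {p : Simplex X → Prop}
    (h : ∀ s : Simplex X, (∀ t, s.2 t ∈ W) → ¬ p s) (φ : TotDual X) : VanishesOn W (cut p φ) :=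
  vanishesOn_of_simplices fun n σ hσ => by rw [cut_single, if_neg (h _ hσ)]

theorem vanishesOn_sub_cut {W : Set X} {p : Simplex X → Prop}
    (h : ∀ s : Simplex X, (∀ t, s.2 t ∈ W) → p s) (φ : TotDual X) : VanishesOn W (φ - cut p φ) :=
  vanishesOn_of_simplices fun n σ hσ => by
    rw [LinearMap.sub_apply, cut_single, if_pos (h _ hσ), sub_self]

theorem locZero_cut {C : Set X} {φ : TotDual X} (h : φ ∈ locZero C) (p : Simplex X → Prop) :
    cut p φ ∈ locZero C := fun x hx => by
  obtain ⟨W, hW, hxW, h⟩ := h x hx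
  exact ⟨W, hW, hxW, h.cut p⟩

theorem not_disjoint_simplex {U V : Set X} (h : Disjoint U V) {s : Simplex X}
    (hU : ∀ t, s.2 t ∈ U) : ¬ ∀ t, s.2 t ∈ V := fun hV =>
  Set.disjoint_left.1 h (hU (Classical.arbitrary _)) (hV (Classical.arbitrary _))

/-- Outside a neighbourhood W of K ∩ L on which φ is locally zero, K and L have disjoint
neighbourhoods U and V. The part of φ on simplices in V is then zero near K, and the rest is zero
near L. On cochains, Mayer–Vietoris thus needs no subdivision. -/
theorem exists_add_of_mem_locZero_inter [T2Space X] {K L : Set X} (hK : IsCompact K)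
    (hL : IsCompact L) {φ : TotDual X} (h : φ ∈ locZero (K ∩ L)) :
    ∃ φ₁ ∈ locZero K, ∃ φ₂ ∈ locZero L, φ₁ + φ₂ = φ := by
  obtain ⟨W, hW, hKL, hφ⟩ := exists_isOpen_mem_locZero h
  obtain ⟨U, V, hU, hV, hKU, hLV, hd⟩ := SeparatedNhds.of_isCompact_isCompact (hK.diff hW)
    (hL.diff hW) (Set.disjoint_left.2 fun x hx hx' => hx.2 (hKL ⟨hx.1, hx'.1⟩))
  refine ⟨cut (fun s => ∀ t, s.2 t ∈ V) φ, fun x hx => ?_, φ - cut (fun s => ∀ t, s.2 t ∈ V) φ,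
    fun x hx => ?_, by abel⟩
  · by_cases hxW : x ∈ W
    · exact locZero_cut hφ _ x hxW
    · exact ⟨U, hU, hKU ⟨hx, hxW⟩, vanishesOn_cut (fun s hs => not_disjoint_simplex hd hs) φ⟩
  · by_cases hxW : x ∈ W
    · exact Submodule.sub_mem _ hφ (locZero_cut hφ _) x hxW
    · exact ⟨V, hV, hLV ⟨hx, hxW⟩, vanishesOn_sub_cut (fun s hs => hs) φ⟩

/-- Sufficiently subdivided chains cap locally zero cochains into the complement. -/
theorem exists_capTot_sd_pow_mem {C : Set X} (hC : IsClosed C) {φ : TotDual X}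
    (hφ : φ ∈ locZero C) (c : Tot X) :
    ∃ m₀, ∀ m ≥ m₀, capTot X ((sd X ^ m) c) φ ∈ totIn Cᶜ ∧
      capTot X (sdHt X ((sd X ^ m) c)) φ ∈ totIn Cᶜ := by
  classical
  choose! W hW hxW hv using hφ
  -- A simplex that is small for this cover is either killed by φ, in some `W x`, or lies off C
  -- together with its caps.
  let W' : X → Set X := fun x => if x ∈ C then W x else Cᶜ
  have hcov : (⋃ x, W' x) = univ := eq_univ_of_forall fun x => mem_iUnion.2 ⟨x, by
    by_cases hx : x ∈ C
    · simpa [W', hx] using hxW x hx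
    · simp [W', hx]⟩
  obtain ⟨m₀, hm₀⟩ := exists_sd_pow_small (W := W') (c := c) (fun x => by
    by_cases hx : x ∈ C
    · simpa [W', hx] using hW x hx
    · simpa [W', hx] using hC.isOpen_compl) (hcov ▸ mem_totIn_univ c)
  have key : ∀ x (c : Tot X), c ∈ totIn (W' x) → capTot X c φ ∈ totIn Cᶜ := fun x c hc => by
    by_cases hx : x ∈ C
    · simp only [W', hx, if_true] at hc
      rw [capTot_eq_zero hc (hv x hx)]
      exact Submodule.zero_mem _
    · simp only [W', hx, if_false] at hc
      exact capTot_mem hc φ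
  refine ⟨m₀, fun m hm => ⟨?_, ?_⟩⟩
  · refine map_supported_mem (f := (capTot X).flip φ) ?_ (hm₀ m hm)
    rintro ⟨n, σ⟩ ⟨x, hx⟩
    exact key x _ (single_mem_totIn hx 1)
  · refine map_supported_mem (f := (capTot X).flip φ ∘ₗ sdHt X) ?_ (hm₀ m hm)
    rintro ⟨n, σ⟩ ⟨x, hx⟩
    exact key x _ (sdHt_mem (single_mem_totIn hx 1))

/-- Locally zero cocycles are coboundaries of locally zero cochains. -/
theorem exists_dDual_eq_of_locZero {z : TotDual X} (hz : z ∈ locZero (univ : Set X))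
    (hd : dDual X z = 0) : ∃ y ∈ locZero (univ : Set X), dDual X y = z ∧
      ∀ V : Set X, VanishesOn V z → VanishesOn V y := by
  have hzd : ∀ c, z (dTot X c) = 0 := fun c => by
    have := LinearMap.congr_fun hd (sgn X c)
    rw [dDual_apply, dTot_sgn, map_neg, sgn_sgn, map_neg] at this
    simpa using this
  have hsm : ∀ c, ∃ N, ∀ m ≥ N, z ((sd X ^ m) c) = 0 ∧ z (sdHt X ((sd X ^ m) c)) = 0 := fun c => by
    choose! W hW hxW hv using hz
    have hcov : (⋃ x, W x) = univ := eq_univ_of_forall fun x =>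
      mem_iUnion.2 ⟨x, hxW x (mem_univ x)⟩
    obtain ⟨m₀, hm₀⟩ := exists_sd_pow_small (W := W) (c := c) (fun x => hW x (mem_univ x))
      (hcov ▸ mem_totIn_univ c)
    refine ⟨m₀, fun m hm => ⟨?_, ?_⟩⟩
    · refine (Submodule.mem_bot ℤ).1 (map_supported_mem (f := z) ?_ (hm₀ m hm))
      rintro ⟨n, σ⟩ ⟨x, hx⟩
      exact (Submodule.mem_bot ℤ).2 (hv x (mem_univ x) _ (single_mem_totIn hx 1))
    · refine (Submodule.mem_bot ℤ).1 (map_supported_mem (f := z ∘ₗ sdHt X) ?_ (hm₀ m hm))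
      rintro ⟨n, σ⟩ ⟨x, hx⟩
      exact (Submodule.mem_bot ℤ).2 (hv x (mem_univ x) _ (sdHt_mem (single_mem_totIn hx 1)))
  choose N hN using hsm
  -- This is z applied to the infinite sum of the homotopies `sdHt ∘ sd ^ i`. On each simplex z
  -- kills all but finitely many terms, and any larger cut-off gives the same value.
  let y₀ : TotDual X := Finsupp.linearCombination ℤ fun s : Simplex X =>
    z (sdHtPow X (N (Finsupp.single s 1)) (Finsupp.single s 1))
  have hstable : ∀ c, ∃ P, ∀ m ≥ P, y₀ c = z (sdHtPow X m c) := fun c => by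
    induction c using Finsupp.induction_linear with
    | zero => exact ⟨0, fun m _ => by simp⟩
    | add x y hx hy =>
      obtain ⟨a, ha⟩ := hx
      obtain ⟨b, hb⟩ := hy
      exact ⟨max a b, fun m hm => by
        rw [map_add, map_add, map_add, ha m (le_of_max_le_left hm), hb m (le_of_max_le_right hm)]⟩
    | single s a =>
      have ha : Finsupp.single s a = a • Finsupp.single s (1 : ℤ) := by simp
      refine ⟨N (Finsupp.single s 1), fun m hm => ?_⟩
      rw [ha, map_smul, map_smul, map_smul]
      congr 1
      simp only [y₀, Finsupp.linearCombination_single, one_smul, sdHtPow_apply, map_sum]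
      refine Finset.sum_subset (Finset.range_mono hm) fun i _ hi => ?_
      exact (hN _ i (by simpa using hi)).2
  have hd₀ : ∀ c, y₀ (dTot X c) = z c := fun c => by
    obtain ⟨P, hP⟩ := hstable (dTot X c)
    set m := max P (N c)
    rw [hP m (le_max_left _ _)]
    have := congrArg z (dTot_sdHtPow m c)
    rw [hzd, map_sub, map_sub, (hN c m (le_max_right _ _)).1] at this
    omega
  have hv₀ : ∀ V : Set X, VanishesOn V z → VanishesOn V y₀ := fun V hV c hc => by
    obtain ⟨P, hP⟩ := hstable c
    rw [hP P le_rfl]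
    exact hV _ (sdHtPow_mem hc P)
  -- The homotopy preserves the chains in any set, so the primitive vanishes wherever z does;
  -- `sgnDual` cancels the sign in `dDual`.
  refine ⟨sgnDual X y₀, fun x hx => ?_, LinearMap.ext fun c => ?_, fun V hV => (hv₀ V hV).sgnDual⟩
  · obtain ⟨W, hW, hxW, h⟩ := hz x hx
    exact ⟨W, hW, hxW, (hv₀ W h).sgnDual⟩
  · rw [dDual_apply, sgnDual_apply, sgn_sgn, hd₀]

end LocallyZero

/-! ### Cones on singular simplices in a vector space. -/

section Cone

theorem map_succAbove_self {k : ℕ} (i : Fin (k + 2)) (t : stdSimplex ℝ (Fin (k + 1))) :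
    (stdSimplex.map i.succAbove t).1 i = 0 := by
  refine (FunOnFinite.linearMap_apply_apply ℝ ℝ i.succAbove t.1 i).trans ?_
  refine Finset.sum_eq_zero fun j hj => ?_
  exact absurd (Finset.mem_filter.1 hj).2 (Fin.succAbove_ne i j)

theorem map_succAbove_succAbove {k : ℕ} (i : Fin (k + 2)) (t : stdSimplex ℝ (Fin (k + 1)))
    (j : Fin (k + 1)) : (stdSimplex.map i.succAbove t).1 (i.succAbove j) = t.1 j := by
  refine (FunOnFinite.linearMap_apply_apply ℝ ℝ i.succAbove t.1 _).trans ?_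
  have : Finset.univ.filter (fun l => i.succAbove l = i.succAbove j) = {j} := by
    ext l
    simp
  rw [this, Finset.sum_singleton]

/-- The projection of a simplex from its vertex `0` to the opposite face. -/
def simplexTail {k : ℕ} (t : stdSimplex ℝ (Fin (k + 2))) : stdSimplex ℝ (Fin (k + 1)) :=
  if h : t.1 0 < 1 then ⟨fun i => t.1 i.succ / (1 - t.1 0),
    fun i => div_nonneg (t.2.1 _) (by linarith), by
      have := t.2.2
      rw [Fin.sum_univ_succ] at this
      rw [← Finset.sum_div, div_eq_one_iff_eq (by linarith)]
      linarith⟩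
  else Classical.arbitrary _

theorem simplexTail_apply {k : ℕ} {t : stdSimplex ℝ (Fin (k + 2))} (h : t.1 0 < 1)
    (i : Fin (k + 1)) : (simplexTail t).1 i = t.1 i.succ / (1 - t.1 0) := by
  rw [simplexTail, dif_pos h]

theorem simplex_zero_le_one {k : ℕ} (t : stdSimplex ℝ (Fin (k + 1))) (i : Fin (k + 1)) :
    t.1 i ≤ 1 := (mem_Icc_of_mem_stdSimplex t.2 i).2

theorem continuousAt_simplexTail {k : ℕ} {t : stdSimplex ℝ (Fin (k + 2))} (h : t.1 0 < 1) :
    ContinuousAt simplexTail t := by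
  have hc : ∀ i : Fin (k + 2), Continuous fun t : stdSimplex ℝ (Fin (k + 2)) => t.1 i :=
    fun i => (continuous_apply i).comp continuous_subtype_val
  rw [IsInducing.subtypeVal.continuousAt_iff]
  have h1 : ∀ᶠ s in 𝓝 t, (fun i => s.1 (Fin.succ i) / (1 - s.1 0)) = (simplexTail s).1 := by
    filter_upwards [(isOpen_lt (hc 0) continuous_const).mem_nhds h] with s hs
    exact funext fun i => (simplexTail_apply hs i).symm
  refine ContinuousAt.congr ?_ h1
  refine continuousAt_pi.2 fun i => ?_
  exact (hc i.succ).continuousAt.div (continuous_const.sub (hc 0)).continuousAt (by linarith)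

variable {E : Type*} [NormedAddCommGroup E] [NormedSpace ℝ E]

/-- The cone with apex `p` on a map from a simplex to a vector space. -/
def coneFun {k : ℕ} (p : E) (f : stdSimplex ℝ (Fin (k + 1)) → E) (t : stdSimplex ℝ (Fin (k + 2))) :
    E := t.1 0 • p + (1 - t.1 0) • f (simplexTail t)

/-- The projection to the opposite face is not under control at the apex, but there its weight 1 -
t₀ tends to zero while f is bounded by compactness. -/
theorem continuous_coneFun {k : ℕ} (p : E) {f : stdSimplex ℝ (Fin (k + 1)) → E}
    (hf : Continuous f) : Continuous (coneFun p f) := by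
  have hc : Continuous fun t : stdSimplex ℝ (Fin (k + 2)) => t.1 0 :=
    (continuous_apply 0).comp continuous_subtype_val
  refine continuous_iff_continuousAt.2 fun t => ?_
  rcases (simplex_zero_le_one t 0).lt_or_eq with h | h
  · exact (hc.continuousAt.smul continuousAt_const).add
      ((continuous_const.sub hc).continuousAt.smul
        (hf.continuousAt.comp (continuousAt_simplexTail h)))
  · obtain ⟨C, hC⟩ := (isCompact_range hf).isBounded.exists_norm_le
    refine (hc.continuousAt.smul continuousAt_const).add ?_
    have h0 : (1 - t.1 0) • f (simplexTail t) = 0 := by rw [h, sub_self, zero_smul]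
    rw [ContinuousAt, h0]
    refine squeeze_zero_norm (a := fun s => |1 - s.1 0| * C) (fun s => ?_) ?_
    · rw [norm_smul, Real.norm_eq_abs]
      exact mul_le_mul_of_nonneg_left (hC _ ⟨_, rfl⟩) (abs_nonneg _)
    · have : Continuous fun s : stdSimplex ℝ (Fin (k + 2)) => |1 - s.1 0| * C :=
        ((continuous_const.sub hc).abs).mul continuous_const
      have h2 := this.tendsto t
      simpa [h] using h2

theorem coneFun_face_zero {k : ℕ} (p : E) (f : stdSimplex ℝ (Fin (k + 1)) → E)
    (t : stdSimplex ℝ (Fin (k + 1))) :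
    coneFun p f (stdSimplex.map (Fin.succAbove 0) t) = f t := by
  have h0 := map_succAbove_self 0 t
  have : simplexTail (stdSimplex.map (Fin.succAbove 0) t) = t := by
    refine Subtype.ext (funext fun i => ?_)
    rw [simplexTail_apply (by rw [h0]; exact one_pos), h0, sub_zero, div_one]
    exact map_succAbove_succAbove 0 t i
  rw [coneFun, this, h0, zero_smul, zero_add, sub_zero, one_smul]

theorem coneFun_face_one (p : E) (f : stdSimplex ℝ (Fin 1) → E) (t : stdSimplex ℝ (Fin 1)) :
    coneFun p f (stdSimplex.map (Fin.succAbove (Fin.succ 0)) t) = p := by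
  have h0 : (stdSimplex.map (Fin.succAbove (Fin.succ 0)) t).1 (0 : Fin 2) = 1 := by
    refine (map_succAbove_succAbove (Fin.succ 0) t 0).trans ?_
    have := t.2.2
    rwa [Fin.sum_univ_one] at this
  rw [coneFun, h0, one_smul, sub_self, zero_smul, add_zero]

theorem coneFun_face_succ {k : ℕ} (p : E) (f : stdSimplex ℝ (Fin (k + 2)) → E) (i : Fin (k + 2))
    (t : stdSimplex ℝ (Fin (k + 2))) :
    coneFun p f (stdSimplex.map (Fin.succAbove i.succ) t) =
      coneFun p (fun s => f (stdSimplex.map i.succAbove s)) t := by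
  have h0 : (stdSimplex.map (Fin.succAbove i.succ) t).1 0 = t.1 0 := by
    have := map_succAbove_succAbove i.succ t 0
    rwa [Fin.succ_succAbove_zero] at this
  rw [coneFun, coneFun, h0]
  rcases (simplex_zero_le_one t 0).lt_or_eq with h | h
  · congr 3
    refine Subtype.ext (funext fun j => ?_)
    rw [simplexTail_apply (by rwa [h0]), h0]
    rcases Fin.eq_self_or_eq_succAbove i j with rfl | ⟨l, rfl⟩
    · rw [map_succAbove_self, map_succAbove_self, zero_div]
    · rw [map_succAbove_succAbove, simplexTail_apply h, ← Fin.succ_succAbove_succ,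
        map_succAbove_succAbove]
  · rw [h, sub_self, zero_smul, zero_smul]

theorem coneFun_mem {k : ℕ} {p : E} {S : Set E} (hS : StarConvex ℝ p S)
    {f : stdSimplex ℝ (Fin (k + 1)) → E} (hf : ∀ t, f t ∈ S) (t : stdSimplex ℝ (Fin (k + 2))) :
    coneFun p f t ∈ S :=
  hS (hf _) (t.2.1 0) (by linarith [simplex_zero_le_one t 0]) (by ring)

end Cone

/-! ### Star-shaped parts of charts. -/

section ChartSet

variable {E : Type*} [TopologicalSpace E] {M : Type u} [TopologicalSpace M]

/-- The points of a chart domain with coordinates in `S`. -/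
def chartSet (e : OpenPartialHomeomorph M E) (S : Set E) : Set M := e.source ∩ e ⁻¹' S

theorem isOpen_chartSet (e : OpenPartialHomeomorph M E) {S : Set E} (hS : IsOpen S) :
    IsOpen (chartSet e S) := e.isOpen_inter_preimage hS

theorem chartSet_mono (e : OpenPartialHomeomorph M E) {S T : Set E} (h : S ⊆ T) :
    chartSet e S ⊆ chartSet e T := fun _ hx => ⟨hx.1, h hx.2⟩

theorem symm_mem_chartSet (e : OpenPartialHomeomorph M E) {S : Set E} {y : E}
    (hy : y ∈ e.target) (hS : y ∈ S) : e.symm y ∈ chartSet e S :=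
  ⟨e.map_target hy, by rwa [mem_preimage, e.right_inv hy]⟩

theorem chartSet_inter (e : OpenPartialHomeomorph M E) (S T : Set E) :
    chartSet e (S ∩ T) = chartSet e S ∩ chartSet e T := by
  ext x
  exact ⟨fun h => ⟨⟨h.1, h.2.1⟩, h.1, h.2.2⟩, fun h => ⟨h.1.1, h.1.2, h.2.2⟩⟩

theorem chartSet_union (e : OpenPartialHomeomorph M E) (S T : Set E) :
    chartSet e (S ∪ T) = chartSet e S ∪ chartSet e T :=
  inter_union_distrib_left _ _ _

end ChartSet

section ChartCone

variable {E : Type*} [NormedAddCommGroup E] [NormedSpace ℝ E]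
variable {M : Type u} [TopologicalSpace M]

/-- The cone with apex `p` on a singular simplex in a star-shaped part of a chart. -/
def chartConeSimp (e : OpenPartialHomeomorph M E) {Ω : Set E} {p : E} (hΩ : StarConvex ℝ p Ω)
    (hΩe : Ω ⊆ e.target) {k : ℕ} (σ : Simp M k) (hσ : ∀ t, σ t ∈ chartSet e Ω) :
    Simp M (k + 1) where
  toFun t := e.symm (coneFun p (fun u => e (σ u)) t)
  continuous_toFun := by
    refine e.continuousOn_symm.comp_continuous (continuous_coneFun p ?_) fun t =>
      hΩe (coneFun_mem hΩ (fun u => (hσ u).2) t)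
    exact e.continuousOn.comp_continuous σ.continuous fun t => (hσ t).1

variable (e : OpenPartialHomeomorph M E) {Ω : Set E} {p : E}

open Classical in
/-- The cone with apex `p` on the singular chains in a star-shaped part of a chart. -/
def chartCone (hΩ : StarConvex ℝ p Ω) (hΩe : Ω ⊆ e.target) : Tot M →ₗ[ℤ] Tot M :=
  Finsupp.linearCombination ℤ fun s : Simplex M =>
    if h : ∀ t, s.2 t ∈ chartSet e Ω then
      Finsupp.single (⟨s.1 + 1, chartConeSimp e hΩ hΩe s.2 h⟩ : Simplex M) 1
    else 0

theorem chartCone_single (hΩ : StarConvex ℝ p Ω) (hΩe : Ω ⊆ e.target) {k : ℕ} {σ : Simp M k}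
    (hσ : ∀ t, σ t ∈ chartSet e Ω) : chartCone e hΩ hΩe (Finsupp.single ⟨k, σ⟩ 1) =
      Finsupp.single (⟨k + 1, chartConeSimp e hΩ hΩe σ hσ⟩ : Simplex M) 1 := by
  rw [chartCone, Finsupp.linearCombination_single, one_smul, dif_pos hσ]

theorem chartCone_mem (hΩ : StarConvex ℝ p Ω) (hΩe : Ω ⊆ e.target) {S : Set E}
    (hS : StarConvex ℝ p S) (hSΩ : S ⊆ Ω) {c : Tot M} (hc : c ∈ totIn (chartSet e S)) :
    chartCone e hΩ hΩe c ∈ totIn (chartSet e S) := by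
  refine map_totIn_mem (fun k σ hσ => ?_) hc
  rw [chartCone_single e hΩ hΩe fun t => chartSet_mono e hSΩ (hσ t)]
  refine single_mem_totIn (fun t => ?_) 1
  have hm := coneFun_mem hS (fun u => (hσ u).2) t
  exact symm_mem_chartSet e (hΩe (hSΩ hm)) hm

/-- The singular `0`-simplex at a point. -/
def pointSimplex (x : M) : Simplex M := ⟨0, ContinuousMap.const _ x⟩

/-- The singular version of `tupleBd_cone`. It makes star-shaped parts of a chart acyclic, relative
to smaller parts that are star-shaped about the same apex, and it is also the Poincaré lemma. -/
theorem dTot_chartCone (hΩ : StarConvex ℝ p Ω) (hΩe : Ω ⊆ e.target) {c : Tot M}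
    (hc : c ∈ totIn (chartSet e Ω)) : dTot M (chartCone e hΩ hΩe c) =
      c - chartCone e hΩ hΩe (dTot M c) -
        augTot M c • Finsupp.single (pointSimplex (e.symm p)) 1 := by
  rw [← sub_eq_zero, ← Submodule.mem_bot ℤ]
  refine map_totIn_mem (f := dTot M ∘ₗ chartCone e hΩ hΩe - (LinearMap.id -
    chartCone e hΩ hΩe ∘ₗ dTot M - (LinearMap.toSpanSingleton ℤ _
      (Finsupp.single (pointSimplex (e.symm p)) 1)) ∘ₗ augTot M)) (fun k σ hσ => ?_) hc
  rw [Submodule.mem_bot, LinearMap.sub_apply, sub_eq_zero]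
  simp only [LinearMap.comp_apply, LinearMap.sub_apply, LinearMap.id_apply,
      LinearMap.toSpanSingleton_apply]
  rw [chartCone_single e hΩ hΩe hσ, augTot_single, ← ofDeg_single, dTot_ofDeg_succ, bd_single,
    map_sum, Fin.sum_univ_succ]
  have h0 : pull (Fin.succAbove 0) (chartConeSimp e hΩ hΩe σ hσ) = σ := by
    ext t : 1
    refine (congrArg e.symm (coneFun_face_zero p _ t)).trans ?_
    exact e.left_inv (hσ t).1
  rw [h0, map_smul, ofDeg_single, Fin.val_zero, pow_zero, one_smul]
  rcases k with _ | k
  · have h1 : pull (Fin.succAbove (Fin.succ 0)) (chartConeSimp e hΩ hΩe σ hσ) =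
        ContinuousMap.const _ (e.symm p) := by
      ext t : 1
      exact congrArg e.symm (coneFun_face_one p _ t)
    rw [Fin.sum_univ_one, h1, map_smul, ofDeg_single, ← ofDeg_single 0 σ, dTot_ofDeg_zero,
      map_zero, if_pos rfl, one_smul, sub_zero]
    simp [pointSimplex, sub_eq_add_neg]
  · have hp : ∀ (i : Fin (k + 2)) t, pull i.succAbove σ t ∈ chartSet e Ω := fun i t => hσ _
    have hs : ∀ (i : Fin (k + 2)), pull (Fin.succAbove i.succ) (chartConeSimp e hΩ hΩe σ hσ) =
        chartConeSimp e hΩ hΩe (pull i.succAbove σ) (hp i) := fun i => by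
      ext t : 1
      exact congrArg e.symm (coneFun_face_succ p _ i t)
    rw [if_neg (by omega), zero_smul, sub_zero, sub_eq_add_neg, ← ofDeg_single (k + 1) σ,
      dTot_ofDeg_succ, bd_single, map_sum, map_sum, ← Finset.sum_neg_distrib]
    congr 1
    refine Finset.sum_congr rfl fun i _ => ?_
    rw [hs, map_smul, map_smul, map_smul, ofDeg_single, ofDeg_single,
      chartCone_single e hΩ hΩe (hp i), Fin.val_succ, pow_succ]
    simp

end ChartCone

/-! ### Homological algebra of quotients P / Q inside a fixed group. -/

section Acyclic

variable {V : Type*} [AddCommGroup V] (d : V →ₗ[ℤ] V)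

/-- The complex `P / Q` is acyclic. -/
def Acyclic (P Q : Submodule ℤ V) : Prop := ∀ v ∈ P, d v ∈ Q → ∃ u ∈ P, v - d u ∈ Q

/-- The homology of `P / Q` is infinite cyclic, generated by the class of `g`. -/
structure IsGen (P Q : Submodule ℤ V) (g : V) : Prop where
  mem : g ∈ P
  d_mem : d g ∈ Q
  exists_smul : ∀ c ∈ P, d c ∈ Q → ∃ r : ℤ, ∃ e ∈ P, c - r • g - d e ∈ Q
  eq_zero : ∀ r : ℤ, ∀ e ∈ P, r • g - d e ∈ Q → r = 0

variable {d}

/-- Relative Mayer–Vietoris: when P/Q₁ and P/Q₂ are acyclic, the connecting homomorphism from the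
homology of P/(Q₁ + Q₂) to that of P/(Q₁ ∩ Q₂) is an isomorphism. The difference of the two chains
bounded by g is a preimage of its class up to sign. -/
theorem IsGen.suspend (hd : ∀ v, d (d v) = 0) {P Q₁ Q₂ : Submodule ℤ V}
    (hQ₁ : ∀ v ∈ Q₁, d v ∈ Q₁) (hQ₂ : ∀ v ∈ Q₂, d v ∈ Q₂) (h₁ : Q₁ ≤ P) (h₂ : Q₂ ≤ P)
    (ha₁ : Acyclic d P Q₁) (ha₂ : Acyclic d P Q₂) {g u₁ u₂ : V} (hg : IsGen d P (Q₁ ⊓ Q₂) g)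
    (hu₁ : u₁ ∈ P) (hu₂ : u₂ ∈ P) (hg₁ : g - d u₁ ∈ Q₁) (hg₂ : g - d u₂ ∈ Q₂) :
    IsGen d P (Q₁ ⊔ Q₂) (u₁ - u₂) where
  mem := sub_mem hu₁ hu₂
  d_mem := by
    have : d (u₁ - u₂) = -(g - d u₁) + (g - d u₂) := by rw [map_sub]; abel
    rw [this]
    exact Submodule.add_mem_sup (neg_mem hg₁) hg₂
  exists_smul := by
    intro c hc hdc
    obtain ⟨m₁, hm₁, m₂, hm₂, e⟩ := Submodule.mem_sup.1 hdc
    have hdm : d m₁ = -d m₂ := by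
      have := congrArg d e
      rw [map_add, hd] at this
      exact eq_neg_of_add_eq_zero_left this
    obtain ⟨r, w, hw, hz⟩ := hg.exists_smul m₁ (h₁ hm₁)
      ⟨hQ₁ _ hm₁, by rw [hdm]; exact neg_mem (hQ₂ _ hm₂)⟩
    obtain ⟨e₂, he₂, hq⟩ := ha₂ (c - r • u₂ - w)
      (sub_mem (sub_mem hc (Submodule.smul_mem _ _ hu₂)) hw) (by
        have : d (c - r • u₂ - w) = (m₁ - r • g - d w) + m₂ + r • (g - d u₂) := by
          rw [map_sub, map_sub, map_smul, ← e, smul_sub]; abel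
        rw [this]
        exact add_mem (add_mem hz.2 hm₂) (Submodule.smul_mem _ _ hg₂))
    obtain ⟨e₁, he₁, hp⟩ := ha₁ (r • u₁ + w) (add_mem (Submodule.smul_mem _ _ hu₁) hw) (by
        have : d (r • u₁ + w) = m₁ - (m₁ - r • g - d w) - r • (g - d u₁) := by
          rw [map_add, map_smul, smul_sub]; abel
        rw [this]
        exact sub_mem (sub_mem hm₁ hz.1) (Submodule.smul_mem _ _ hg₁))
    -- The part of d (u₁ - u₂) in Q₁ is -(g - d u₁), so the connecting map takes the new generator
    -- to the class of -g.
    refine ⟨-r, e₁ + e₂, add_mem he₁ he₂, ?_⟩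
    have : c - (-r) • (u₁ - u₂) - d (e₁ + e₂) =
        (r • u₁ + w - d e₁) + (c - r • u₂ - w - d e₂) := by
      rw [neg_smul, smul_sub, map_add]; abel
    rw [this]
    exact Submodule.add_mem_sup hp hq
  eq_zero := by
    intro r e he h
    obtain ⟨y₁, hy₁, y₂, hy₂, hy⟩ := Submodule.mem_sup.1 h
    have e2 : r • u₁ - y₁ - d e = r • u₂ + y₂ := by
      have : y₂ = r • (u₁ - u₂) - d e - y₁ := by rw [← hy]; abel
      rw [this, smul_sub]; abel
    refine hg.eq_zero r (r • u₂ + y₂) (add_mem (Submodule.smul_mem _ _ hu₂) (h₂ hy₂)) ⟨?_, ?_⟩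
    · have : r • g - d (r • u₂ + y₂) = r • (g - d u₁) + d y₁ := by
        rw [← e2, map_sub, map_sub, hd, map_smul, smul_sub]; abel
      rw [this]
      exact add_mem (Submodule.smul_mem _ _ hg₁) (hQ₁ _ hy₁)
    · have : r • g - d (r • u₂ + y₂) = r • (g - d u₂) - d y₂ := by
        rw [map_add, map_smul, smul_sub]; abel
      rw [this]
      exact sub_mem (Submodule.smul_mem _ _ hg₂) (hQ₂ _ hy₂)

/-- Enlarging the denominator by an acyclic quotient changes nothing. It serves to replace a sum of
chain groups by the chains in the union. -/
theorem IsGen.of_acyclic (hd : ∀ v, d (d v) = 0) {P Q Q' : Submodule ℤ V}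
    (hQ : Q ≤ Q') (hP : Q' ≤ P) (ha : Acyclic d Q' Q) {g : V}
    (hg : IsGen d P Q g) : IsGen d P Q' g where
  mem := hg.mem
  d_mem := hQ hg.d_mem
  exists_smul := by
    intro c hc hdc
    obtain ⟨e, he, h⟩ := ha (d c) hdc (by rw [hd]; exact zero_mem _)
    obtain ⟨r, w, hw, h⟩ := hg.exists_smul (c - e) (sub_mem hc (hP he)) (by rwa [map_sub])
    refine ⟨r, w, hw, ?_⟩
    have : c - r • g - d w = (c - e - r • g - d w) + e := by abel
    rw [this]
    exact add_mem (hQ h) he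
  eq_zero := by
    intro r e he h
    obtain ⟨w, hw, h'⟩ := ha _ h (by
      rw [map_sub, hd, sub_zero, map_smul]
      exact Submodule.smul_mem _ _ hg.d_mem)
    refine hg.eq_zero r (e + w) (add_mem he (hP hw)) ?_
    rwa [map_add, ← sub_sub]

/-- P₁/(P₁ ∩ Q) is the same as (P₁ + Q)/Q, which differs from P/Q by the acyclic quotient P/(P₁ +
Q). -/
theorem IsGen.of_excision (hd : ∀ v, d (d v) = 0) {P P₁ Q : Submodule ℤ V}
    (hP₁ : ∀ v ∈ P₁, d v ∈ P₁) (hQ : ∀ v ∈ Q, d v ∈ Q) (h₁ : P₁ ≤ P)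
    (ha : Acyclic d P (P₁ ⊔ Q)) {g : V} (hg : IsGen d P₁ (P₁ ⊓ Q) g) : IsGen d P Q g where
  mem := h₁ hg.mem
  d_mem := hg.d_mem.2
  exists_smul := by
    intro c hc hdc
    obtain ⟨e, he, h⟩ := ha c hc (Submodule.mem_sup_right hdc)
    obtain ⟨c₁, hc₁, c₂, hc₂, hs⟩ := Submodule.mem_sup.1 h
    have hd₁ : d c₁ = d c - d c₂ := by
      have := congrArg d hs
      rw [map_add, map_sub, hd, sub_zero] at this
      exact eq_sub_of_add_eq this
    obtain ⟨r, w, hw, h⟩ := hg.exists_smul c₁ hc₁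
      ⟨hP₁ _ hc₁, by rw [hd₁]; exact sub_mem hdc (hQ _ hc₂)⟩
    refine ⟨r, e + w, add_mem he (h₁ hw), ?_⟩
    have : c - r • g - d (e + w) = (c₁ - r • g - d w) + c₂ := by
      have : c = c₁ + c₂ + d e := by rw [hs]; abel
      rw [this, map_add]; abel
    rw [this]
    exact add_mem h.2 hc₂
  eq_zero := by
    intro r e he h
    have hde : d e ∈ P₁ ⊔ Q := by
      have : d e = r • g + -(r • g - d e) := by abel
      rw [this]
      exact Submodule.add_mem_sup (Submodule.smul_mem _ _ hg.mem) (neg_mem h)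
    obtain ⟨w, hw, h'⟩ := ha e he hde
    obtain ⟨y₁, hy₁, y₂, hy₂, hs⟩ := Submodule.mem_sup.1 h'
    have hd₁ : d e = d y₁ + d y₂ := by
      rw [← map_add, hs, map_sub, hd, sub_zero]
    refine hg.eq_zero r y₁ hy₁ ⟨sub_mem (Submodule.smul_mem _ _ hg.mem) (hP₁ _ hy₁), ?_⟩
    have : r • g - d y₁ = (r • g - d e) + d y₂ := by rw [hd₁]; abel
    rw [this]
    exact add_mem h (hQ _ hy₂)

end Acyclic

/-! ### The local homology of a manifold. -/

section LocalHomology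

variable {M : Type u} [TopologicalSpace M] {n : ℕ}

theorem acyclic_of_starConvex {E : Type*} [NormedAddCommGroup E] [NormedSpace ℝ E]
    (e : OpenPartialHomeomorph M E) {Ω S : Set E} {p : E} (hΩ : StarConvex ℝ p Ω)
    (hΩe : Ω ⊆ e.target) (hS : StarConvex ℝ p S) (hSΩ : S ⊆ Ω) (hp : p ∈ S) :
    Acyclic (dTot M) (totIn (chartSet e Ω)) (totIn (chartSet e S)) := by
  intro c hc hdc
  refine ⟨chartCone e hΩ hΩe c, chartCone_mem e hΩ hΩe hΩ le_rfl hc, ?_⟩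
  rw [dTot_chartCone e hΩ hΩe hc]
  have : c - (c - chartCone e hΩ hΩe (dTot M c) -
      augTot M c • Finsupp.single (pointSimplex (e.symm p)) 1) = chartCone e hΩ hΩe (dTot M c) +
      augTot M c • Finsupp.single (pointSimplex (e.symm p)) 1 := by abel
  rw [this]
  refine add_mem (chartCone_mem e hΩ hΩe hS hSΩ hdc) (Submodule.smul_mem _ _ ?_)
  exact single_mem_totIn (fun _ => symm_mem_chartSet e (hΩe (hSΩ hp)) hp) 1

theorem isGen_point {E : Type*} [NormedAddCommGroup E] [NormedSpace ℝ E]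
    (e : OpenPartialHomeomorph M E) {Ω : Set E} {p : E} (hΩ : StarConvex ℝ p Ω)
    (hΩe : Ω ⊆ e.target) (hp : p ∈ Ω) :
    IsGen (dTot M) (totIn (chartSet e Ω)) ⊥ (Finsupp.single (pointSimplex (e.symm p)) 1) where
  mem := single_mem_totIn (fun _ => symm_mem_chartSet e (hΩe hp) hp) 1
  d_mem := by
    rw [pointSimplex, ← ofDeg_single, dTot_ofDeg_zero]
    exact zero_mem _
  exists_smul := by
    intro c hc hdc
    rw [Submodule.mem_bot] at hdc
    refine ⟨augTot M c, chartCone e hΩ hΩe c, chartCone_mem e hΩ hΩe hΩ le_rfl hc, ?_⟩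
    rw [dTot_chartCone e hΩ hΩe hc, hdc, map_zero, sub_zero, Submodule.mem_bot]
    abel
  eq_zero := by
    intro r c _ h
    rw [Submodule.mem_bot, sub_eq_zero] at h
    have := congrArg (augTot M) h
    rw [augTot_dTot, map_smul, pointSimplex, augTot_single] at this
    simpa using this

/-- The affine subspaces through `y₀` in which the first `d` coordinates are fixed. -/
def coordFlat (y₀ : EuclideanSpace ℝ (Fin n)) (d : ℕ) : Set (EuclideanSpace ℝ (Fin n)) :=
  {y | ∀ i : Fin n, (i : ℕ) < d → y i = y₀ i}

theorem isClosed_coordFlat (y₀ : EuclideanSpace ℝ (Fin n)) (d : ℕ) :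
    IsClosed (coordFlat y₀ d) := by
  simp only [coordFlat, Set.ofPred_forall]
  refine isClosed_iInter fun i => isClosed_iInter fun _ => ?_
  exact isClosed_eq (by fun_prop) continuous_const

/-- The half of a flat on one side of the hyperplane that cuts out the next flat. -/
def halfFlat (y₀ : EuclideanSpace ℝ (Fin n)) (j : Fin n) (s : ℝ) :
    Set (EuclideanSpace ℝ (Fin n)) := coordFlat y₀ j ∩ {y | 0 ≤ s * (y j - y₀ j)}

theorem isClosed_halfFlat (y₀ : EuclideanSpace ℝ (Fin n)) (j : Fin n) (s : ℝ) :
    IsClosed (halfFlat y₀ j s) :=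
  (isClosed_coordFlat y₀ j).inter (isClosed_le continuous_const (by fun_prop))

theorem halfFlat_union (y₀ : EuclideanSpace ℝ (Fin n)) (j : Fin n) :
    halfFlat y₀ j 1 ∪ halfFlat y₀ j (-1) = coordFlat y₀ j := by
  ext y
  refine ⟨fun h => h.elim And.left And.left, fun h => ?_⟩
  rcases le_total 0 (y j - y₀ j) with h' | h'
  · exact Or.inl ⟨h, by simpa using h'⟩
  · exact Or.inr ⟨h, by simpa using h'⟩

theorem halfFlat_inter (y₀ : EuclideanSpace ℝ (Fin n)) (j : Fin n) :
    halfFlat y₀ j 1 ∩ halfFlat y₀ j (-1) = coordFlat y₀ (j + 1) := by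
  ext y
  constructor
  · rintro ⟨⟨h, h1⟩, -, h2⟩ i hi
    rcases Nat.lt_succ_iff_lt_or_eq.1 hi with hi | hi
    · exact h i hi
    · obtain rfl : i = j := Fin.ext hi
      simp only [mem_ofPred_eq] at h1 h2
      linarith
  · intro h
    have hj : y j = y₀ j := h j (Nat.lt_succ_self _)
    have hf : y ∈ coordFlat y₀ j := fun i hi => h i (hi.trans (Nat.lt_succ_self _))
    exact ⟨⟨hf, by simp [hj]⟩, hf, by simp [hj]⟩

/-- The apex is pushed off the half flat, against its inward direction and by half the radius to
stay in the ball. If a point between the apex and y lies in the half flat, then so does y: their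
first coordinates agree, and y lies even further inside. -/
theorem starConvex_ball_diff_halfFlat (y₀ : EuclideanSpace ℝ (Fin n)) (j : Fin n) {s R : ℝ}
    (hs : s * s = 1) (hR : 0 < R) :
    y₀ - (s * (R / 2)) • EuclideanSpace.single j (1 : ℝ) ∈ Metric.ball y₀ R \ halfFlat y₀ j s ∧
      StarConvex ℝ (y₀ - (s * (R / 2)) • EuclideanSpace.single j (1 : ℝ))
        (Metric.ball y₀ R \ halfFlat y₀ j s) := by
  set p := y₀ - (s * (R / 2)) • EuclideanSpace.single j (1 : ℝ) with hp
  have hpj : p j = y₀ j - s * (R / 2) := by simp [hp]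
  have hpi : ∀ i : Fin n, (i : ℕ) < j → p i = y₀ i := fun i hi => by
    have : i ≠ j := fun h => by omega
    simp [hp, this]
  have hs1 : |s| = 1 := by
    have : |s| * |s| = 1 := by rw [← abs_mul, hs, abs_one]
    nlinarith [abs_nonneg s]
  have hpb : p ∈ Metric.ball y₀ R := by
    rw [Metric.mem_ball, dist_eq_norm, hp, sub_sub_cancel_left, norm_neg, norm_smul,
      PiLp.norm_single, norm_one, mul_one, norm_mul, Real.norm_eq_abs, hs1, one_mul,
      Real.norm_of_nonneg (by positivity)]
    linarith
  have key : s * (p j - y₀ j) = -(R / 2) := by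
    rw [hpj]; linear_combination (-(R / 2)) * hs
  refine ⟨⟨hpb, fun h => ?_⟩, ?_⟩
  · have h2 : 0 ≤ s * (p j - y₀ j) := h.2
    linarith
  · intro y hy a b ha hb hab
    refine ⟨(convex_ball y₀ R) hpb hy.1 ha hb hab, fun h => ?_⟩
    have hz : ∀ i, (a • p + b • y) i = a * p i + b * y i := fun i => by simp
    have h2 : 0 ≤ s * ((a • p + b • y) j - y₀ j) := h.2
    have e2 : s * ((a • p + b • y) j - y₀ j) = a * -(R / 2) + b * (s * (y j - y₀ j)) := by
      rw [hz, ← key]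
      obtain rfl : a = 1 - b := by linarith
      ring
    rw [e2] at h2
    have hb0 : b ≠ 0 := by
      rintro rfl
      have : a = 1 := by linarith
      subst this
      linarith
    have hbp : 0 < b := lt_of_le_of_ne hb hb0.symm
    refine hy.2 ⟨fun i hi => ?_, ?_⟩
    · have h3 : (a • p + b • y) i = y₀ i := h.1 i hi
      rw [hz, hpi i hi] at h3
      obtain rfl : a = 1 - b := by linarith
      have : b * (y i - y₀ i) = 0 := by linarith
      rcases mul_eq_zero.1 this with h4 | h4
      · exact absurd h4 hb0
      · linarith
    · by_contra hn
      have hn' : s * (y j - y₀ j) < 0 := not_le.1 hn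
      nlinarith [mul_pos hbp (neg_pos.2 hn'), mul_nonneg ha (half_pos hR).le]

theorem chartCone_mem_range {E : Type*} [NormedAddCommGroup E] [NormedSpace ℝ E]
    (e : OpenPartialHomeomorph M E) {Ω : Set E} {p : E} (hΩ : StarConvex ℝ p Ω)
    (hΩe : Ω ⊆ e.target) {k : ℕ} {c : Tot M} (hc : c ∈ LinearMap.range (ofDeg M k)) :
    chartCone e hΩ hΩe c ∈ LinearMap.range (ofDeg M (k + 1)) := by
  classical
  obtain ⟨c, rfl⟩ := hc
  induction c using Finsupp.induction_linear with
  | zero => simp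
  | add x y hx hy =>
    rw [map_add, map_add]
    exact add_mem hx hy
  | single σ a =>
    rw [ofDeg_single, chartCone, Finsupp.linearCombination_single]
    refine Submodule.smul_mem _ _ ?_
    split_ifs with h
    · exact ⟨Finsupp.single _ 1, ofDeg_single _ _ _⟩
    · exact zero_mem _

/-- The complements of the two half flats are star-shaped in the ball. They intersect in the
complement of one flat, and their union is the complement of the next, so each further fixed
coordinate is a suspension that raises the degree by one. The start is the full space, with empty
complement and a point as generator; for d = n the flat is the single point y₀. -/
theorem exists_isGen_flat (e : OpenPartialHomeomorph M (EuclideanSpace ℝ (Fin n)))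
    (y₀ : EuclideanSpace ℝ (Fin n)) {R : ℝ} (hR : 0 < R) (hball : Metric.ball y₀ R ⊆ e.target)
    (d : ℕ) (hdn : d ≤ n) : ∃ g ∈ LinearMap.range (ofDeg M d),
      IsGen (dTot M) (totIn (chartSet e (Metric.ball y₀ R)))
        (totIn (chartSet e (Metric.ball y₀ R \ coordFlat y₀ d))) g := by
  set Ω := Metric.ball y₀ R with hΩ
  induction d with
  | zero =>
    have h0 : chartSet e (Ω \ coordFlat y₀ 0) = ∅ := by
      have : coordFlat y₀ 0 = univ := eq_univ_of_forall fun y i hi => absurd hi (Nat.not_lt_zero _)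
      rw [this, sdiff_univ]
      exact inter_empty _
    have hbot : totIn (∅ : Set M) = ⊥ := eq_bot_iff.2 fun c hc => (Submodule.mem_bot ℤ).2
      (totIn_empty hc)
    rw [h0, hbot]
    exact ⟨_, ⟨Finsupp.single _ 1, ofDeg_single _ _ _⟩,
      isGen_point e ((convex_ball y₀ R).starConvex (Metric.mem_ball_self hR)) hball
        (Metric.mem_ball_self hR)⟩
  | succ d ih =>
    obtain ⟨g, hgd, hg⟩ := ih (by omega)
    let j : Fin n := ⟨d, by omega⟩
    have hj : (j : ℕ) = d := rfl
    obtain ⟨hp₁, hs₁⟩ := starConvex_ball_diff_halfFlat y₀ j (s := 1) (by norm_num) hR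
    obtain ⟨hp₂, hs₂⟩ := starConvex_ball_diff_halfFlat y₀ j (s := -1) (by norm_num) hR
    have hΩ₁ := (convex_ball y₀ R).starConvex hp₁.1
    have hΩ₂ := (convex_ball y₀ R).starConvex hp₂.1
    have ha₁ := acyclic_of_starConvex e hΩ₁ hball hs₁ sdiff_subset hp₁
    have ha₂ := acyclic_of_starConvex e hΩ₂ hball hs₂ sdiff_subset hp₂
    have ho : ∀ s, IsOpen (chartSet e (Ω \ halfFlat y₀ j s)) := fun s =>
      isOpen_chartSet e (Metric.isOpen_ball.sdiff (isClosed_halfFlat y₀ j s))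
    have hcap : chartSet e (Ω \ coordFlat y₀ d) =
        chartSet e (Ω \ halfFlat y₀ j 1) ∩ chartSet e (Ω \ halfFlat y₀ j (-1)) := by
      rw [← chartSet_inter, sdiff_inter_sdiff, halfFlat_union]
    have hcup : chartSet e (Ω \ coordFlat y₀ (d + 1)) =
        chartSet e (Ω \ halfFlat y₀ j 1) ∪ chartSet e (Ω \ halfFlat y₀ j (-1)) := by
      rw [← chartSet_union, ← sdiff_inter, halfFlat_inter]
    have hle : ∀ s, totIn (chartSet e (Ω \ halfFlat y₀ j s)) ≤ totIn (chartSet e Ω) := fun s =>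
      totIn_mono (chartSet_mono e sdiff_subset)
    rw [hcap, totIn_inter] at hg
    -- the two cones on `g` differ by the generator of the next flat
    have hk : ∀ {p : EuclideanSpace ℝ (Fin n)} (hΩp : StarConvex ℝ p Ω) (s : ℝ),
        p ∈ Ω \ halfFlat y₀ j s → StarConvex ℝ p (Ω \ halfFlat y₀ j s) →
        dTot M g ∈ totIn (chartSet e (Ω \ halfFlat y₀ j s)) →
        g - dTot M (chartCone e hΩp hball g) ∈ totIn (chartSet e (Ω \ halfFlat y₀ j s)) := by
      intro p hΩp s hp hS hdg
      rw [dTot_chartCone e hΩp hball hg.mem]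
      have : g - (g - chartCone e hΩp hball (dTot M g) -
          augTot M g • Finsupp.single (pointSimplex (e.symm p)) 1) =
          chartCone e hΩp hball (dTot M g) +
          augTot M g • Finsupp.single (pointSimplex (e.symm p)) 1 := by abel
      rw [this]
      refine add_mem (chartCone_mem e hΩp hball hS sdiff_subset hdg) (Submodule.smul_mem _ _ ?_)
      exact single_mem_totIn (fun _ => symm_mem_chartSet e (hball hp.1) hp) 1
    refine ⟨chartCone e hΩ₁ hball g - chartCone e hΩ₂ hball g,
      sub_mem (chartCone_mem_range e hΩ₁ hball hgd) (chartCone_mem_range e hΩ₂ hball hgd), ?_⟩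
    have hs := hg.suspend dTot_dTot (fun v => dTot_mem) (fun v => dTot_mem)
      (hle _) (hle _) ha₁ ha₂ (chartCone_mem e hΩ₁ hball hΩ₁ le_rfl hg.mem)
      (chartCone_mem e hΩ₂ hball hΩ₂ le_rfl hg.mem) (hk hΩ₁ 1 hp₁ hs₁ hg.d_mem.1)
      (hk hΩ₂ (-1) hp₂ hs₂ hg.d_mem.2)
    rw [hcup]
    refine hs.of_acyclic dTot_dTot (sup_le_totIn _ _)
      (totIn_mono (union_subset (chartSet_mono e sdiff_subset) (chartSet_mono e sdiff_subset))) ?_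
    exact fun c hc hdc => excision (ho 1) (ho (-1)) hc hdc

/-- The local homology of a manifold is infinite cyclic and concentrated in degree `n`. -/
theorem exists_isGen_local [T1Space M] [ChartedSpace (EuclideanSpace ℝ (Fin n)) M] (x : M) :
    ∃ g ∈ LinearMap.range (ofDeg M n), IsGen (dTot M) ⊤ (totIn ({x}ᶜ : Set M)) g := by
  set e := chartAt (EuclideanSpace ℝ (Fin n)) x
  have hx : x ∈ e.source := mem_chart_source _ x
  obtain ⟨R, hR, hball⟩ := Metric.isOpen_iff.1 e.open_target (e x) (e.map_source hx)
  obtain ⟨g, hgd, hg⟩ := exists_isGen_flat e (e x) hR hball n le_rfl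
  refine ⟨g, hgd, ?_⟩
  have h1 : chartSet e (Metric.ball (e x) R \ coordFlat (e x) n) =
      chartSet e (Metric.ball (e x) R) ∩ {x}ᶜ := by
    ext y
    constructor
    · rintro ⟨hy, hy', hf⟩
      refine ⟨⟨hy, hy'⟩, ?_⟩
      rintro rfl
      exact hf fun i _ => rfl
    · rintro ⟨⟨hy, hy'⟩, hne⟩
      refine ⟨hy, hy', fun hf => hne ?_⟩
      refine e.injOn hy hx ?_
      ext i
      exact hf i i.2
  rw [h1, totIn_inter] at hg
  refine hg.of_excision dTot_dTot (fun v => dTot_mem) (fun v => dTot_mem) le_top ?_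
  intro c _ hdc
  have hu : chartSet e (Metric.ball (e x) R) ∪ {x}ᶜ = univ := eq_univ_of_forall fun y => by
    by_cases h : y = x
    · subst h
      exact Or.inl ⟨hx, Metric.mem_ball_self hR⟩
    · exact Or.inr h
  obtain ⟨w, -, hw⟩ := excision (isOpen_chartSet e Metric.isOpen_ball) isOpen_compl_singleton
    (hu ▸ mem_totIn_univ c) hdc
  exact ⟨w, Submodule.mem_top, hw⟩

end LocalHomology

/-! ### Induction over the compact subsets of a manifold. -/

section CompactPrinciple

variable {M : Type u} [TopologicalSpace M] {V : Type*}

/-- Data for a Mayer–Vietoris induction over the compact subsets of a space: `Cyc v K` says that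
`v` is a cycle over `K`, and `Tr v K` that it bounds over `K`. -/
structure CompactInduction (Cyc Tr : V → Set M → Prop) : Prop where
  anti : ∀ v K L, K ⊆ L → Cyc v L → Cyc v K
  union : ∀ v K L, IsCompact K → IsCompact L → Tr v K → Tr v L →
    (∀ w, Cyc w (K ∩ L) → Tr w (K ∩ L)) → Cyc v (K ∪ L) → Tr v (K ∪ L)
  nhds : ∀ v K T, IsCompact K → IsCompact T → K ⊆ T → Cyc v T → Tr v K →
    ∃ W, IsOpen W ∧ K ⊆ W ∧ ∀ K', IsCompact K' → K' ⊆ W → K' ⊆ T → Tr v K'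
  empty : ∀ v, Cyc v ∅ → Tr v ∅
  point : ∀ v x, Cyc v {x} → Tr v {x}

variable {Cyc Tr : V → Set M → Prop}

/-- By the neighbourhood property each fibre of f is contained in a slab over which v bounds. A
partition of the compact interval containing f(K) puts each piece in such a slab; consecutive slabs
meet in a single fibre, where the hypothesis holds for all elements, so they can be glued one after
another. -/
theorem CompactInduction.of_slices [T2Space M] (H : CompactInduction Cyc Tr) {K : Set M}
    (hK : IsCompact K) {f : M → ℝ} (hf : ContinuousOn f K)
    (hs : ∀ s, ∀ v, Cyc v (K ∩ f ⁻¹' {s}) → Tr v (K ∩ f ⁻¹' {s})) {v : V} (hv : Cyc v K) :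
    Tr v K := by
  have hcomp : ∀ T : Set ℝ, IsClosed T → IsCompact (K ∩ f ⁻¹' T) := fun T hT =>
    hK.of_isClosed_subset (hf.preimage_isClosed_of_isClosed hK.isClosed hT) inter_subset_left
  have h1 : ∀ s : ℝ, ∃ O : Set ℝ, IsOpen O ∧ s ∈ O ∧
      ∀ T ⊆ O, IsClosed T → Tr v (K ∩ f ⁻¹' T) := by
    intro s
    obtain ⟨W, hW, hsW, h⟩ := H.nhds v _ K (hcomp {s} isClosed_singleton) hK inter_subset_left hv
      (hs s v (H.anti _ _ _ inter_subset_left hv))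
    have hc : IsCompact (f '' (K \ W)) := (hK.diff hW).image_of_continuousOn
      (hf.mono sdiff_subset)
    refine ⟨(f '' (K \ W))ᶜ, hc.isClosed.isOpen_compl, ?_, fun T hT hTc => ?_⟩
    · rintro ⟨x, hx, rfl⟩
      exact hx.2 (hsW ⟨hx.1, rfl⟩)
    · refine h _ (hcomp T hTc) ?_ inter_subset_left
      rintro x ⟨hxK, hxT⟩
      by_contra hxW
      exact hT hxT ⟨x, ⟨hxK, hxW⟩, rfl⟩
  choose O hO hsO hT using h1
  obtain ⟨a, b, hab⟩ : ∃ a b : ℝ, a ≤ b ∧ f '' K ⊆ Icc a b := by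
    have hb := (hK.image_of_continuousOn hf).isBounded
    obtain ⟨r, hr⟩ := hb.subset_closedBall 0
    rw [Real.closedBall_eq_Icc] at hr
    refine ⟨-|r|, |r|, by linarith [abs_nonneg r], hr.trans (Icc_subset_Icc ?_ ?_)⟩
    · linarith [le_abs_self r]
    · linarith [le_abs_self r]
  obtain ⟨t, ht0, htm, ⟨m, hm⟩, htO⟩ := exists_monotone_Icc_subset_open_cover_Icc (c := fun s => ((↑) : Icc a b → ℝ) ⁻¹' O s)
    hab.1 (fun s => (hO s).preimage continuous_subtype_val) (fun s _ => mem_iUnion.2 ⟨s, hsO s⟩)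
  have hstep : ∀ k, Tr v (K ∩ f ⁻¹' Icc a (t k)) := by
    intro k
    induction k with
    | zero =>
      rw [ht0, Icc_self]
      exact hs _ _ (H.anti _ _ _ inter_subset_left hv)
    | succ k ih =>
      obtain ⟨s, hs'⟩ := htO k
      have hTk : Tr v (K ∩ f ⁻¹' Icc (t k : ℝ) (t (k + 1))) :=
        hT s _ (fun x hx => hs' (a := ⟨x, ((t k).2.1.trans hx.1), hx.2.trans (t (k + 1)).2.2⟩) hx) isClosed_Icc
      have hle : (t k : ℝ) ≤ t (k + 1) := htm (Nat.le_succ k)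
      have ha : a ≤ t k := (t k).2.1
      have e1 : K ∩ f ⁻¹' Icc a (t k) ∪ K ∩ f ⁻¹' Icc (t k : ℝ) (t (k + 1)) =
          K ∩ f ⁻¹' Icc a (t (k + 1)) := by
        rw [← inter_union_distrib_left, ← preimage_union, Icc_union_Icc_eq_Icc ha hle]
      have e2 : K ∩ f ⁻¹' Icc a (t k) ∩ (K ∩ f ⁻¹' Icc (t k : ℝ) (t (k + 1))) =
          K ∩ f ⁻¹' {(t k : ℝ)} := by
        rw [← inter_inter_distrib_left, ← preimage_inter, Icc_inter_Icc_eq_singleton ha hle]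
      rw [← e1]
      refine H.union _ _ _ (hcomp _ isClosed_Icc) (hcomp _ isClosed_Icc) ih hTk ?_ ?_
      · rw [e2]
        exact hs _
      · exact H.anti _ _ _ (union_subset inter_subset_left inter_subset_left) hv
  have h := hstep m
  have hsub : K ⊆ f ⁻¹' Icc a b := fun x hx => hab.2 ⟨x, hx, rfl⟩
  rwa [hm m le_rfl, inter_eq_left.2 hsub] at h

/-- Induction on the number d of coordinates that may vary on K: slicing by the last of these leaves
sets with one coordinate less, and with none left K is empty or a point. -/
theorem CompactInduction.of_chart [T2Space M] (H : CompactInduction Cyc Tr) {n : ℕ}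
    (e : OpenPartialHomeomorph M (EuclideanSpace ℝ (Fin n))) (d : ℕ) :
    ∀ K : Set M, IsCompact K → K ⊆ e.source →
      (∀ i : Fin n, d ≤ i → ∀ x ∈ K, ∀ y ∈ K, e x i = e y i) → ∀ v, Cyc v K → Tr v K := by
  induction d with
  | zero =>
    intro K _ hKe h v hv
    rcases K.eq_empty_or_nonempty with rfl | ⟨x, hx⟩
    · exact H.empty v hv
    · obtain rfl : K = {x} := by
        refine Subset.antisymm (fun y hy => ?_) (singleton_subset_iff.2 hx)
        refine e.injOn (hKe hy) (hKe hx) ?_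
        ext i
        exact h i (Nat.zero_le _) y hy x hx
      exact H.point v x hv
  | succ d ih =>
    intro K hK hKe h v hv
    by_cases hd : d < n
    · have hf : ContinuousOn (fun x => e x ⟨d, hd⟩) K :=
        (EuclideanSpace.proj (𝕜 := ℝ) (⟨d, hd⟩ : Fin n)).continuous.comp_continuousOn
          (e.continuousOn.mono hKe)
      refine H.of_slices hK hf (fun s => ?_) hv
      refine ih _ (hK.of_isClosed_subset
        (hf.preimage_isClosed_of_isClosed hK.isClosed isClosed_singleton) inter_subset_left)
        (inter_subset_left.trans hKe) ?_
      rintro i hi x ⟨hx, hx'⟩ y ⟨hy, hy'⟩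
      rcases Nat.eq_or_lt_of_le hi with hi | hi
      · obtain rfl : i = ⟨d, hd⟩ := Fin.ext hi.symm
        exact Eq.trans hx' (Eq.symm hy')
      · exact h i hi x hx y hy
    · exact ih K hK hKe (fun i hi => absurd i.2 (by omega)) v hv

/-- Mayer–Vietoris induction over the compact subsets of a manifold. -/
theorem CompactInduction.all [T2Space M] {n : ℕ} [ChartedSpace (EuclideanSpace ℝ (Fin n)) M]
    (H : CompactInduction Cyc Tr) {K : Set M} (hK : IsCompact K) {v : V} (hv : Cyc v K) :
    Tr v K := by
  have : LocallyCompactSpace M := ChartedSpace.locallyCompactSpace (EuclideanSpace ℝ (Fin n)) M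
  -- Gluing over a union needs the claim over the intersection as well, so the property that is
  -- spread over finite covers concerns all compact subsets of L at once.
  suffices h : ∃ L, IsCompact L ∧ K ⊆ L ∧ ∀ K' ⊆ L, IsCompact K' → ∀ v, Cyc v K' → Tr v K' by
    obtain ⟨L, -, hKL, h⟩ := h
    exact h K hKL hK v hv
  refine hK.induction_on (p := fun s => ∃ L, IsCompact L ∧ s ⊆ L ∧
    ∀ K' ⊆ L, IsCompact K' → ∀ v, Cyc v K' → Tr v K') ?_ ?_ ?_ ?_
  · refine ⟨∅, isCompact_empty, Subset.rfl, fun K' hK' _ => ?_⟩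
    rw [subset_empty_iff.1 hK']
    exact H.empty
  · rintro s t hst ⟨L, hL, htL, h⟩
    exact ⟨L, hL, hst.trans htL, h⟩
  · rintro s t ⟨L, hL, hsL, h⟩ ⟨L', hL', htL, h'⟩
    refine ⟨L ∪ L', hL.union hL', union_subset_union hsL htL, fun K' hK' hc v hv => ?_⟩
    have e : K' = K' ∩ L ∪ K' ∩ L' := by
      rw [← inter_union_distrib_left, inter_eq_left.2 hK']
    rw [e]
    have hc1 : IsCompact (K' ∩ L) := hc.inter_right hL.isClosed
    have hc2 : IsCompact (K' ∩ L') := hc.inter_right hL'.isClosed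
    refine H.union _ _ _ hc1 hc2
      (h _ inter_subset_right hc1 _ (H.anti _ _ _ inter_subset_left hv))
      (h' _ inter_subset_right hc2 _ (H.anti _ _ _ inter_subset_left hv))
      (h _ (inter_subset_left.trans inter_subset_right) (hc1.inter hc2)) ?_
    rw [← e]
    exact hv
  · intro x _
    set e := chartAt (EuclideanSpace ℝ (Fin n)) x
    obtain ⟨L, hLx, hLe, hL⟩ := local_compact_nhds (e.open_source.mem_nhds (mem_chart_source _ x))
    refine ⟨L, mem_nhdsWithin_of_mem_nhds hLx, L, hL, Subset.rfl, fun K' hK' hc v hv => ?_⟩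
    exact H.of_chart e n K' hc (hK'.trans hLe) (fun i hi => absurd i.2 (by omega)) v hv

end CompactPrinciple

/-! ### Representatives of relative homology classes. -/

section RelativeClasses

variable {X : Type u} [TopologicalSpace X]

theorem mkQ_mem_cycles_iff {U : Set X} {n : ℕ} {a : Chain ℤ X n} :
    (chainsIn ℤ U n).mkQ a ∈ cycles (C := fun n => RelChain ℤ U n) (relBd ℤ U) n ↔
      dTot X (ofDeg X n a) ∈ totIn U := by
  cases n with
  | zero =>
    rw [dTot_ofDeg_zero]
    exact ⟨fun _ => zero_mem _, fun _ => trivial⟩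
  | succ n =>
    rw [dTot_ofDeg_succ, ofDeg_mem_iff]
    exact Submodule.Quotient.mk_eq_zero _

/-- `a` is a cycle modulo `U` in the class `z`. -/
def Represents (U : Set X) (n : ℕ) (a : Chain ℤ X n) (z : RelHomology ℤ U n) : Prop :=
  ∃ h : (chainsIn ℤ U n).mkQ a ∈ cycles (C := fun n => RelChain ℤ U n) (relBd ℤ U) n,
    Submodule.Quotient.mk ⟨_, h⟩ = z

variable {U : Set X} {n : ℕ} {a b : Chain ℤ X n} {y z : RelHomology ℤ U n}

theorem exists_represents (z : RelHomology ℤ U n) : ∃ a, Represents U n a z := by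
  obtain ⟨⟨c, hc⟩, rfl⟩ := Submodule.Quotient.mk_surjective _ z
  obtain ⟨a, rfl⟩ := Submodule.mkQ_surjective _ c
  exact ⟨a, hc, rfl⟩

theorem exists_represents_of_mem (h : dTot X (ofDeg X n a) ∈ totIn U) :
    ∃ z, Represents U n a z :=
  ⟨_, mkQ_mem_cycles_iff.2 h, rfl⟩

theorem Represents.dTot_mem (h : Represents U n a z) : dTot X (ofDeg X n a) ∈ totIn U :=
  mkQ_mem_cycles_iff.1 h.choose

theorem Represents.map {V : Set X} (h : Represents U n a z) (hUV : U ⊆ V) :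
    Represents V n a (RelHomology.map hUV n z) := by
  obtain ⟨h', rfl⟩ := h
  exact ⟨mkQ_mem_cycles_iff.2 (totIn_mono hUV (mkQ_mem_cycles_iff.1 h')), rfl⟩

theorem Represents.smul (h : Represents U n a z) (r : ℤ) : Represents U n (r • a) (r • z) := by
  obtain ⟨h', rfl⟩ := h
  exact ⟨Submodule.smul_mem _ r h', rfl⟩

theorem sub_bd_mem {e : Tot X} (h : ofDeg X n a - dTot X e ∈ totIn U) :
    a - bd ℤ X n (toDeg X (n + 1) e) ∈ chainsIn ℤ U n := by
  have := toDeg_mem (n := n) h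
  rwa [map_sub, toDeg_ofDeg, toDeg_dTot] at this

theorem Represents.eq_iff (ha : Represents U n a y) (hb : Represents U n b z) :
    y = z ↔ ∃ e, ofDeg X n (a - b) - dTot X e ∈ totIn U := by
  obtain ⟨ha, rfl⟩ := ha
  obtain ⟨hb, rfl⟩ := hb
  rw [Submodule.Quotient.eq]
  constructor
  · rintro ⟨e, he⟩
    obtain ⟨e, rfl⟩ := Submodule.mkQ_surjective _ e
    refine ⟨ofDeg X (n + 1) e, ?_⟩
    rw [dTot_ofDeg_succ, ← map_sub, ofDeg_mem_iff]
    have he' : (chainsIn ℤ U n).mkQ (bd ℤ X n e) = (chainsIn ℤ U n).mkQ (a - b) := he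
    exact (Submodule.Quotient.eq _).1 he'.symm
  · rintro ⟨e, he⟩
    have h := sub_bd_mem he
    exact ⟨(chainsIn ℤ U (n + 1)).mkQ (toDeg X (n + 1) e), ((Submodule.Quotient.eq _).2 h).symm⟩

theorem Represents.of_sub (ha : Represents U n a z) {e : Tot X}
    (h : ofDeg X n (a - b) - dTot X e ∈ totIn U) : Represents U n b z := by
  have hb : dTot X (ofDeg X n b) ∈ totIn U := by
    have h1 := sub_mem ha.dTot_mem (EndsDuality.dTot_mem h)
    rwa [map_sub (dTot X), dTot_dTot, sub_zero, map_sub, map_sub, sub_sub_cancel] at h1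
  obtain ⟨y, hy⟩ := exists_represents_of_mem hb
  rwa [(ha.eq_iff hy).2 ⟨e, h⟩]

/-- Up to boundaries g is s • a and a is r₀ • g. Since no nonzero multiple of g bounds, s * r₀ = 1.
-/
theorem IsGen.of_smul {V : Type*} [AddCommGroup V] {d : V →ₗ[ℤ] V} {P Q : Submodule ℤ V} {g a e : V}
    (hg : IsGen d P Q g) (ha : a ∈ P) (hda : d a ∈ Q) {s : ℤ} (he : e ∈ P)
    (h : g - s • a - d e ∈ Q) : IsGen d P Q a := by
  obtain ⟨r₀, w, hw, h₀⟩ := hg.exists_smul a ha hda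
  have hu : (1 - s * r₀) = 0 := by
    refine hg.eq_zero _ (e + s • w) (add_mem he (Submodule.smul_mem _ _ hw)) ?_
    have : (1 - s * r₀) • g - d (e + s • w) = (g - s • a - d e) + s • (a - r₀ • g - d w) := by
      rw [map_add, map_smul]; module
    rw [this]
    exact add_mem h (Submodule.smul_mem _ _ h₀)
  refine ⟨ha, hda, fun c hc hdc => ?_, fun r f hf hr => ?_⟩
  · obtain ⟨t, f, hf, ht⟩ := hg.exists_smul c hc hdc
    refine ⟨t * s, f + t • e, add_mem hf (Submodule.smul_mem _ _ he), ?_⟩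
    have : c - (t * s) • a - d (f + t • e) = (c - t • g - d f) + t • (g - s • a - d e) := by
      rw [map_add, map_smul]; module
    rw [this]
    exact add_mem ht (Submodule.smul_mem _ _ h)
  · have h1 : r * r₀ = 0 := by
      refine hg.eq_zero _ (f - r • w) (sub_mem hf (Submodule.smul_mem _ _ hw)) ?_
      have : (r * r₀) • g - d (f - r • w) = (r • a - d f) - r • (a - r₀ • g - d w) := by
        rw [map_sub, map_smul]; module
      rw [this]
      exact sub_mem hr (Submodule.smul_mem _ _ h₀)
    rcases mul_eq_zero.1 h1 with h2 | h2
    · exact h2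
    · rw [h2] at hu
      norm_num at hu

/-- The known generator of the local homology is a multiple of the spanning class z, so a represents
a generator too. This passes from the degree n group to the total complex. -/
theorem Represents.isGen {M : Type u} [TopologicalSpace M] [T1Space M] {n : ℕ}
    [ChartedSpace (EuclideanSpace ℝ (Fin n)) M] {x : M} {a : Chain ℤ M n}
    {z : RelHomology ℤ ({x}ᶜ : Set M) n} (h : Represents {x}ᶜ n a z)
    (hz : Submodule.span ℤ {z} = ⊤) : IsGen (dTot M) ⊤ (totIn ({x}ᶜ : Set M)) (ofDeg M n a) := by
  obtain ⟨_, ⟨g, rfl⟩, hg⟩ := exists_isGen_local (n := n) x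
  obtain ⟨y, hy⟩ := exists_represents_of_mem hg.d_mem
  obtain ⟨s, rfl⟩ := Submodule.mem_span_singleton.1 (hz ▸ Submodule.mem_top : y ∈ Submodule.span ℤ {z})
  obtain ⟨e, he⟩ := (hy.eq_iff (h.smul s)).1 rfl
  rw [map_sub, map_smul] at he
  exact hg.of_smul Submodule.mem_top h.dTot_mem Submodule.mem_top he

end RelativeClasses

/-! ### Cycles in the inverse limit from compatible sequences of chains. -/

section EndCycles

variable (R : Type) [CommRing R] {X : Type u} [TopologicalSpace X] (K : CompactExhaustion X)

/-- The cycles of `C_*(X, ∂_∞ V)`. -/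
abbrev EndCycles (V : Set X) (n : ℕ) : Submodule R (EndChain R K V n) :=
  cycles (C := fun n => EndChain R K V n) (endBd R K V) n

/-- The cocycles of `C^*(X, ∂_∞ V)`. -/
abbrev EndCocycles (V : Set X) (k : ℕ) : Submodule R (EndCochain R K V k) :=
  cocycles (C := fun k => EndCochain R K V k) (endCobd R K V) k

variable {R K}

theorem proj_mem_cycles {V : Set X} {n : ℕ} {c : EndChain R K V n} (hc : c ∈ EndCycles R K V n)
    (i : ℕ) : c.1 i ∈ cycles (R := R) (C := fun n => RelChain R (V \ K i) n) (relBd R (V \ K i)) n :=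
  map_mem_cycles (R := R) (C := fun n => EndChain R K V n)
    (C' := fun n => RelChain R (V \ K i) n) (d := endBd R K V)
    (fun n => (EndFamily.proj R K V i n).comp (EndChain R K V n).subtype) (fun _ _ => rfl) n c hc

theorem mem_endChain_of_succ {K : CompactExhaustion X} {V : Set X} {m : ℕ} {a : ℕ → Chain ℤ X m}
    (h : ∀ i, a (i + 1) - a i ∈ chainsIn ℤ (V \ K i) m) :
    (fun i => (chainsIn ℤ (V \ K i) m).mkQ (a i) : EndFamily ℤ K V m) ∈ EndChain ℤ K V m := by
  intro i j hij
  have key : a j - a i ∈ chainsIn ℤ (V \ K i) m := by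
    induction j, hij using Nat.le_induction with
    | base => rw [sub_self]; exact zero_mem _
    | succ j hij ih =>
      rw [← sub_add_sub_cancel (a (j + 1)) (a j)]
      exact add_mem (chainsIn_mono (diff_subset_diff_of_le K V hij) m (h j)) ih
  exact (Submodule.Quotient.eq _).2 key

theorem mem_cycles_endBd {K : CompactExhaustion X} {V : Set X} {m : ℕ} {a : ℕ → Chain ℤ X m}
    (hc : (fun i => (chainsIn ℤ (V \ K i) m).mkQ (a i) : EndFamily ℤ K V m) ∈ EndChain ℤ K V m)
    (h : ∀ i, dTot X (ofDeg X m (a i)) ∈ totIn (V \ K i)) :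
    (⟨_, hc⟩ : EndChain ℤ K V m) ∈ EndCycles ℤ K V m := by
  cases m with
  | zero => trivial
  | succ m => exact Subtype.ext (funext fun i => mkQ_mem_cycles_iff.2 (h i))

end EndCycles

/-! ### Existence of a fundamental class, and its representing chains. -/

section FundamentalClass

variable {M : Type u} [TopologicalSpace M] [T2Space M] {n : ℕ}
  [ChartedSpace (EuclideanSpace ℝ (Fin n)) M]

theorem exists_isCompact_subset_mem_totIn {X : Type u} [TopologicalSpace X] {U : Set X} {c : Tot X}
    (h : c ∈ totIn U) : ∃ Q, IsCompact Q ∧ Q ⊆ U ∧ c ∈ totIn Q := by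
  refine ⟨⋃ s ∈ c.support, range s.2, ?_, ?_, ?_⟩
  · exact c.support.isCompact_biUnion fun s _ => isCompact_range s.2.continuous
  · refine iUnion₂_subset fun s hs => ?_
    rintro _ ⟨t, rfl⟩
    exact (Finsupp.mem_supported ℤ c).1 h hs t
  · refine (Finsupp.mem_supported ℤ c).2 fun s hs t => ?_
    exact mem_biUnion hs ⟨t, rfl⟩

theorem exists_isOpen_of_mem_totIn_compl {K : Set M} {c : Tot M} (h : c ∈ totIn Kᶜ) :
    ∃ W, IsOpen W ∧ K ⊆ W ∧ c ∈ totIn Wᶜ := by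
  obtain ⟨C, hC, hCK, hc⟩ := exists_isCompact_subset_mem_totIn h
  exact ⟨Cᶜ, hC.isClosed.isOpen_compl, subset_compl_comm.1 hCK, by rwa [compl_compl]⟩

/-- A cycle of degree `n` or more relative to the complement of a compact set `K` bounds if it
bounds relative to the complement of every point of `K`. -/
theorem compactInduction_bounds : CompactInduction
    (fun (v : Σ N, Chain ℤ M (n + N)) K => dTot M (ofDeg M _ v.2) ∈ totIn Kᶜ ∧
      ∀ x ∈ K, ∃ e, ofDeg M _ v.2 - dTot M e ∈ totIn ({x}ᶜ : Set M))
    (fun v K => ∃ e, ofDeg M _ v.2 - dTot M e ∈ totIn Kᶜ) where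
  anti v K L hKL h := ⟨totIn_mono (compl_subset_compl.2 hKL) h.1, fun x hx => h.2 x (hKL hx)⟩
  empty v _ := ⟨0, by rw [compl_empty]; exact mem_totIn_univ _⟩
  point v x h := h.2 x rfl
  nhds v K T _ _ _ _ := by
    rintro ⟨e, he⟩
    obtain ⟨W, hW, hKW, h⟩ := exists_isOpen_of_mem_totIn_compl he
    exact ⟨W, hW, hKW, fun K' _ hK' _ => ⟨e, totIn_mono (compl_subset_compl.2 hK') h⟩⟩
  union := by
    rintro ⟨N, v⟩ K L hK hL ⟨e₁, h₁⟩ ⟨e₂, h₂⟩ hKL -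
    -- The two bounding chains differ by a relative cycle over K ∩ L of one degree more; this is why
    -- the induction runs over all degrees n + N together.
    have hdw : dTot M (ofDeg M (n + (N + 1)) (toDeg M (n + (N + 1)) (e₁ - e₂))) ∈
        totIn Kᶜ ⊔ totIn Lᶜ := by
      have h1 := ofDeg_mem (sub_bd_mem h₁)
      have h2 := ofDeg_mem (sub_bd_mem h₂)
      have : dTot M (ofDeg M (n + (N + 1)) (toDeg M (n + (N + 1)) (e₁ - e₂))) =
          -ofDeg M (n + N) (v - bd ℤ M (n + N) (toDeg M (n + N + 1) e₁)) +
          ofDeg M (n + N) (v - bd ℤ M (n + N) (toDeg M (n + N + 1) e₂)) := by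
        have h3 := dTot_ofDeg_succ (X := M) (n + N) (toDeg M (n + N + 1) (e₁ - e₂))
        refine h3.trans ?_
        rw [map_sub, map_sub, map_sub, map_sub, map_sub]
        abel
      rw [this]
      exact Submodule.add_mem_sup (neg_mem h1) h2
    obtain ⟨f, hf⟩ := hKL ⟨N + 1, toDeg M _ (e₁ - e₂)⟩ ⟨by
        rw [compl_inter]
        exact sup_le_totIn _ _ hdw, fun x hx => by
        -- The pointwise condition is automatic above degree n: the local generator has degree n and
        -- disappears on projecting to degree n + (N + 1).
        obtain ⟨_, ⟨g, rfl⟩, hg⟩ := exists_isGen_local (n := n) x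
        obtain ⟨r, e, -, h⟩ := hg.exists_smul _ Submodule.mem_top
          (sup_le (totIn_mono (compl_subset_compl.2 (singleton_subset_iff.2 hx.1)))
            (totIn_mono (compl_subset_compl.2 (singleton_subset_iff.2 hx.2))) hdw)
        have h1 := ofDeg_mem (toDeg_mem (n := n + (N + 1)) h)
        refine ⟨ofDeg M _ (toDeg M (n + (N + 1) + 1) e), ?_⟩
        rw [map_sub, map_sub (toDeg M _) (ofDeg M _ _), map_smul, toDeg_ofDeg_of_ne (by omega) g,
          smul_zero, sub_zero, toDeg_dTot, toDeg_ofDeg, map_sub, ← dTot_ofDeg_succ] at h1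
        exact h1⟩
    rw [compl_inter] at hf
    obtain ⟨e', -, h⟩ := excision hK.isClosed.isOpen_compl hL.isClosed.isOpen_compl hf (by
      rw [map_sub, dTot_dTot, sub_zero]
      exact hdw)
    obtain ⟨m₁, hm₁, m₂, hm₂, hm⟩ := Submodule.mem_sup.1 h
    set w₁ := ofDeg M (n + (N + 1)) (toDeg M (n + (N + 1)) e₁) with hw₁
    set w₂ := ofDeg M (n + (N + 1)) (toDeg M (n + (N + 1)) e₂) with hw₂
    have g₁ : ofDeg M (n + N) v - dTot M w₁ ∈ totIn Kᶜ := by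
      have h1 := ofDeg_mem (sub_bd_mem h₁)
      rw [map_sub, ← dTot_ofDeg_succ] at h1
      exact h1
    have g₂ : ofDeg M (n + N) v - dTot M w₂ ∈ totIn Lᶜ := by
      have h1 := ofDeg_mem (sub_bd_mem h₂)
      rw [map_sub, ← dTot_ofDeg_succ] at h1
      exact h1
    -- Near K this is w₁ up to a chain off K. Up to a cycle it is also w₂ + m₂, with m₂ off L, so it
    -- works over both sets.
    refine ⟨w₁ - m₁, ?_⟩
    rw [compl_union, totIn_inter]
    constructor
    · have : ofDeg M (n + N) v - dTot M (w₁ - m₁) =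
          (ofDeg M (n + N) v - dTot M w₁) + dTot M m₁ := by rw [map_sub]; abel
      rw [this]
      exact add_mem g₁ (dTot_mem hm₁)
    · have h3 : dTot M (w₁ - m₁) = dTot M w₂ + dTot M m₂ := by
        have h4 := congrArg (dTot M) hm
        simp only [map_add, map_sub, dTot_dTot, sub_zero] at h4
        rw [map_sub, hw₁, hw₂, sub_eq_iff_eq_add]
        rw [sub_eq_iff_eq_add.1 h4.symm]
        abel
      have : ofDeg M (n + N) v - dTot M (w₁ - m₁) =
          (ofDeg M (n + N) v - dTot M w₂) - dTot M m₂ := by rw [h3]; abel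
      rw [this]
      exact sub_mem g₂ (dTot_mem hm₂)

theorem exists_sub_dTot_mem {K : Set M} (hK : IsCompact K) {a : Chain ℤ M n}
    (ha : dTot M (ofDeg M n a) ∈ totIn Kᶜ)
    (h : ∀ x ∈ K, ∃ e, ofDeg M n a - dTot M e ∈ totIn ({x}ᶜ : Set M)) :
    ∃ e, ofDeg M n a - dTot M e ∈ totIn Kᶜ :=
  (compactInduction_bounds (n := n)).all (n := n) hK (v := ⟨0, a⟩) ⟨ha, h⟩

/-- Over L ∩ L' the two local choices agree at every point, hence up to a boundary by
`exists_sub_dTot_mem`. By excision the discrepancy splits into a part off L and a part off L';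
adding the latter to b leaves the class over L' unchanged and gives the class of a over L. -/
theorem exists_represents_compact {o : ∀ x : M, RelHomology ℤ ({x}ᶜ : Set M) n}
    (ho : ∀ x, ∃ U ∈ 𝓝 x, ∃ β : RelHomology ℤ (Uᶜ : Set M) n, ∀ (y : M) (hy : y ∈ U),
      RelHomology.map (compl_subset_compl.2 (singleton_subset_iff.2 hy)) n β = o y)
    {K : Set M} (hK : IsCompact K) : ∃ a : Chain ℤ M n, dTot M (ofDeg M n a) ∈ totIn Kᶜ ∧
      ∀ x ∈ K, Represents {x}ᶜ n a (o x) := by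
  have : LocallyCompactSpace M := ChartedSpace.locallyCompactSpace (EuclideanSpace ℝ (Fin n)) M
  suffices h : ∃ L, IsCompact L ∧ K ⊆ L ∧ ∃ a : Chain ℤ M n, dTot M (ofDeg M n a) ∈ totIn Lᶜ ∧
      ∀ x ∈ L, Represents {x}ᶜ n a (o x) by
    obtain ⟨L, -, hKL, a, ha, h⟩ := h
    exact ⟨a, totIn_mono (compl_subset_compl.2 hKL) ha, fun x hx => h x (hKL hx)⟩
  refine hK.induction_on (p := fun s => ∃ L, IsCompact L ∧ s ⊆ L ∧ ∃ a : Chain ℤ M n,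
    dTot M (ofDeg M n a) ∈ totIn Lᶜ ∧ ∀ x ∈ L, Represents {x}ᶜ n a (o x)) ?_ ?_ ?_ ?_
  · exact ⟨∅, isCompact_empty, Subset.rfl, 0, by rw [map_zero, map_zero]; exact zero_mem _,
      fun x hx => hx.elim⟩
  · rintro s t hst ⟨L, hL, htL, h⟩
    exact ⟨L, hL, hst.trans htL, h⟩
  · rintro s t ⟨L, hL, hsL, a, ha, hao⟩ ⟨L', hL', htL, b, hb, hbo⟩
    refine ⟨L ∪ L', hL.union hL', union_subset_union hsL htL, ?_⟩
    have hdab : dTot M (ofDeg M n (a - b)) ∈ totIn Lᶜ ⊔ totIn L'ᶜ := by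
      rw [map_sub, map_sub]
      exact sub_mem (Submodule.mem_sup_left ha) (Submodule.mem_sup_right hb)
    obtain ⟨e, he⟩ := exists_sub_dTot_mem (hL.inter hL') (a := a - b) (by
      rw [compl_inter]
      exact sup_le_totIn _ _ hdab) (fun x hx => ((hao x hx.1).eq_iff (hbo x hx.2)).1 rfl)
    rw [compl_inter] at he
    obtain ⟨e', -, h⟩ := excision hL.isClosed.isOpen_compl hL'.isClosed.isOpen_compl he (by
      rw [map_sub, dTot_dTot, sub_zero]
      exact hdab)
    obtain ⟨m₁, hm₁, m₂, hm₂, hm⟩ := Submodule.mem_sup.1 h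
    have h1 : a - (b + toDeg M n m₂) = toDeg M n m₁ + bd ℤ M n (toDeg M (n + 1) (e + e')) := by
      have := congrArg (toDeg M n) hm
      rw [map_add, sub_sub, ← map_add (dTot M), map_sub, toDeg_ofDeg, toDeg_dTot] at this
      rw [← sub_sub, sub_eq_iff_eq_add, sub_eq_iff_eq_add.1 this.symm]
      abel
    have h2 : ofDeg M n (a - (b + toDeg M n m₂)) -
        dTot M (ofDeg M (n + 1) (toDeg M (n + 1) (e + e'))) ∈ totIn Lᶜ := by
      rw [h1, dTot_ofDeg_succ, map_add, add_sub_cancel_right]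
      exact ofDeg_mem (toDeg_mem hm₁)
    have h3 : ofDeg M n (b - (b + toDeg M n m₂)) - dTot M 0 ∈ totIn L'ᶜ := by
      rw [map_zero, sub_zero, sub_add_cancel_left, map_neg]
      exact neg_mem (ofDeg_mem (toDeg_mem hm₂))
    refine ⟨b + toDeg M n m₂, ?_, ?_⟩
    · rw [compl_union, totIn_inter]
      constructor
      · have := sub_mem ha (dTot_mem h2)
        rwa [map_sub (dTot M), dTot_dTot, sub_zero, map_sub, map_sub, sub_sub_cancel] at this
      · have := sub_mem hb (dTot_mem h3)
        rwa [map_sub (dTot M), dTot_dTot, sub_zero, map_sub, map_sub, sub_sub_cancel] at this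
    · rintro x (hx | hx)
      · exact (hao x hx).of_sub
          (totIn_mono (compl_subset_compl.2 (singleton_subset_iff.2 hx)) h2)
      · exact (hbo x hx).of_sub
          (totIn_mono (compl_subset_compl.2 (singleton_subset_iff.2 hx)) h3)
  · intro x _
    obtain ⟨U, hU, β, hβ⟩ := ho x
    obtain ⟨L, hLx, hLU, hL⟩ := local_compact_nhds hU
    obtain ⟨a, ha⟩ := exists_represents β
    refine ⟨L, mem_nhdsWithin_of_mem_nhds hLx, L, hL, Subset.rfl, a,
      totIn_mono (compl_subset_compl.2 hLU) ha.dTot_mem, fun y hy => ?_⟩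
    rw [← hβ y (hLU hy)]
    exact ha.map _

/-- Chains `a i` that are compatible fundamental cycles relative to the complements of `K i`. -/
structure FundamentalSequence (K : CompactExhaustion M) (a : ℕ → Chain ℤ M n) : Prop where
  dTot_mem : ∀ i, dTot M (ofDeg M n (a i)) ∈ totIn (K i)ᶜ
  sub_mem : ∀ i, ofDeg M n (a (i + 1) - a i) ∈ totIn (K i)ᶜ
  isGen : ∀ i, ∀ x ∈ K i, IsGen (dTot M) ⊤ (totIn ({x}ᶜ : Set M)) (ofDeg M n (a i))

/-- Representatives over K i and K (i + 1) restrict to the same class over K i, because they do so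
at every point. -/
theorem exists_isFundamentalClass (horient : IsOrientable n M) (K : CompactExhaustion M) :
    ∃ μ : EndHomology ℤ K univ n, IsFundamentalClass K μ := by
  obtain ⟨o, hgen, ho⟩ := horient
  choose a ha hao using fun i => exists_represents_compact ho (K.isCompact i)
  have hex : ∀ i, ∃ e, ofDeg M n (a (i + 1) - a i) - dTot M e ∈ totIn (K i)ᶜ := fun i => by
    refine exists_sub_dTot_mem (K.isCompact i) ?_ fun x hx =>
      ((hao (i + 1) x (K.subset_succ i hx)).eq_iff (hao i x hx)).1 rfl
    rw [map_sub, map_sub]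
    exact sub_mem (totIn_mono (compl_subset_compl.2 (K.subset_succ i)) (ha (i + 1))) (ha i)
  choose e he using hex
  -- The inverse limit is taken on chains, so agreement up to boundaries is not enough; subtracting
  -- the accumulated bounding terms makes the representatives agree exactly modulo chains off K i.
  set b : ℕ → Chain ℤ M n := fun i =>
    a i - ∑ l ∈ Finset.range i, bd ℤ M n (toDeg M (n + 1) (e l)) with hb
  have hab : ∀ i, ofDeg M n (a i - b i) -
      dTot M (∑ l ∈ Finset.range i, ofDeg M (n + 1) (toDeg M (n + 1) (e l))) = 0 := fun i => by
    simp only [hb, sub_sub_cancel, map_sum, dTot_ofDeg_succ, sub_self]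
  have hbb : ∀ i, b (i + 1) - b i ∈ chainsIn ℤ (univ \ K i) n := fun i => by
    have := sub_bd_mem (he i)
    rw [compl_eq_univ_sdiff] at this
    simp only [hb, Finset.sum_range_succ]
    convert this using 1
    abel
  have hc := mem_endChain_of_succ (K := K) (V := univ) hbb
  have hz := mem_cycles_endBd hc fun i => by
    have h1 := congrArg (dTot M) (hab i)
    rw [map_sub (dTot M), dTot_dTot, sub_zero, map_zero, map_sub, map_sub, sub_eq_zero] at h1
    rw [← h1, ← compl_eq_univ_sdiff]
    exact ha i
  refine ⟨Submodule.Quotient.mk ⟨⟨_, hc⟩, hz⟩, fun x i hx => ?_⟩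
  have h1 : Represents (univ \ K i) n (b i)
      (EndHomology.proj K univ i n (Submodule.Quotient.mk ⟨⟨_, hc⟩, hz⟩)) := ⟨_, rfl⟩
  have h2 : Represents {x}ᶜ n (b i) (o x) := (hao i x hx).of_sub (e := _) (by
    rw [hab i]
    exact zero_mem _)
  have h3 := ((h1.map (univ_diff_subset_compl K hx)).eq_iff h2).2
    ⟨0, by rw [sub_self, map_zero, map_zero, sub_zero]; exact zero_mem _⟩
  rw [h3]
  exact hgen x

theorem exists_fundamentalSequence {K : CompactExhaustion M} {c : EndChain ℤ K univ n}
    (hc : c ∈ EndCycles ℤ K univ n)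
    (hμ : IsFundamentalClass K (Submodule.Quotient.mk ⟨c, hc⟩ : EndHomology ℤ K univ n)) :
    ∃ a : ℕ → Chain ℤ M n, FundamentalSequence K a ∧
      ∀ i, (chainsIn ℤ (univ \ K i) n).mkQ (a i) = c.1 i := by
  choose a ha using fun i => Submodule.mkQ_surjective _ (c.1 i)
  have h1 : ∀ i, Represents (univ \ K i) n (a i)
      (EndHomology.proj K univ i n (Submodule.Quotient.mk ⟨c, hc⟩)) := fun i => by
    refine ⟨?_, ?_⟩
    · rw [ha]
      exact proj_mem_cycles hc i
    · refine congrArg Submodule.Quotient.mk (Subtype.ext ?_)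
      exact ha i
  refine ⟨a, ⟨fun i => ?_, fun i => ?_, fun i x hx => ?_⟩, ha⟩
  · rw [compl_eq_univ_sdiff]
    exact (h1 i).dTot_mem
  · rw [ofDeg_mem_iff, compl_eq_univ_sdiff]
    refine (Submodule.Quotient.eq _).1 ?_
    have := c.2 i (i + 1) (Nat.le_succ i)
    rw [← ha, ← ha] at this
    exact this
  · exact ((h1 i).map (univ_diff_subset_compl K hx)).isGen (hμ x i hx)

end FundamentalClass

/-! ### The mapping cone of the cap product over a closed set. -/

section Telescope

variable {M : Type u} [TopologicalSpace M]

/-- Sequences of chains that eventually leave every compact part of `C`. -/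
def evOut (K : CompactExhaustion M) (C : Set M) : Submodule ℤ (ℕ → Tot M) where
  carrier := {c | ∀ j, ∀ᶠ i in Filter.atTop, c i ∈ totIn (C ∩ K j)ᶜ}
  zero_mem' := fun _ => Filter.Eventually.of_forall fun _ => zero_mem _
  add_mem' := fun hc hc' j => ((hc j).and (hc' j)).mono fun _ h => add_mem h.1 h.2
  smul_mem' := fun r _ hc j => (hc j).mono fun _ h => Submodule.smul_mem _ r h

variable {K : CompactExhaustion M} {C C' : Set M} {c : ℕ → Tot M}

theorem evOut_anti (h : C ⊆ C') : evOut K C' ≤ evOut K C := fun _ hc j =>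
  (hc j).mono fun _ h' => totIn_mono (compl_subset_compl.2 (inter_subset_inter_left _ h)) h'

theorem mem_evOut_iff_of_isCompact (hC : IsCompact C) :
    c ∈ evOut K C ↔ ∀ᶠ i in Filter.atTop, c i ∈ totIn Cᶜ := by
  constructor
  · intro h
    obtain ⟨j, hj⟩ := K.exists_superset_of_isCompact hC
    have := h j
    rwa [inter_eq_left.2 hj] at this
  · exact fun h j => h.mono fun i hi => totIn_mono (compl_subset_compl.2 inter_subset_left) hi

theorem evOut_union (h : c ∈ evOut K C) (h' : c ∈ evOut K C') : c ∈ evOut K (C ∪ C') := fun j => by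
  filter_upwards [h j, h' j] with i hi hi'
  rw [union_inter_distrib_right, compl_union]
  exact mem_totIn_inter hi hi'

theorem evOut_shift (h : c ∈ evOut K C) : (fun i => c (i + 1)) ∈ evOut K C := fun j =>
  (Filter.tendsto_add_atTop_nat 1).eventually (h j)

theorem evOut_dTot (h : c ∈ evOut K C) : (fun i => dTot M (c i)) ∈ evOut K C := fun j =>
  (h j).mono fun _ hi => dTot_mem hi

theorem mem_evOut_of_compl (h : ∀ i, c i ∈ totIn (K i)ᶜ) : c ∈ evOut K C := fun j =>
  (Filter.eventually_ge_atTop j).mono fun i hi =>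
    totIn_mono (compl_subset_compl.2 (inter_subset_right.trans (K.subset hi))) (h i)

/-- A cochain together with two sequences of chains. -/
abbrev Telescope (M : Type u) [TopologicalSpace M] : Type u :=
  TotDual M × (ℕ → Tot M) × (ℕ → Tot M)

/-- The mapping cone of the cap products with the `μ i`, in the telescope of the chains. -/
def coneBd (μ ν : ℕ → Tot M) : Telescope M →ₗ[ℤ] Telescope M where
  toFun v := (dDual M v.1, fun i => capTot M (μ i) v.1 + dTot M (v.2.1 i), fun i =>
    capTot M (ν i) (sgnDual M v.1) + v.2.1 (i + 1) - v.2.1 i - dTot M (v.2.2 i))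
  map_add' v w := by
    refine Prod.ext ?_ (Prod.ext (funext fun i => ?_) (funext fun i => ?_))
    · exact map_add _ _ _
    · simp only [Prod.fst_add, Prod.snd_add, Pi.add_apply, map_add]; abel
    · simp only [Prod.fst_add, Prod.snd_add, Pi.add_apply, map_add]; abel
  map_smul' r v := by
    refine Prod.ext ?_ (Prod.ext (funext fun i => ?_) (funext fun i => ?_))
    · exact map_smul _ _ _
    · simp only [Prod.smul_fst, Prod.smul_snd, Pi.smul_apply, map_smul, smul_add,
        RingHom.id_apply]
    · simp only [Prod.smul_fst, Prod.smul_snd, Pi.smul_apply, map_smul, smul_add, smul_sub,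
        RingHom.id_apply]

/-- The elements that are negligible near `C`. -/
def coneNull (K : CompactExhaustion M) (C : Set M) : Submodule ℤ (Telescope M) :=
  (locZero C).prod ((evOut K C).prod (evOut K C))

theorem coneNull_anti (h : C ⊆ C') : coneNull K C' ≤ coneNull K C :=
  Submodule.prod_mono (locZero_anti h) (Submodule.prod_mono (evOut_anti h) (evOut_anti h))

theorem coneNull_union {v : Telescope M} (h : v ∈ coneNull K C) (h' : v ∈ coneNull K C') :
    v ∈ coneNull K (C ∪ C') :=
  ⟨locZero_union h.1 h'.1, evOut_union h.2.1 h'.2.1, evOut_union h.2.2 h'.2.2⟩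

theorem mem_coneNull_of_forall_inter {v : Telescope M} (h : ∀ j, v ∈ coneNull K (C ∩ K j)) :
    v ∈ coneNull K C := by
  refine ⟨fun x hx => ?_, fun j => ?_, fun j => ?_⟩
  · obtain ⟨j, hj⟩ := K.exists_mem x
    exact (h j).1 x ⟨hx, hj⟩
  · have := (h j).2.1 j
    rwa [inter_assoc, inter_self] at this
  · have := (h j).2.2 j
    rwa [inter_assoc, inter_self] at this

/-- Chains `μ i` representing a class at infinity, with `ν i` connecting `μ i` and `μ (i + 1)`,
that cap locally zero cochains out of closed sets and generate the local homology groups. -/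
structure DualSystem (K : CompactExhaustion M) (μ ν : ℕ → Tot M) : Prop where
  dTot_mem : ∀ i, dTot M (μ i) ∈ totIn (K i)ᶜ
  connect : ∀ i, μ (i + 1) - μ i - dTot M (ν i) ∈ totIn (K i)ᶜ
  cap_left : ∀ C φ, IsClosed C → φ ∈ locZero C → (fun i => capTot M (μ i) φ) ∈ evOut K C
  cap_right : ∀ C φ, IsClosed C → φ ∈ locZero C → (fun i => capTot M (ν i) φ) ∈ evOut K C
  isGen : ∀ i, ∀ x ∈ K i, IsGen (dTot M) ⊤ (totIn ({x}ᶜ : Set M)) (μ i)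

/-- The i-th chain is subdivided i times, so in the limit it becomes finer than any open cover of a
compact set, and every locally zero cochain is eventually capped off C. The subdivision homotopy,
with a sign, joins consecutive terms. -/
theorem dualSystem_of_fundamentalSequence [T2Space M] {n : ℕ} {a : ℕ → Chain ℤ M n}
    (ha : FundamentalSequence K a) : DualSystem K (fun i => (sd M ^ i) (ofDeg M n (a i)))
      (fun i => -sdHt M ((sd M ^ i) (ofDeg M n (a i)))) := by
  have hcap : ∀ (f : Tot M →ₗ[ℤ] Tot M), (∀ U : Set M, ∀ c ∈ totIn U, f c ∈ totIn U) →
      ∀ C φ, (∀ c, ∃ m₀, ∀ m ≥ m₀, capTot M (f ((sd M ^ m) c)) φ ∈ totIn Cᶜ) →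
      (fun i => capTot M (f ((sd M ^ i) (ofDeg M n (a i)))) φ) ∈ evOut K C := by
    intro f hf C φ h j
    -- Over K j only the fixed chain `a j` matters: the rest of `a i` is off K j and remains so
    -- under subdivision and capping.
    obtain ⟨m₀, hm₀⟩ := h (ofDeg M n (a j))
    filter_upwards [Filter.eventually_ge_atTop m₀, Filter.eventually_ge_atTop j] with i hi hij
    have hr : ofDeg M n (a i) - ofDeg M n (a j) ∈ totIn (K j)ᶜ := by
      clear hi
      induction i, hij using Nat.le_induction with
      | base => rw [sub_self]; exact zero_mem _
      | succ i hij ih =>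
        rw [← sub_add_sub_cancel _ (ofDeg M n (a i)), ← map_sub]
        exact add_mem (totIn_mono (compl_subset_compl.2 (K.subset hij)) (ha.sub_mem i)) ih
    have e : capTot M (f ((sd M ^ i) (ofDeg M n (a i)))) φ =
        capTot M (f ((sd M ^ i) (ofDeg M n (a i) - ofDeg M n (a j)))) φ +
        capTot M (f ((sd M ^ i) (ofDeg M n (a j)))) φ := by
      simp only [map_sub, LinearMap.sub_apply, sub_add_cancel]
    rw [e]
    exact add_mem (totIn_mono (compl_subset_compl.2 inter_subset_right)
      (capTot_mem (hf _ _ (sd_pow_mem hr i)) φ))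
      (totIn_mono (compl_subset_compl.2 inter_subset_left) (hm₀ i hi))
  refine ⟨fun i => ?_, fun i => ?_, fun C φ hC hφ => ?_, fun C φ hC hφ => ?_, fun i x hx => ?_⟩
  · rw [dTot_sd_pow]
    exact sd_pow_mem (ha.dTot_mem i) i
  · have e : (sd M ^ (i + 1)) (ofDeg M n (a (i + 1))) - (sd M ^ i) (ofDeg M n (a i)) -
        dTot M (-sdHt M ((sd M ^ i) (ofDeg M n (a i)))) =
        (sd M ^ (i + 1)) (ofDeg M n (a (i + 1) - a i)) -
        sdHt M ((sd M ^ i) (dTot M (ofDeg M n (a i)))) := by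
      rw [map_neg, dTot_sdHt, dTot_sd_pow, map_sub, map_sub, pow_succ', Module.End.mul_apply,
        Module.End.mul_apply]
      abel
    rw [e]
    exact sub_mem (sd_pow_mem (ha.sub_mem i) _) (sdHt_mem (sd_pow_mem (ha.dTot_mem i) _))
  · refine hcap LinearMap.id (fun U c hc => hc) C φ fun c => ?_
    obtain ⟨m₀, h⟩ := exists_capTot_sd_pow_mem hC hφ c
    exact ⟨m₀, fun m hm => (h m hm).1⟩
  · refine hcap (-sdHt M) (fun U c hc => neg_mem (sdHt_mem hc)) C φ fun c => ?_
    obtain ⟨m₀, h⟩ := exists_capTot_sd_pow_mem hC hφ c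
    refine ⟨m₀, fun m hm => ?_⟩
    rw [LinearMap.neg_apply, map_neg, LinearMap.neg_apply]
    exact neg_mem (h m hm).2
  · have hKx : totIn (K i)ᶜ ≤ totIn ({x}ᶜ : Set M) :=
      totIn_mono (compl_subset_compl.2 (singleton_subset_iff.2 hx))
    refine (ha.isGen i x hx).of_smul (s := 1) (e := sdHtPow M i (ofDeg M n (a i)))
      Submodule.mem_top ?_ Submodule.mem_top ?_
    · rw [dTot_sd_pow]
      exact hKx (sd_pow_mem (ha.dTot_mem i) i)
    · rw [one_smul, dTot_sdHtPow, sub_sub_cancel]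
      exact hKx (sdHtPow_mem (ha.dTot_mem i) i)

variable {μ ν : ℕ → Tot M}

theorem coneBd_mem (H : DualSystem K μ ν) (hC : IsClosed C) {v : Telescope M}
    (hv : v ∈ coneNull K C) : coneBd μ ν v ∈ coneNull K C :=
  ⟨dDual_mem_locZero hv.1, add_mem (H.cap_left C v.1 hC hv.1) (evOut_dTot hv.2.1),
    sub_mem (sub_mem (add_mem (H.cap_right C _ hC (sgnDual_mem_locZero hv.1))
      (evOut_shift hv.2.1)) hv.2.1) (evOut_dTot hv.2.2)⟩

/-- The `μ i` are cycles only relative to the complements of K i, so `coneBd` does not square to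
zero. The error at index i is off K i, hence negligible near every set; all later arguments work
modulo such terms. -/
theorem coneBd_coneBd_mem (H : DualSystem K μ ν) (C : Set M) (v : Telescope M) :
    coneBd μ ν (coneBd μ ν v) ∈ coneNull K C := by
  refine ⟨?_, mem_evOut_of_compl fun i => ?_, mem_evOut_of_compl fun i => ?_⟩
  · change dDual M (dDual M v.1) ∈ _
    rw [dDual_dDual]
    exact zero_mem _
  · change capTot M (μ i) (dDual M v.1) + dTot M (capTot M (μ i) v.1 + dTot M (v.2.1 i)) ∈ _
    rw [map_add, dTot_dTot, add_zero, dTot_capTot, add_sub_cancel]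
    exact capTot_mem (H.dTot_mem i) _
  · change capTot M (ν i) (sgnDual M (dDual M v.1)) +
      (capTot M (μ (i + 1)) v.1 + dTot M (v.2.1 (i + 1))) -
      (capTot M (μ i) v.1 + dTot M (v.2.1 i)) -
      dTot M (capTot M (ν i) (sgnDual M v.1) + v.2.1 (i + 1) - v.2.1 i - dTot M (v.2.2 i)) ∈ _
    have e : capTot M (ν i) (sgnDual M (dDual M v.1)) +
      (capTot M (μ (i + 1)) v.1 + dTot M (v.2.1 (i + 1))) -
      (capTot M (μ i) v.1 + dTot M (v.2.1 i)) -
      dTot M (capTot M (ν i) (sgnDual M v.1) + v.2.1 (i + 1) - v.2.1 i - dTot M (v.2.2 i)) =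
      capTot M (μ (i + 1) - μ i - dTot M (ν i)) v.1 := by
      rw [map_sub (dTot M), map_sub (dTot M), map_add (dTot M), dTot_dTot, dTot_capTot,
        sgnDual_sgnDual, dDual_sgnDual, map_neg, map_sub, map_sub, LinearMap.sub_apply,
        LinearMap.sub_apply]
      abel
    rw [e]
    exact capTot_mem (H.connect i) _

end Telescope

/-! ### An algebraic Mayer–Vietoris step. -/

section MayerVietoris

/-- N₁, N₂ and N₁₂ play the role of elements negligible near K, near L and near K ∩ L. The
difference of two solutions is a cycle modulo N₁₂, hence a boundary up to N₁₂; acyclicity of N₁₂/(N₁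
+ N₂) splits what is left, and each solution absorbs its share. The square of d needs to vanish only
modulo N₁ and N₂. -/
theorem acyclic_union {V : Type*} [AddCommGroup V] {d : V →ₗ[ℤ] V} {N₁ N₂ N₁₂ : Submodule ℤ V}
    (hd₁ : ∀ v, d (d v) ∈ N₁) (hd₂ : ∀ v, d (d v) ∈ N₂) (hN₁ : ∀ v ∈ N₁, d v ∈ N₁)
    (hN₂ : ∀ v ∈ N₂, d v ∈ N₂) (h₁ : N₁ ≤ N₁₂) (h₂ : N₂ ≤ N₁₂)
    (ha : ∀ v, d v ∈ N₁₂ → ∃ u, v - d u ∈ N₁₂) (hb : Acyclic d N₁₂ (N₁ ⊔ N₂)) {v u₁ u₂ : V}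
    (hu₁ : v - d u₁ ∈ N₁) (hu₂ : v - d u₂ ∈ N₂) : ∃ u, v - d u ∈ N₁ ⊓ N₂ := by
  have hd : d (u₁ - u₂) = -(v - d u₁) + (v - d u₂) := by rw [map_sub]; abel
  have hd' : d (u₁ - u₂) ∈ N₁ ⊔ N₂ := hd ▸ Submodule.add_mem_sup (neg_mem hu₁) hu₂
  obtain ⟨z, hz⟩ := ha _ (sup_le h₁ h₂ hd')
  obtain ⟨y, -, hy⟩ := hb _ hz (by
    rw [map_sub]
    exact sub_mem hd' (Submodule.mem_sup_left (hd₁ z)))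
  obtain ⟨m₁, hm₁, m₂, hm₂, hm⟩ := Submodule.mem_sup.1 hy
  refine ⟨u₁ - m₁, ?_, ?_⟩
  · rw [map_sub, ← sub_add]
    exact add_mem hu₁ (hN₁ _ hm₁)
  · have e : u₁ - m₁ = u₂ + m₂ + d (z + y) := by
      rw [map_add, eq_sub_of_add_eq hm]
      abel
    rw [e, map_add, map_add, ← sub_sub, ← sub_sub]
    exact sub_mem (sub_mem hu₂ (hN₂ _ hm₂)) (hd₂ _)

end MayerVietoris

/-! ### Gluing and continuity for the cone. -/

section LocalDuality

variable {M : Type u} [TopologicalSpace M] {K : CompactExhaustion M} {μ ν : ℕ → Tot M}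

theorem exists_add_of_eventually_mem_sup {P Q : Submodule ℤ (Tot M)} {c : ℕ → Tot M}
    (h : ∀ᶠ i in Filter.atTop, c i ∈ P ⊔ Q) : ∃ y z : ℕ → Tot M, y + z = c ∧
      (∀ᶠ i in Filter.atTop, y i ∈ P) ∧ ∀ᶠ i in Filter.atTop, z i ∈ Q := by
  have hex : ∀ i, ∃ p : Tot M × Tot M, p.1 + p.2 = c i ∧ (c i ∈ P ⊔ Q → p.1 ∈ P ∧ p.2 ∈ Q) := by
    intro i
    by_cases hi : c i ∈ P ⊔ Q
    · obtain ⟨y, hy, z, hz, e⟩ := Submodule.mem_sup.1 hi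
      exact ⟨(y, z), e, fun _ => ⟨hy, hz⟩⟩
    · exact ⟨(c i, 0), add_zero _, fun h => absurd h hi⟩
  choose p hp hpq using hex
  exact ⟨fun i => (p i).1, fun i => (p i).2, funext hp, h.mono fun i hi => (hpq i hi).1,
    h.mono fun i hi => (hpq i hi).2⟩

theorem eventually_mem_sup_of_mem_sup {S T : Set M} (hS : IsCompact S) (hT : IsCompact T)
    {c : ℕ → Tot M} (h : c ∈ evOut K S ⊔ evOut K T) :
    ∀ᶠ i in Filter.atTop, c i ∈ totIn Sᶜ ⊔ totIn Tᶜ := by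
  obtain ⟨y, hy, z, hz, rfl⟩ := Submodule.mem_sup.1 h
  filter_upwards [(mem_evOut_iff_of_isCompact hS).1 hy, (mem_evOut_iff_of_isCompact hT).1 hz]
    with i h1 h2
  exact Submodule.add_mem_sup h1 h2

theorem mem_sup_of_eventually_mem_sup {S T : Set M} (hS : IsCompact S) (hT : IsCompact T)
    {c : ℕ → Tot M} (h : ∀ᶠ i in Filter.atTop, c i ∈ totIn Sᶜ ⊔ totIn Tᶜ) :
    c ∈ evOut K S ⊔ evOut K T := by
  obtain ⟨y, z, rfl, hy, hz⟩ := exists_add_of_eventually_mem_sup h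
  exact Submodule.add_mem_sup ((mem_evOut_iff_of_isCompact hS).2 hy)
    ((mem_evOut_iff_of_isCompact hT).2 hz)

/-- Excision for sequences of chains. -/
theorem exists_eventually_excision {U V : Set M} (hU : IsOpen U) (hV : IsOpen V) {c : ℕ → Tot M}
    (hc : ∀ᶠ i in Filter.atTop, c i ∈ totIn (U ∪ V))
    (hd : ∀ᶠ i in Filter.atTop, dTot M (c i) ∈ totIn U ⊔ totIn V) :
    ∃ e : ℕ → Tot M, (∀ᶠ i in Filter.atTop, e i ∈ totIn (U ∪ V)) ∧
      ∀ᶠ i in Filter.atTop, c i - dTot M (e i) ∈ totIn U ⊔ totIn V := by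
  have hex : ∀ i, ∃ e, c i ∈ totIn (U ∪ V) → dTot M (c i) ∈ totIn U ⊔ totIn V →
      e ∈ totIn (U ∪ V) ∧ c i - dTot M e ∈ totIn U ⊔ totIn V := by
    intro i
    by_cases h : c i ∈ totIn (U ∪ V) ∧ dTot M (c i) ∈ totIn U ⊔ totIn V
    · obtain ⟨e, he, h'⟩ := excision hU hV h.1 h.2
      exact ⟨e, fun _ _ => ⟨he, h'⟩⟩
    · exact ⟨0, fun h1 h2 => absurd ⟨h1, h2⟩ h⟩
  choose e he using hex
  exact ⟨e, by filter_upwards [hc, hd] with i h1 h2 using (he i h1 h2).1,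
    by filter_upwards [hc, hd] with i h1 h2 using (he i h1 h2).2⟩

theorem coneNull_sup_snd {S T : Set M} {v : Telescope M} (h : v ∈ coneNull K S ⊔ coneNull K T) :
    v.2.1 ∈ evOut K S ⊔ evOut K T ∧ v.2.2 ∈ evOut K S ⊔ evOut K T := by
  obtain ⟨x, hx, y, hy, rfl⟩ := Submodule.mem_sup.1 h
  exact ⟨Submodule.add_mem_sup hx.2.1 hy.2.1, Submodule.add_mem_sup hx.2.2 hy.2.2⟩

/-- The cochain splits into a sum without any correction. The sequences split term by term by
excision, the second one after the correction e of the first has been taken into account through the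
shift. -/
theorem acyclic_coneNull_inter [T2Space M] (H : DualSystem K μ ν) {S T : Set M}
    (hS : IsCompact S) (hT : IsCompact T) :
    Acyclic (coneBd μ ν) (coneNull K (S ∩ T)) (coneNull K S ⊔ coneNull K T) := by
  rintro ⟨φ, c, h⟩ hv hdv
  have hc := (mem_evOut_iff_of_isCompact (K := K) (hS.inter hT)).1 hv.2.1
  have hh := (mem_evOut_iff_of_isCompact (K := K) (hS.inter hT)).1 hv.2.2
  simp only [compl_inter] at hc hh
  obtain ⟨φ₁, hφ₁, φ₂, hφ₂, hφ⟩ := exists_add_of_mem_locZero_inter hS hT hv.1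
  have hm₁ : ((φ₁, 0, 0) : Telescope M) ∈ coneNull K S := ⟨hφ₁, zero_mem _, zero_mem _⟩
  have hm₂ : ((φ₂, 0, 0) : Telescope M) ∈ coneNull K T := ⟨hφ₂, zero_mem _, zero_mem _⟩
  have hsum : ((φ, c, h) : Telescope M) = (0, c, h) + ((φ₁, 0, 0) + (φ₂, 0, 0)) := by
    simp [hφ]
  have hd0 : coneBd μ ν (0, c, h) ∈ coneNull K S ⊔ coneNull K T := by
    rw [hsum, map_add, map_add] at hdv
    exact (add_mem_cancel_right (Submodule.add_mem_sup (coneBd_mem H hS.isClosed hm₁)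
      (coneBd_mem H hT.isClosed hm₂))).1 hdv
  obtain ⟨hd1, hd2⟩ := coneNull_sup_snd hd0
  have hd1 := eventually_mem_sup_of_mem_sup hS hT hd1
  have hd2 := eventually_mem_sup_of_mem_sup hS hT hd2
  simp only [coneBd, LinearMap.coe_mk, AddHom.coe_mk, map_zero, zero_add] at hd1 hd2
  obtain ⟨e, he, hce⟩ := exists_eventually_excision hS.isClosed.isOpen_compl
    hT.isClosed.isOpen_compl hc hd1
  have hshift := Filter.tendsto_add_atTop_nat 1
  -- Subtracting the shift difference of e makes the boundary small, as the third component of the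
  -- cone boundary controls only c (i + 1) - c i - d (h i).
  obtain ⟨f, hf, hhf⟩ := exists_eventually_excision (c := fun i => h i - (e (i + 1) - e i))
    hS.isClosed.isOpen_compl hT.isClosed.isOpen_compl (by
      filter_upwards [hh, he, hshift.eventually he] with i h1 h2 h3
      exact sub_mem h1 (sub_mem h3 h2)) (by
      filter_upwards [hd2, hce, hshift.eventually hce] with i h1 h2 h3
      have e1 : dTot M (h i - (e (i + 1) - e i)) =
          (c (i + 1) - dTot M (e (i + 1))) - (c i - dTot M (e i)) -
          (c (i + 1) - c i - dTot M (h i)) := by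
        rw [map_sub, map_sub]; abel
      rw [e1]
      exact sub_mem (sub_mem h3 h2) h1)
  have hcompl : (S ∩ T)ᶜ = Sᶜ ∪ Tᶜ := compl_inter S T
  refine ⟨(0, e, -f), ⟨zero_mem _, (mem_evOut_iff_of_isCompact (hS.inter hT)).2 (by
      simpa only [hcompl] using he), neg_mem ((mem_evOut_iff_of_isCompact (hS.inter hT)).2 (by
      simpa only [hcompl] using hf))⟩, ?_⟩
  have hfin : ((φ, c, h) : Telescope M) - coneBd μ ν (0, e, -f) =
      ((φ₁, 0, 0) + (φ₂, 0, 0)) + (0, fun i => c i - dTot M (e i),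
        fun i => h i - (e (i + 1) - e i) - dTot M (f i)) := by
    rw [hsum, add_comm _ ((φ₁, 0, 0) + (φ₂, 0, 0) : Telescope M), add_sub_assoc]
    congr 1
    refine Prod.ext ?_ (Prod.ext (funext fun i => ?_) (funext fun i => ?_))
    · simp [coneBd]
    · simp [coneBd]
    · simp only [coneBd, LinearMap.coe_mk, AddHom.coe_mk, Prod.snd_sub, Pi.sub_apply, map_zero,
        Pi.neg_apply, map_neg]
      abel
  rw [hfin]
  refine add_mem (Submodule.add_mem_sup hm₁ hm₂) ?_
  obtain ⟨y₁, hy₁, z₁, hz₁, e₁⟩ := Submodule.mem_sup.1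
    (mem_sup_of_eventually_mem_sup (K := K) hS hT hce)
  obtain ⟨y₂, hy₂, z₂, hz₂, e₂⟩ := Submodule.mem_sup.1
    (mem_sup_of_eventually_mem_sup (K := K) hS hT hhf)
  rw [← e₁, ← e₂]
  exact Submodule.mem_sup.2 ⟨(0, y₁, y₂), ⟨zero_mem _, hy₁, hy₂⟩, (0, z₁, z₂),
    ⟨zero_mem _, hz₁, hz₂⟩, by simp⟩

/-- Each late term of a sequence in `evOut K S` avoids a neighbourhood of S, but these may shrink
along the sequence. The cycle condition over T ties all late terms to the single chain `c i₁`, up to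
boundaries of sums of the h and up to chains off L ∩ T; and one chain avoids a fixed neighbourhood.
-/
theorem coneBd_nhds [T2Space M] [LocallyCompactSpace M] (H : DualSystem K μ ν) {v : Telescope M}
    {S T : Set M} (hS : IsCompact S) (hT : IsCompact T) (_ : S ⊆ T)
    (hv : coneBd μ ν v ∈ coneNull K T) (hu : ∃ u, v - coneBd μ ν u ∈ coneNull K S) :
    ∃ W, IsOpen W ∧ S ⊆ W ∧ ∀ S' : Set M, IsCompact S' → S' ⊆ W → S' ⊆ T →
      ∃ u, v - coneBd μ ν u ∈ coneNull K S' := by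
  obtain ⟨u, hu⟩ := hu
  obtain ⟨W₀, hW₀, hSW₀, hφW⟩ := exists_isOpen_mem_locZero hu.1
  obtain ⟨L, hL, hSL, hLW⟩ := exists_compact_between hS hW₀ hSW₀
  have hLT : IsCompact (L ∩ T) := hL.inter hT
  have hd : coneBd μ ν (v - coneBd μ ν u) ∈ coneNull K (L ∩ T) := by
    rw [map_sub]
    exact sub_mem (coneNull_anti inter_subset_right hv) (coneBd_coneBd_mem H _ u)
  set w := v - coneBd μ ν u with hw
  obtain ⟨φ, c, h⟩ := w
  have hφ : φ ∈ locZero (L ∩ T) := locZero_anti (inter_subset_left.trans hLW) hφW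
  have h1 : (fun i => c (i + 1) - c i - dTot M (h i)) ∈ evOut K (L ∩ T) := by
    have := sub_mem hd.2.2 (H.cap_right _ _ hLT.isClosed (sgnDual_mem_locZero hφ))
    refine (congrArg (· ∈ evOut K (L ∩ T)) (funext fun i => ?_)).mp this
    simp only [coneBd, LinearMap.coe_mk, AddHom.coe_mk, Pi.sub_apply]
    abel
  obtain ⟨i₁, hi₁⟩ := Filter.eventually_atTop.1
    (((mem_evOut_iff_of_isCompact hLT).1 h1).and ((mem_evOut_iff_of_isCompact hS).1 hu.2.1))
  obtain ⟨W₁, hW₁, hSW₁, hcW⟩ := exists_isOpen_of_mem_totIn_compl (hi₁ i₁ le_rfl).2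
  -- The partial sums satisfy e (i + 1) - e i = h i from i₁ on, so subtracting this boundary also
  -- cancels the third component.
  let e : ℕ → Tot M := fun i => ∑ l ∈ Finset.Ico i₁ i, h l
  have hce : ∀ i ≥ i₁, c i - dTot M (e i) - c i₁ ∈ totIn (L ∩ T)ᶜ := by
    intro i hi
    induction i, hi using Nat.le_induction with
    | base => simp [e]
    | succ i hi ih =>
      have e1 : c (i + 1) - dTot M (e (i + 1)) - c i₁ =
          (c i - dTot M (e i) - c i₁) + (c (i + 1) - c i - dTot M (h i)) := by
        simp only [e, Finset.sum_Ico_succ_top hi, map_add]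
        abel
      rw [e1]
      exact add_mem ih (hi₁ i hi).1
  refine ⟨interior L ∩ W₁, isOpen_interior.inter hW₁, subset_inter hSL hSW₁,
    fun S' hS' hW hS'T => ⟨u + (0, e, 0), ?_⟩⟩
  have hS'L : S' ⊆ L := fun x hx => interior_subset (hW hx).1
  rw [map_add, ← sub_sub, ← hw]
  refine ⟨?_, ?_, ?_⟩
  · change φ - dDual M 0 ∈ locZero S'
    rw [map_zero, sub_zero]
    exact locZero_anti (hS'L.trans hLW) hφW
  · refine (mem_evOut_iff_of_isCompact hS').2 ?_
    filter_upwards [Filter.eventually_ge_atTop i₁] with i hi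
    change c i - (capTot M (μ i) 0 + dTot M (e i)) ∈ _
    rw [map_zero, zero_add, ← sub_add_cancel (c i - dTot M (e i)) (c i₁)]
    exact add_mem (totIn_mono (compl_subset_compl.2 (subset_inter hS'L hS'T)) (hce i hi))
      (totIn_mono (compl_subset_compl.2 fun x hx => (hW hx).2) hcW)
  · refine (mem_evOut_iff_of_isCompact hS').2 ?_
    filter_upwards [Filter.eventually_ge_atTop i₁] with i hi
    change h i - (capTot M (ν i) (sgnDual M 0) + e (i + 1) - e i - dTot M 0) ∈ _
    have : h i - (capTot M (ν i) (sgnDual M 0) + e (i + 1) - e i - dTot M 0) = 0 := by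
      simp only [e, Finset.sum_Ico_succ_top hi, map_zero]
      abel
    rw [this]
    exact zero_mem _

end LocalDuality

/-! ### Local duality at a point. -/

section Point

variable {M : Type u} [TopologicalSpace M] {K : CompactExhaustion M} {μ ν : ℕ → Tot M}

@[simp] theorem dDual_augTot : dDual M (augTot M) = 0 := by
  refine LinearMap.ext fun c => ?_
  rw [dDual_apply]
  have : sgn M (dTot M c) = -dTot M (sgn M c) := by rw [dTot_sgn, neg_neg]
  rw [this, map_neg, augTot_dTot, neg_zero]
  rfl

@[simp] theorem sgnDual_augTot : sgnDual M (augTot M) = augTot M := by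
  refine LinearMap.ext fun c => ?_
  rw [sgnDual_apply]
  induction c using tot_induction with
  | h0 => simp
  | hadd x y hx hy => simp only [map_add, hx, hy]
  | h n c =>
    rw [sgn_ofDeg, map_smul]
    rcases n with _ | n
    · simp
    · rw [augTot_ofDeg_of_ne (Nat.succ_ne_zero n), smul_zero]

/-- Near a point of a manifold, a cocycle is cohomologous to a multiple of the augmentation. -/
theorem exists_sub_augTot_mem_locZero {n : ℕ} [ChartedSpace (EuclideanSpace ℝ (Fin n)) M] {x : M}
    {φ : TotDual M} (h : dDual M φ ∈ locZero {x}) :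
    ∃ (s : ℤ) (ψ : TotDual M), φ - dDual M ψ - s • augTot M ∈ locZero {x} := by
  obtain ⟨W, hW, hxW, hφ⟩ := h x rfl
  set e := chartAt (EuclideanSpace ℝ (Fin n)) x
  have hx : x ∈ e.source := mem_chart_source _ x
  have ho : IsOpen (e.target ∩ e.symm ⁻¹' W) := e.symm.isOpen_inter_preimage hW
  obtain ⟨R, hR, hball⟩ := Metric.isOpen_iff.1 ho (e x)
    ⟨e.map_source hx, by rw [mem_preimage, e.left_inv hx]; exact hxW⟩
  have hΩ : StarConvex ℝ (e x) (Metric.ball (e x) R) :=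
    (convex_ball _ _).starConvex (Metric.mem_ball_self hR)
  have hΩe : Metric.ball (e x) R ⊆ e.target := fun y hy => (hball hy).1
  have hBW : chartSet e (Metric.ball (e x) R) ⊆ W := by
    rintro y ⟨hy, hyb⟩
    have : e.symm (e y) ∈ W := (hball hyb).2
    rwa [e.left_inv hy] at this
  set κ := chartCone e hΩ hΩe
  refine ⟨φ (Finsupp.single (pointSimplex (e.symm (e x))) 1), φ ∘ₗ κ ∘ₗ sgn M,
    VanishesOn.mem_locZero (W := chartSet e (Metric.ball (e x) R)) (fun c hc => ?_)
      (isOpen_chartSet e Metric.isOpen_ball)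
      (singleton_subset_iff.2 ⟨hx, Metric.mem_ball_self hR⟩)⟩
  have hcyc : ∀ y ∈ totIn (chartSet e (Metric.ball (e x) R)), φ (dTot M y) = 0 := fun y hy => by
    have h1 := hφ (sgn M y) (sgn_mem (totIn_mono hBW hy))
    rw [dDual_apply, dTot_sgn, map_neg, sgn_sgn, map_neg, neg_eq_zero] at h1
    exact h1
  have h2 := hcyc _ (chartCone_mem e hΩ hΩe hΩ le_rfl hc)
  rw [dTot_chartCone e hΩ hΩe hc, map_sub, map_sub, map_smul] at h2
  rw [LinearMap.sub_apply, LinearMap.sub_apply, LinearMap.smul_apply, dDual_apply,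
    LinearMap.comp_apply, LinearMap.comp_apply, sgn_sgn, smul_eq_mul, mul_comm, ← smul_eq_mul]
  exact h2

/-- Near x a cocycle is a multiple of the augmentation, and capping with the augmentation is the
identity. So the cap product sends the generator of the cohomology of a point to `μ i`, which
generates the local homology; that a generator goes to a generator is acyclicity of the cone. -/
theorem coneBd_point [T2Space M] {n : ℕ} [ChartedSpace (EuclideanSpace ℝ (Fin n)) M]
    (H : DualSystem K μ ν) {v : Telescope M} {x : M} (hv : coneBd μ ν v ∈ coneNull K {x}) :
    ∃ u, v - coneBd μ ν u ∈ coneNull K {x} := by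
  have hxc : IsCompact ({x} : Set M) := isCompact_singleton
  obtain ⟨φ, c, h⟩ := v
  obtain ⟨s, ψ, hψ⟩ := exists_sub_augTot_mem_locZero (n := n) hv.1
  set θ := φ - dDual M ψ - s • augTot M with hθ
  have hm : ((θ, 0, 0) : Telescope M) ∈ coneNull K {x} := ⟨hψ, zero_mem _, zero_mem _⟩
  set w : Telescope M := (φ, c, h) - coneBd μ ν (ψ, 0, 0) - (θ, 0, 0) with hw
  have hdw : coneBd μ ν w ∈ coneNull K {x} := by
    rw [hw, map_sub, map_sub]
    exact sub_mem (sub_mem hv (coneBd_coneBd_mem H _ _)) (coneBd_mem H hxc.isClosed hm)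
  have hw1 : w.1 = s • augTot M := by
    change φ - dDual M ψ - θ = _
    rw [hθ]; abel
  suffices hs : ∃ u, w - coneBd μ ν u ∈ coneNull K {x} by
    obtain ⟨u, hu⟩ := hs
    refine ⟨(ψ, 0, 0) + u, ?_⟩
    have : (φ, c, h) - coneBd μ ν ((ψ, 0, 0) + u) = (w - coneBd μ ν u) + (θ, 0, 0) := by
      rw [map_add, hw]; abel
    rw [this]
    exact add_mem hu hm
  clear_value w
  obtain ⟨φ', c, h⟩ := w
  obtain rfl : φ' = s • augTot M := hw1
  obtain ⟨j, hj⟩ := K.exists_mem x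
  obtain ⟨i₀, hi₀⟩ := Filter.eventually_atTop.1
    (((mem_evOut_iff_of_isCompact hxc).1 hdw.2.1).and ((mem_evOut_iff_of_isCompact hxc).1 hdw.2.2))
  simp only [coneBd, LinearMap.coe_mk, AddHom.coe_mk, map_smul, sgnDual_augTot, capTot_augTot]
    at hi₀
  set i₁ := max i₀ j with hi₁
  have hgen := H.isGen i₁ x (K.subset (le_max_right _ _) hj)
  -- Injectivity: the second component says that s • μ i₁ bounds relative to the complement of x.
  obtain rfl : s = 0 := by
    refine hgen.eq_zero s (-c i₁) Submodule.mem_top ?_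
    rw [map_neg, sub_neg_eq_add]
    exact (hi₀ i₁ (le_max_left _ _)).1
  simp only [zero_smul, zero_add] at hi₀
  obtain ⟨r, e₀, -, he₀⟩ := hgen.exists_smul (c i₁) Submodule.mem_top (hi₀ i₁ (le_max_left _ _)).1
  -- Surjectivity: the relation between `c i₁` and r • `μ i₁` is carried to later indices by the
  -- connecting chains h and ν.
  let e : ℕ → Tot M := fun i => e₀ + ∑ l ∈ Finset.Ico i₁ i, (h l - r • ν l)
  have hce : ∀ i ≥ i₁, c i - r • μ i - dTot M (e i) ∈ totIn ({x}ᶜ : Set M) := by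
    intro i hi
    induction i, hi using Nat.le_induction with
    | base => simpa [e] using he₀
    | succ i hi ih =>
      have e1 : c (i + 1) - r • μ (i + 1) - dTot M (e (i + 1)) =
          (c i - r • μ i - dTot M (e i)) + (c (i + 1) - c i - dTot M (h i)) -
          r • (μ (i + 1) - μ i - dTot M (ν i)) := by
        simp only [e, Finset.sum_Ico_succ_top hi, map_add, map_sub, map_smul, smul_sub]
        abel
      rw [e1]
      refine sub_mem (add_mem ih (hi₀ i ((le_max_left _ _).trans hi)).2)
        (Submodule.smul_mem _ _ (totIn_mono (compl_subset_compl.2 ?_) (H.connect i)))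
      exact singleton_subset_iff.2 (K.subset ((le_max_right _ _).trans hi) hj)
  refine ⟨(r • augTot M, e, 0), ?_, ?_, ?_⟩
  · change (0 : ℤ) • augTot M - dDual M (r • augTot M) ∈ locZero {x}
    rw [map_smul, dDual_augTot, smul_zero, zero_smul, sub_zero]
    exact zero_mem _
  · refine (mem_evOut_iff_of_isCompact hxc).2 ?_
    filter_upwards [Filter.eventually_ge_atTop i₁] with i hi
    change c i - (capTot M (μ i) (r • augTot M) + dTot M (e i)) ∈ _
    rw [map_smul, capTot_augTot, ← sub_sub]
    exact hce i hi
  · refine (mem_evOut_iff_of_isCompact hxc).2 ?_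
    filter_upwards [Filter.eventually_ge_atTop i₁] with i hi
    change h i - (capTot M (ν i) (sgnDual M (r • augTot M)) + e (i + 1) - e i - dTot M 0) ∈ _
    have : h i - (capTot M (ν i) (sgnDual M (r • augTot M)) + e (i + 1) - e i - dTot M 0) = 0 := by
      simp only [e, Finset.sum_Ico_succ_top hi, map_zero, map_smul, sgnDual_augTot, capTot_augTot]
      abel
    rw [this]
    exact zero_mem _

end Point

/-! ### Local duality over closed sets. -/

section Closed

variable {M : Type u} [TopologicalSpace M] {K : CompactExhaustion M} {μ ν : ℕ → Tot M}

theorem coneNull_union_eq {S T : Set M} :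
    coneNull K S ⊓ coneNull K T = coneNull K (S ∪ T) :=
  le_antisymm (fun _ h => coneNull_union h.1 h.2)
    (le_inf (coneNull_anti subset_union_left) (coneNull_anti subset_union_right))

theorem compactInduction_coneBd [T2Space M] {n : ℕ} [ChartedSpace (EuclideanSpace ℝ (Fin n)) M]
    (H : DualSystem K μ ν) : CompactInduction
      (fun (v : Telescope M) S => coneBd μ ν v ∈ coneNull K S)
      (fun v S => ∃ u, v - coneBd μ ν u ∈ coneNull K S) where
  anti v S T hST h := coneNull_anti hST h
  union v S T hS hT := by
    rintro ⟨u₁, hu₁⟩ ⟨u₂, hu₂⟩ h -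
    rw [← coneNull_union_eq]
    exact acyclic_union (coneBd_coneBd_mem H S) (coneBd_coneBd_mem H T)
      (fun _ => coneBd_mem H hS.isClosed) (fun _ => coneBd_mem H hT.isClosed)
      (coneNull_anti inter_subset_left) (coneNull_anti inter_subset_right) h
      (acyclic_coneNull_inter H hS hT) hu₁ hu₂
  nhds v S T hS hT hST hv hu := by
    have := ChartedSpace.locallyCompactSpace (EuclideanSpace ℝ (Fin n)) M
    exact coneBd_nhds H hS hT hST hv hu
  empty v _ := ⟨0, fun x hx => hx.elim, fun j => Filter.Eventually.of_forall fun i => by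
      rw [empty_inter, compl_empty]
      exact mem_totIn_univ _, fun j => Filter.Eventually.of_forall fun i => by
      rw [empty_inter, compl_empty]
      exact mem_totIn_univ _⟩
  point v x h := coneBd_point (n := n) H h

/-- Cochains that agree to a growing extent can be glued. -/
theorem exists_sub_mem_locZero {C : Set M} {φ : ℕ → TotDual M}
    (h : ∀ i j, i ≤ j → φ j - φ i ∈ locZero (C ∩ K i)) [T2Space M] :
    ∃ ψ, ∀ j, ψ - φ j ∈ locZero (C ∩ K j) := by
  classical
  have hex : ∀ s : Simplex M, ∃ j, ∀ t, s.2 t ∈ interior (K j) := by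
    intro s
    obtain ⟨j, hj⟩ := K.exists_superset_of_isCompact (isCompact_range s.2.continuous)
    exact ⟨j + 1, fun t => K.subset_interior_succ j (hj ⟨t, rfl⟩)⟩
  -- A simplex is evaluated by the cochain of the first level whose interior contains it. Near a
  -- point of K j only levels up to j + 1 occur, so finitely many neighbourhoods have to be
  -- intersected.
  let J : Simplex M → ℕ := fun s => Nat.find (hex s)
  refine ⟨Finsupp.linearCombination ℤ fun s => φ (J s) (Finsupp.single s 1), fun j x hx => ?_⟩
  have hW : ∀ l, ∃ W, IsOpen W ∧ x ∈ W ∧ (l ≤ j + 1 → (x ∈ K l ∧ VanishesOn W (φ l - φ j)) ∨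
      W ⊆ (K l)ᶜ) := by
    intro l
    by_cases hl : l ≤ j + 1 ∧ x ∈ K l
    · have hz : ∃ W, IsOpen W ∧ x ∈ W ∧ VanishesOn W (φ l - φ j) := by
        rcases le_total l j with hlj | hjl
        · obtain ⟨W, hW, hxW, hv⟩ := h l j hlj x ⟨hx.1, hl.2⟩
          refine ⟨W, hW, hxW, fun c hc => ?_⟩
          have := hv c hc
          rw [LinearMap.sub_apply, sub_eq_zero] at this ⊢
          exact this.symm
        · exact h j l hjl x hx
      obtain ⟨W, hW, hxW, hv⟩ := hz
      exact ⟨W, hW, hxW, fun _ => Or.inl ⟨hl.2, hv⟩⟩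
    · by_cases hl' : l ≤ j + 1
      · exact ⟨(K l)ᶜ, (K.isCompact l).isClosed.isOpen_compl, fun hxl => hl ⟨hl', hxl⟩,
          fun _ => Or.inr Subset.rfl⟩
      · exact ⟨univ, isOpen_univ, mem_univ x, fun h => absurd h hl'⟩
  choose W hW hxW hWl using hW
  refine ⟨interior (K (j + 1)) ∩ ⋂ l ∈ Finset.range (j + 2), W l,
    isOpen_interior.inter (isOpen_biInter_finset fun l _ => hW l),
    ⟨K.subset_interior_succ j hx.2, mem_iInter₂.2 fun l _ => hxW l⟩,
    vanishesOn_of_simplices fun m σ hσ => ?_⟩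
  have hJ : J ⟨m, σ⟩ ≤ j + 1 := Nat.find_min' _ fun t => (hσ t).1
  have hJs : ∀ t, σ t ∈ interior (K (J ⟨m, σ⟩)) := Nat.find_spec (hex ⟨m, σ⟩)
  have hσW : ∀ t, σ t ∈ W (J ⟨m, σ⟩) := fun t =>
    mem_iInter₂.1 (hσ t).2 _ (Finset.mem_range.2 (by omega))
  rw [LinearMap.sub_apply, Finsupp.linearCombination_single, one_smul]
  rcases hWl _ hJ with ⟨-, hv⟩ | hK
  · exact hv _ (single_mem_totIn hσW 1)
  · exact absurd (interior_subset (hJs (Classical.arbitrary _)))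
      (hK (hσW (Classical.arbitrary _)))

/-- A diagonal sequence for sequences of chains that agree to a growing extent. -/
theorem exists_sub_mem_evOut {C : Set M} (hC : IsClosed C) [T2Space M] {c : ℕ → ℕ → Tot M}
    (h : ∀ i j, i ≤ j → c j - c i ∈ evOut K (C ∩ K i)) :
    ∃ e, ∀ j, e - c j ∈ evOut K (C ∩ K j) := by
  have hcpt : ∀ j, IsCompact (C ∩ K j) := fun j => (K.isCompact j).inter_left hC
  have h1 : ∀ l, ∃ t, ∀ i ≥ t, ∀ j ≤ l, c l i - c j i ∈ totIn (C ∩ K j)ᶜ := by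
    intro l
    have := (Filter.eventually_all_finset (Finset.range (l + 1))).2 fun j hj =>
      (mem_evOut_iff_of_isCompact (hcpt j)).1 (h j l (by
        have := Finset.mem_range.1 hj
        omega))
    obtain ⟨t, ht⟩ := Filter.eventually_atTop.1 this
    exact ⟨t, fun i hi j hj => ht i hi j (Finset.mem_range.2 (by omega))⟩
  choose t ht using h1
  -- The diagonal moves to level l only at indices from which on `c l` agrees with all earlier
  -- sequences over their compact sets.
  let J : ℕ → ℕ := fun i => Nat.findGreatest (fun l => t l ≤ i) i
  refine ⟨fun i => c (J i) i, fun j => (mem_evOut_iff_of_isCompact (hcpt j)).2 ?_⟩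
  filter_upwards [Filter.eventually_ge_atTop (t j), Filter.eventually_ge_atTop j] with i hi hij
  have hJ : t (J i) ≤ i := Nat.findGreatest_spec (P := fun l => t l ≤ i) hij hi
  exact ht _ i hJ j (Nat.le_findGreatest hij hi)

/-- Local duality: the cone of the cap product is acyclic near every closed set. -/
theorem exists_sub_coneBd_mem [T2Space M] {n : ℕ} [ChartedSpace (EuclideanSpace ℝ (Fin n)) M]
    (H : DualSystem K μ ν) {C : Set M} (hC : IsClosed C) {v : Telescope M}
    (hv : coneBd μ ν v ∈ coneNull K C) : ∃ u, v - coneBd μ ν u ∈ coneNull K C := by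
  have hcpt : ∀ j, IsCompact (C ∩ K j) := fun j => (K.isCompact j).inter_left hC
  have hcj : ∀ (j : ℕ) (w : Telescope M), coneBd μ ν w ∈ coneNull K (C ∩ K j) →
      ∃ u, w - coneBd μ ν u ∈ coneNull K (C ∩ K j) := fun j w hw =>
    (compactInduction_coneBd (n := n) H).all (n := n) (hcpt j) hw
  choose u hu using fun j => hcj j v (coneNull_anti inter_subset_left hv)
  have hmono : ∀ {i j}, i ≤ j → C ∩ K i ⊆ C ∩ K j := fun h =>
    inter_subset_inter_right _ (K.subset h)
  have hdu : ∀ j, coneBd μ ν (u (j + 1) - u j) ∈ coneNull K (C ∩ K j) := fun j => by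
    have := sub_mem (hu j) (coneNull_anti (hmono (Nat.le_succ j)) (hu (j + 1)))
    rwa [sub_sub_sub_cancel_left, ← map_sub] at this
  choose z hz using fun j => hcj j _ (hdu j)
  -- Consecutive solutions differ by a cycle over C ∩ K j, which is a boundary there by the compact
  -- case. Subtracting the accumulated boundaries makes the solutions compatible without spoiling
  -- them, as `coneBd` applied twice is negligible.
  let u' : ℕ → Telescope M := fun j => u j - coneBd μ ν (∑ l ∈ Finset.range j, z l)
  have hu' : ∀ j, v - coneBd μ ν (u' j) ∈ coneNull K (C ∩ K j) := fun j => by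
    simp only [u', map_sub (coneBd μ ν) (u j), ← sub_add]
    exact add_mem (hu j) (coneBd_coneBd_mem H _ _)
  have hdiff : ∀ i j, i ≤ j → u' j - u' i ∈ coneNull K (C ∩ K i) := by
    intro i j hij
    induction j, hij using Nat.le_induction with
    | base => rw [sub_self]; exact zero_mem _
    | succ j hij ih =>
      have e : u' (j + 1) - u' i = (u (j + 1) - u j - coneBd μ ν (z j)) + (u' j - u' i) := by
        simp only [u', Finset.sum_range_succ, map_add]
        abel
      rw [e]
      exact add_mem (coneNull_anti (hmono hij) (hz j)) ih
  clear_value u'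
  obtain ⟨φ, hφ⟩ := exists_sub_mem_locZero (fun i j hij => (hdiff i j hij).1)
  obtain ⟨c, hc⟩ := exists_sub_mem_evOut hC (c := fun j => (u' j).2.1)
    (fun i j hij => (hdiff i j hij).2.1)
  obtain ⟨h, hh⟩ := exists_sub_mem_evOut hC (c := fun j => (u' j).2.2)
    (fun i j hij => (hdiff i j hij).2.2)
  refine ⟨(φ, c, h), mem_coneNull_of_forall_inter fun j => ?_⟩
  have h1 : ((φ, c, h) : Telescope M) - u' j ∈ coneNull K (C ∩ K j) := ⟨hφ j, hc j, hh j⟩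
  have e : v - coneBd μ ν (φ, c, h) =
      (v - coneBd μ ν (u' j)) - coneBd μ ν ((φ, c, h) - u' j) := by
    rw [map_sub]; abel
  rw [e]
  exact sub_mem (hu' j) (coneBd_mem H (hcpt j).isClosed h1)

end Closed

/-! ### Tails of A, and separating the two families of ends. -/

section Separation

variable {M : Type u} [TopologicalSpace M]

theorem totIn_union_le {U V : Set M} (hU : IsOpen U) (hV : IsOpen V) (hd : Disjoint U V) :
    totIn (U ∪ V) ≤ totIn U ⊔ totIn V := totIn_le fun _ _ hσ => by
  rcases simplex_mem_or hU hV hd Subset.rfl hσ with h | h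
  · exact Submodule.mem_sup_left (single_mem_totIn h 1)
  · exact Submodule.mem_sup_right (single_mem_totIn h 1)

/-- No simplex lies in both U and V, so nothing in x can cancel against y. -/
theorem mem_totIn_of_add_mem {U V S : Set M} (hd : Disjoint U V) {x y : Tot M}
    (hx : x ∈ totIn U) (hy : y ∈ totIn V) (h : x + y ∈ totIn S) : x ∈ totIn S := by
  refine (Finsupp.mem_supported' ℤ _).2 fun s hs => ?_
  have h1 : x s + y s = 0 := (Finsupp.mem_supported' ℤ _).1 h s hs
  by_cases hU : ∀ t, s.2 t ∈ U
  · rwa [(Finsupp.mem_supported' ℤ _).1 hy s (not_disjoint_simplex hd hU), add_zero] at h1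
  · exact (Finsupp.mem_supported' ℤ _).1 hx s hU

/-- Beyond the level `i₀` the sets `A` and `B` separate the ends. -/
def SeparatedFrom (K : CompactExhaustion M) (A B : Set M) (i₀ : ℕ) : Prop :=
  ∀ i ≥ i₀, IsOpen (A \ K i) ∧ IsOpen (B \ K i) ∧ Disjoint (A \ K i) (B \ K i) ∧ (K i)ᶜ ⊆ A ∪ B

variable {K : CompactExhaustion M} {A B : Set M} {i₀ : ℕ}

/-- The part of `A` outside the interior of `K i`. -/
def tail (K : CompactExhaustion M) (A : Set M) (i : ℕ) : Set M := A \ interior (K i)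

theorem tail_anti {i j : ℕ} (h : i ≤ j) : tail K A j ⊆ tail K A i :=
  sdiff_subset_sdiff_right (interior_mono (K.subset h))

theorem tail_subset {i l : ℕ} (h : l < i) : tail K A i ⊆ A \ K l := fun _ hx =>
  ⟨hx.1, fun hK => hx.2 (interior_mono (K.subset h) (K.subset_interior_succ l hK))⟩

theorem diff_subset_tail (i : ℕ) : A \ K i ⊆ tail K A i := fun _ hx =>
  ⟨hx.1, fun h => hx.2 (interior_subset h)⟩

theorem interior_subset_compl_tail (i : ℕ) : interior (K i) ⊆ (tail K A i)ᶜ := fun _ hx h => h.2 hx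

theorem disjoint_compl_tail {i j : ℕ} (h : i ≤ j) : Disjoint (tail K A i)ᶜ (A \ K j) :=
  Set.disjoint_left.2 fun _ hx hx' => hx (diff_subset_tail i ⟨hx'.1, fun h' =>
    hx'.2 (K.subset h h')⟩)

theorem compl_tail_inter_subset (i j : ℕ) :
    (tail K A i ∩ K j)ᶜ ⊆ (tail K A i)ᶜ ∪ (A \ K j) := fun x hx => by
  by_cases h : x ∈ tail K A i
  · exact Or.inr ⟨h.1, fun h' => hx ⟨h, h'⟩⟩
  · exact Or.inl h

namespace SeparatedFrom

variable (hAB : SeparatedFrom K A B i₀)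

include hAB

theorem diff_subset_compl_tail {i : ℕ} (h : i₀ < i) : B \ K i₀ ⊆ (tail K A i)ᶜ := fun _ hx h' =>
  Set.disjoint_left.1 (hAB i₀ le_rfl).2.2.1 (tail_subset h h') hx

theorem compl_subset {i : ℕ} (h : i₀ ≤ i) : (K i)ᶜ ⊆ A \ K i ∪ B \ K i := fun _ hx =>
  ((hAB i h).2.2.2 hx).imp (fun h => ⟨h, hx⟩) (fun h => ⟨h, hx⟩)

theorem compl_tail_inter_compl_subset {i j : ℕ} (h : i₀ < i) (hij : i ≤ j) :
    (tail K A i)ᶜ ∩ (K j)ᶜ ⊆ B \ K j := fun _ hx =>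
  (hAB.compl_subset (h.le.trans hij) hx.2).resolve_left fun h' =>
    Set.disjoint_left.1 (disjoint_compl_tail hij) hx.1 h'

theorem compl_tail_eq {i : ℕ} (h : i₀ < i) : (tail K A i)ᶜ = interior (K i) ∪ B \ K i₀ := by
  refine Subset.antisymm (fun x hx => ?_)
    (union_subset (interior_subset_compl_tail i) (hAB.diff_subset_compl_tail h))
  by_cases hxi : x ∈ interior (K i)
  · exact Or.inl hxi
  · have hxK : x ∈ (K i₀ : Set M)ᶜ := fun h' =>
      hxi (interior_mono (K.subset h) (K.subset_interior_succ i₀ h'))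
    exact Or.inr ((hAB.compl_subset le_rfl hxK).resolve_left fun h' => hx ⟨h'.1, hxi⟩)

/-- By separation the complement consists of the interior of K i and of B far out, both open. Local
duality is thereby available for tails of A. -/
theorem isClosed_tail {i : ℕ} (h : i₀ < i) : IsClosed (tail K A i) := by
  rw [← isOpen_compl_iff, hAB.compl_tail_eq h]
  exact isOpen_interior.union (hAB i₀ le_rfl).2.1

theorem capTot_mem {l : ℕ} (hl : i₀ ≤ l) {φ : TotDual M} (hφ : VanishesOn (A \ K l) φ)
    {c : Tot M} (hc : c ∈ totIn (K l)ᶜ) : capTot M c φ ∈ totIn (B \ K l) := by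
  obtain ⟨hA, hB, hd, -⟩ := hAB l hl
  obtain ⟨x, hx, y, hy, rfl⟩ := Submodule.mem_sup.1
    (totIn_union_le hA hB hd (totIn_mono (hAB.compl_subset hl) hc))
  rw [map_add, LinearMap.add_apply, capTot_eq_zero hx hφ, zero_add]
  exact EndsDuality.capTot_mem hy φ

/-- A cochain that is locally zero on a tail of `A`, and a primitive of a cocycle modulo locally
zero cochains, may be changed to a primitive that vanishes on the end of `A`. -/
theorem exists_primitive {i : ℕ} (h : i₀ < i) {φ ψ : TotDual M} (hδ : dDual M φ = 0)
    (hφ : VanishesOn (A \ K i) φ) (hψ : ψ ∈ locZero (tail K A i))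
    (hφψ : φ - dDual M ψ ∈ locZero univ) :
    ∃ ψ', dDual M ψ' = φ ∧ VanishesOn (A \ K i) ψ' ∧ ψ - ψ' ∈ locZero univ := by
  -- Cutting off the simplices in A \ K i changes ψ by a locally zero cochain: ψ is zero near the
  -- tail, and small simplices elsewhere are not in A \ K i. The remaining error is a locally zero
  -- cocycle, whose primitive vanishes wherever it does.
  set w := cut (fun s => ∀ t, s.2 t ∈ A \ K i) ψ with hw
  have hw0 : w ∈ locZero univ := fun x _ => by
    by_cases hx : x ∈ tail K A i
    · exact locZero_cut hψ _ x hx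
    · exact ⟨_, (hAB.isClosed_tail h).isOpen_compl, hx,
        vanishesOn_cut (fun s hs => not_disjoint_simplex (disjoint_compl_tail le_rfl) hs) ψ⟩
  have hv : VanishesOn (A \ K i) (ψ - w) := vanishesOn_sub_cut (fun s hs => hs) ψ
  have hz0 : φ - dDual M (ψ - w) ∈ locZero univ := by
    rw [map_sub, ← sub_add]
    exact add_mem hφψ (dDual_mem_locZero hw0)
  obtain ⟨y, hy0, hy, hyv⟩ := exists_dDual_eq_of_locZero hz0 (by rw [map_sub, hδ, dDual_dDual,
    sub_zero])
  refine ⟨ψ - w + y, ?_, hv.add (hyv _ (hφ.sub hv.dDual)), ?_⟩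
  · rw [map_add, hy]
    abel
  · rw [sub_add_eq_sub_sub, sub_sub_cancel]
    exact sub_mem hw0 hy0

end SeparatedFrom

end Separation

/-! ### Caps with a chain and with its subdivisions. -/

section Comparison

variable {M : Type u} [TopologicalSpace M] {K : CompactExhaustion M} {n : ℕ}
  {a : ℕ → Chain ℤ M n}

theorem capTot_sd_pow {φ : TotDual M} (hφ : dDual M φ = 0) (c : Tot M) (i : ℕ) :
    capTot M ((sd M ^ i) c) φ = capTot M c φ - dTot M (capTot M (sdHtPow M i c) (sgnDual M φ)) -
      capTot M (sdHtPow M i (dTot M c)) φ := by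
  rw [dTot_capTot, sgnDual_sgnDual, dDual_sgnDual, hφ, map_zero, neg_zero, map_zero, sub_zero,
    dTot_sdHtPow, map_sub, map_sub, LinearMap.sub_apply, LinearMap.sub_apply]
  abel

/-- The new summand is minus the connecting chain `ν i` of the dual system. So the correction terms
for subdivision fit into the telescope, up to chains far out. -/
theorem sdHtPow_succ_sub (c c' : Tot M) (i : ℕ) :
    sdHtPow M (i + 1) c' - sdHtPow M i c = sdHt M ((sd M ^ i) c) + sdHtPow M (i + 1) (c' - c) := by
  rw [map_sub, sdHtPow_apply (i + 1) c, Finset.sum_range_succ, ← sdHtPow_apply]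
  abel

theorem FundamentalSequence.sub_mem_of_le [T2Space M]
    [ChartedSpace (EuclideanSpace ℝ (Fin n)) M] (ha : FundamentalSequence K a) {i j : ℕ}
    (hij : i ≤ j) : ofDeg M n (a j) - ofDeg M n (a i) ∈ totIn (K i)ᶜ := by
  induction j, hij using Nat.le_induction with
  | base => rw [sub_self]; exact zero_mem _
  | succ j hij ih =>
    rw [← sub_add_sub_cancel _ (ofDeg M n (a j)), ← map_sub]
    exact add_mem (totIn_mono (compl_subset_compl.2 (K.subset hij)) (ha.sub_mem j)) ih

end Comparison

/-! ### Duality at the ends, in all degrees at once. -/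

section EndsTotal

/-- For the inverse limit, g (j + 1) - g j must lie in S j exactly. Sampling y along increasing
thresholds achieves this up to the boundaries of the f in between, and these boundaries can be
subtracted because only d (g j) is prescribed. -/
theorem exists_telescope {M : Type u} [TopologicalSpace M] {S : ℕ → Set M}
    {x y f : ℕ → Tot M} (h₁ : ∀ j, ∀ᶠ i in Filter.atTop, x i - dTot M (y i) ∈ totIn (S j))
    (h₂ : ∀ j, ∀ᶠ i in Filter.atTop, y (i + 1) - y i - dTot M (f i) ∈ totIn (S j)) :
    ∃ g : ℕ → Tot M, (∀ j, g (j + 1) - g j ∈ totIn (S j)) ∧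
      ∀ j, ∀ᶠ i in Filter.atTop, x i - dTot M (g j) ∈ totIn (S j) := by
  choose t ht using fun j => Filter.eventually_atTop.1 ((h₁ j).and (h₂ j))
  let I : ℕ → ℕ := fun j => (Finset.range (j + 1)).sup t
  have hI : Monotone I := fun i j hij => Finset.sup_mono (Finset.range_mono (by omega))
  have hIt : ∀ j, t j ≤ I j := fun j => Finset.le_sup (Finset.mem_range.2 (Nat.lt_succ_self j))
  have hsum : ∀ j p q, I j ≤ p → p ≤ q →
      y q - y p - dTot M (∑ i ∈ Finset.Ico p q, f i) ∈ totIn (S j) := by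
    intro j p q hp hq
    induction q, hq using Nat.le_induction with
    | base => simp
    | succ q hq ih =>
      have e : y (q + 1) - y p - dTot M (∑ i ∈ Finset.Ico p (q + 1), f i) =
          (y q - y p - dTot M (∑ i ∈ Finset.Ico p q, f i)) + (y (q + 1) - y q - dTot M (f q)) := by
        rw [Finset.sum_Ico_succ_top hq, map_add]
        abel
      rw [e]
      exact add_mem ih (ht j q ((hIt j).trans (hp.trans hq))).2
  refine ⟨fun j => y (I j) - dTot M (∑ i ∈ Finset.Ico (I 0) (I j), f i), fun j => ?_, fun j => ?_⟩
  · have h := hsum j (I j) (I (j + 1)) le_rfl (hI (Nat.le_succ j))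
    beta_reduce
    rw [← Finset.sum_Ico_consecutive f (hI (Nat.zero_le j)) (hI (Nat.le_add_right j 1)), map_add]
    convert h using 1
    abel
  · filter_upwards [Filter.eventually_ge_atTop (I j)] with i hi
    have h := dTot_mem (hsum j (I j) i le_rfl hi)
    rw [map_sub, map_sub, dTot_dTot, sub_zero] at h
    rw [map_sub, dTot_dTot, sub_zero]
    convert add_mem (ht j i ((hIt j).trans hi)).1 h using 1
    abel

variable {M : Type u} [TopologicalSpace M] {K : CompactExhaustion M} {A B : Set M} {i₀ : ℕ}

theorem sub_mem_of_succ {S : ℕ → Set M} (hS : Antitone S) {b : ℕ → Tot M}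
    (hb : ∀ j, b (j + 1) - b j ∈ totIn (S j)) {i j : ℕ} (hij : i ≤ j) :
    b j - b i ∈ totIn (S i) := by
  induction j, hij using Nat.le_induction with
  | base => rw [sub_self]; exact zero_mem _
  | succ j hij ih =>
    rw [← sub_add_sub_cancel _ (b j)]
    exact add_mem (totIn_mono (hS hij) (hb j)) ih

theorem antitone_diff (K : CompactExhaustion M) (B : Set M) : Antitone fun j => B \ K j :=
  fun _ _ h => diff_subset_diff_of_le K B h

theorem mem_evOut_of_mem_compl {c : ℕ → Tot M} {C : Set M}
    (h : ∀ᶠ i in Filter.atTop, c i ∈ totIn Cᶜ) : c ∈ evOut K C := fun _ =>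
  h.mono fun _ hi => totIn_mono (compl_subset_compl.2 inter_subset_left) hi

/-- From index i₀ on the chains change only inside B beyond K i₀, and the chain at i₀ has compact
support, so one tail of A is avoided by all of them. -/
theorem SeparatedFrom.exists_mem_compl_tail (hAB : SeparatedFrom K A B i₀) {b : ℕ → Tot M}
    (hb : ∀ j, b (j + 1) - b j ∈ totIn (B \ K j)) :
    ∃ i₁ > i₀, ∀ i' ≥ i₁, ∀ i ≥ i₀, b i ∈ totIn (tail K A i')ᶜ := by
  obtain ⟨Q, hQ, hQb⟩ := exists_isCompact_mem_totIn (b i₀)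
  obtain ⟨j, hj⟩ := K.exists_superset_of_isCompact hQ
  refine ⟨max (j + 1) (i₀ + 1), lt_of_lt_of_le (Nat.lt_succ_self i₀) (le_max_right _ _),
    fun i' hi' i hi => ?_⟩
  have hji : j < i' := (le_max_left _ _).trans hi'
  have hli : i₀ < i' := (le_max_right (j + 1) (i₀ + 1)).trans hi'
  rw [← sub_add_cancel (b i) (b i₀)]
  refine add_mem (totIn_mono (hAB.diff_subset_compl_tail hli)
    (sub_mem_of_succ (antitone_diff K B) hb hi)) (totIn_mono ?_ hQb)
  exact (hj.trans ((K.subset_interior_succ j).trans (interior_mono (K.subset hji)))).trans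
      (interior_subset_compl_tail i')

/-- The relative complex is the kernel of the map from the cone over M to the cone over C. Both are
acyclic, and the solution over M is corrected by one over C. -/
theorem exists_sub_coneBd_mem_relative [T2Space M] {n : ℕ}
    [ChartedSpace (EuclideanSpace ℝ (Fin n)) M] {μ ν : ℕ → Tot M} (H : DualSystem K μ ν) {C : Set M} (hC : IsClosed C)
    {v : Telescope M} (hv : v ∈ coneNull K C) (hdv : coneBd μ ν v ∈ coneNull K univ) :
    ∃ u ∈ coneNull K C, v - coneBd μ ν u ∈ coneNull K univ := by
  obtain ⟨u₀, hu₀⟩ := exists_sub_coneBd_mem (n := n) H isClosed_univ hdv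
  have h1 : coneBd μ ν u₀ ∈ coneNull K C := by
    have := sub_mem hv (coneNull_anti (subset_univ C) hu₀)
    rwa [sub_sub_cancel] at this
  obtain ⟨w, hw⟩ := exists_sub_coneBd_mem (n := n) H hC h1
  refine ⟨_, hw, ?_⟩
  rw [map_sub, ← sub_add]
  exact add_mem hu₀ (coneBd_coneBd_mem H _ w)

variable [T2Space M] {n : ℕ} [ChartedSpace (EuclideanSpace ℝ (Fin n)) M] {a : ℕ → Chain ℤ M n}

/-- Beyond K l the cap lands in B, and the remaining chain `a l` has compact support. The bound is
uniform in i and in support-preserving operators f, so it covers the subdivision homotopies. -/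
theorem SeparatedFrom.exists_capTot_mem (hAB : SeparatedFrom K A B i₀)
    (ha : FundamentalSequence K a) {l : ℕ} (hl : i₀ ≤ l) {φ : TotDual M}
    (hφ : VanishesOn (A \ K l) φ) : ∃ i₁ > l, ∀ i' ≥ i₁, ∀ f : Tot M →ₗ[ℤ] Tot M,
      (∀ U : Set M, ∀ c ∈ totIn U, f c ∈ totIn U) → ∀ i ≥ l,
        capTot M (f (ofDeg M n (a i))) φ ∈ totIn (tail K A i')ᶜ := by
  obtain ⟨Q, hQ, hQa⟩ := exists_isCompact_mem_totIn (ofDeg M n (a l))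
  obtain ⟨j, hj⟩ := K.exists_superset_of_isCompact hQ
  refine ⟨max (j + 1) (l + 1), lt_of_lt_of_le (Nat.lt_succ_self l) (le_max_right _ _),
    fun i' hi' f hf i hi => ?_⟩
  have hji : j < i' := (le_max_left _ _).trans hi'
  have hli : i₀ < i' := lt_of_le_of_lt hl ((le_max_right (j + 1) (l + 1)).trans hi')
  have h1 := hf _ _ hQa
  have h2 := hf _ _ (ha.sub_mem_of_le hi)
  have e : f (ofDeg M n (a i)) = f (ofDeg M n (a i) - ofDeg M n (a l)) + f (ofDeg M n (a l)) := by
    rw [map_sub, sub_add_cancel]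
  rw [e, map_add, LinearMap.add_apply]
  refine add_mem (totIn_mono ?_ (hAB.capTot_mem hl hφ h2)) (totIn_mono ?_
    (EndsDuality.capTot_mem h1 φ))
  · exact (diff_subset_diff_of_le K B hl).trans (hAB.diff_subset_compl_tail hli)
  · exact (hj.trans ((K.subset_interior_succ j).trans (interior_mono (K.subset hji)))).trans
      (interior_subset_compl_tail i')

/-- Injectivity: φ together with the chains bounded by its caps is a cone cycle that is negligible
near a tail of A, so relative duality writes it as a boundary, whose cochain part is a primitive of
φ up to locally zero terms. -/
theorem SeparatedFrom.exists_dDual_eq (hAB : SeparatedFrom K A B i₀) (ha : FundamentalSequence K a)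
    {φ : TotDual M} (hδ : dDual M φ = 0) {l : ℕ} (hφ : VanishesOn (A \ K l) φ) {g : ℕ → Tot M}
    (hg : ∀ j, g (j + 1) - g j ∈ totIn (B \ K j))
    (h : ∀ j, ∀ᶠ i in Filter.atTop,
      capTot M (ofDeg M n (a i)) φ - dTot M (g j) ∈ totIn (B \ K j)) :
    ∃ ψ, dDual M ψ = φ ∧ ∃ i, VanishesOn (A \ K i) ψ := by
  have hll : i₀ ≤ max i₀ l := le_max_left _ _
  replace hφ : VanishesOn (A \ K (max i₀ l)) φ :=
    hφ.mono (diff_subset_diff_of_le K A (le_max_right _ _))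
  generalize max i₀ l = l at hll hφ
  obtain ⟨i₁, hi₁l, hi₁⟩ := hAB.exists_capTot_mem ha hll hφ.sgnDual
  obtain ⟨i₂, hi₂, hgt⟩ := hAB.exists_mem_compl_tail hg
  set i' := max i₁ i₂ with hi'
  have h0i' : i₀ < i' := lt_of_lt_of_le hi₂ (le_max_right _ _)
  have hli' : l < i' := lt_of_lt_of_le hi₁l (le_max_left _ _)
  set α : ℕ → Tot M := fun i => ofDeg M n (a i) with hα
  have H := dualSystem_of_fundamentalSequence ha
  -- The hypothesis concerns the chains `a i`, the dual system their subdivisions; t bounds the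
  -- difference of the two caps, up to chains far out.
  let t : ℕ → Tot M := fun i => capTot M (sdHtPow M i (α i)) (sgnDual M φ)
  have hv : ((φ, t - g, 0) : Telescope M) ∈ coneNull K (tail K A i') := by
    refine ⟨hφ.mem_locZero (hAB l hll).1 (tail_subset hli'), mem_evOut_of_mem_compl ?_, zero_mem _⟩
    filter_upwards [Filter.eventually_ge_atTop l, Filter.eventually_ge_atTop i₀] with i hi hi0
    exact sub_mem (hi₁ i' (le_max_left _ _) _ (fun U c hc => sdHtPow_mem hc i) i hi)
      (hgt i' (le_max_right _ _) i hi0)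
  obtain ⟨u, hu, huv⟩ := exists_sub_coneBd_mem_relative (n := n) H (hAB.isClosed_tail h0i') hv (by
    refine ⟨?_, ?_, ?_⟩
    · change dDual M φ ∈ _
      rw [hδ]
      exact zero_mem _
    · refine fun j => ?_
      filter_upwards [h j, Filter.eventually_ge_atTop j] with i hi hij
      change capTot M ((sd M ^ i) (α i)) φ + dTot M (t i - g i) ∈ _
      have e : capTot M ((sd M ^ i) (α i)) φ + dTot M (t i - g i) =
          (capTot M (α i) φ - dTot M (g j)) - dTot M (g i - g j) -
            capTot M (sdHtPow M i (dTot M (α i))) φ := by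
        rw [capTot_sd_pow hδ, map_sub, map_sub]
        abel
      rw [e, univ_inter]
      have hsub : B \ K j ⊆ (K j : Set M)ᶜ := fun x hx => hx.2
      refine sub_mem (sub_mem (totIn_mono hsub hi) (totIn_mono hsub
        (dTot_mem (sub_mem_of_succ (antitone_diff K B) hg hij)))) ?_
      exact totIn_mono (compl_subset_compl.2 (K.subset hij))
        (EndsDuality.capTot_mem (sdHtPow_mem (ha.dTot_mem i) i) φ)
    · refine mem_evOut_of_compl fun i => ?_
      change capTot M (-sdHt M ((sd M ^ i) (α i))) (sgnDual M φ) + (t (i + 1) - g (i + 1)) -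
        (t i - g i) - dTot M 0 ∈ _
      have e : capTot M (-sdHt M ((sd M ^ i) (α i))) (sgnDual M φ) + (t (i + 1) - g (i + 1)) -
          (t i - g i) - dTot M 0 = capTot M (sdHtPow M (i + 1) (α (i + 1) - α i)) (sgnDual M φ) -
          (g (i + 1) - g i) := by
        have h1 := congrArg (fun c => capTot M c (sgnDual M φ))
          (sdHtPow_succ_sub (α i) (α (i + 1)) i)
        simp only [map_sub, map_add, LinearMap.sub_apply, LinearMap.add_apply] at h1
        simp only [map_sub, map_neg, LinearMap.sub_apply, LinearMap.neg_apply, map_zero, t]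
        rw [← sub_eq_iff_eq_add'.2 h1]
        abel
      rw [e]
      exact sub_mem (EndsDuality.capTot_mem (sdHtPow_mem
        (ha.sub_mem_of_le (Nat.le_succ i)) _) _) (totIn_mono (fun x hx => hx.2) (hg i)))
  obtain ⟨ψ, hψ, hψv, -⟩ := hAB.exists_primitive h0i' hδ
    (hφ.mono (diff_subset_diff_of_le K A hli'.le)) hu.1 huv.1
  exact ⟨ψ, hψ, i', hψv⟩

/-- Surjectivity: the sequence b with zero cochain is a relative cone cycle. A chain bounding it has
as its cochain part the class sought, and as its sequences the homotopy between b and the caps. -/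
theorem SeparatedFrom.exists_capTot_eq (hAB : SeparatedFrom K A B i₀)
    (ha : FundamentalSequence K a) {b : ℕ → Tot M} (hb : ∀ j, b (j + 1) - b j ∈ totIn (B \ K j))
    (hdb : ∀ j, dTot M (b j) ∈ totIn (B \ K j)) :
    ∃ φ, dDual M φ = 0 ∧ (∃ l, VanishesOn (A \ K l) φ) ∧ ∃ g : ℕ → Tot M,
      (∀ j, g (j + 1) - g j ∈ totIn (B \ K j)) ∧ ∀ j, ∀ᶠ i in Filter.atTop,
        b i - capTot M (ofDeg M n (a i)) φ - dTot M (g j) ∈ totIn (B \ K j) := by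
  obtain ⟨i₁, hi₁, hbt⟩ := hAB.exists_mem_compl_tail hb
  set α : ℕ → Tot M := fun i => ofDeg M n (a i) with hα
  have hout : ∀ {c : ℕ → Tot M}, (∀ i, c i ∈ totIn (B \ K i)) → c ∈ evOut K univ := fun h =>
    mem_evOut_of_compl fun i => totIn_mono (fun x hx => hx.2) (h i)
  obtain ⟨⟨φ, c, h⟩, hu, huv⟩ := exists_sub_coneBd_mem_relative (n := n)
    (dualSystem_of_fundamentalSequence ha) (hAB.isClosed_tail hi₁) (v := (0, b, 0))
    ⟨zero_mem _, mem_evOut_of_mem_compl ((Filter.eventually_ge_atTop i₀).mono fun i hi =>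
      hbt i₁ le_rfl i hi), zero_mem _⟩ (by
      refine ⟨?_, hout fun i => ?_, hout fun i => ?_⟩
      · change dDual M 0 ∈ _
        rw [map_zero]
        exact zero_mem _
      · change capTot M _ 0 + dTot M (b i) ∈ _
        rw [map_zero, zero_add]
        exact hdb i
      · change capTot M _ (sgnDual M 0) + b (i + 1) - b i - dTot M 0 ∈ _
        rw [map_zero, map_zero, map_zero, zero_add, sub_zero]
        exact hb i)
  -- With the zero cocycle as target, this changes φ by a locally zero cochain into an honest
  -- cocycle vanishing on A far out.
  obtain ⟨φ', hδ, hφ', hφφ⟩ := hAB.exists_primitive hi₁ (φ := 0) (map_zero _)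
    (fun _ _ => rfl) hu.1 huv.1
  have hm : ((φ - φ', 0, 0) : Telescope M) ∈ coneNull K univ := ⟨hφφ, zero_mem _, zero_mem _⟩
  have hw := add_mem huv (coneBd_mem (dualSystem_of_fundamentalSequence ha) isClosed_univ hm)
  have e0 : ((φ, c, h) : Telescope M) = (φ - φ', 0, 0) + (φ', c, h) := by simp
  rw [e0, map_add, sub_add_eq_sub_sub, sub_right_comm, sub_add_cancel] at hw
  obtain ⟨i₂, hi₂, hat⟩ := hAB.exists_capTot_mem ha hi₁.le hφ'.sgnDual
  obtain ⟨i₃, hi₃, hat'⟩ := hAB.exists_capTot_mem ha hi₁.le hφ'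
  set i' := max i₂ i₃ with hi'
  have h1i' : i₁ < i' := lt_of_lt_of_le hi₂ (le_max_left _ _)
  have h0i' : i₀ < i' := hi₁.trans h1i'
  let t : ℕ → Tot M := fun i => capTot M (sdHtPow M i (α i)) (sgnDual M φ')
  have hp : (fun i => b i - capTot M (α i) φ' - dTot M (c i - t i)) ∈ evOut K univ := by
    have h1 : (fun i => capTot M (sdHtPow M i (dTot M (α i))) φ') ∈ evOut K univ :=
      mem_evOut_of_compl fun i => EndsDuality.capTot_mem (sdHtPow_mem (ha.dTot_mem i) i) φ'
    refine (congrArg (· ∈ evOut K univ) (funext fun i => ?_)).mp (sub_mem hw.2.1 h1)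
    change b i - (capTot M ((sd M ^ i) (α i)) φ' + dTot M (c i)) - _ = _
    rw [capTot_sd_pow hδ, map_sub]
    abel
  have hq : (fun i => c (i + 1) - t (i + 1) - (c i - t i) - dTot M (h i)) ∈ evOut K univ := by
    have h1 : (fun i => capTot M (sdHtPow M (i + 1) (α (i + 1) - α i)) (sgnDual M φ')) ∈
        evOut K univ := mem_evOut_of_compl fun i =>
      EndsDuality.capTot_mem (sdHtPow_mem (ha.sub_mem_of_le (Nat.le_succ i)) _) _
    refine (congrArg (· ∈ evOut K univ) (funext fun i => ?_)).mp
      (neg_mem (add_mem hw.2.2 h1))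
    change -(0 - (capTot M (-sdHt M ((sd M ^ i) (α i))) (sgnDual M φ') + c (i + 1) - c i -
      dTot M (h i)) + capTot M (sdHtPow M (i + 1) (α (i + 1) - α i)) (sgnDual M φ')) = _
    have h2 := congrArg (fun c => capTot M c (sgnDual M φ')) (sdHtPow_succ_sub (α i) (α (i + 1)) i)
    simp only [map_sub, map_add, LinearMap.sub_apply, LinearMap.add_apply] at h2
    simp only [map_sub, map_neg, LinearMap.sub_apply, LinearMap.neg_apply, t]
    rw [← sub_eq_iff_eq_add'.2 h2]
    abel
  -- split off the parts in the end of `A`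
  have hi₁i' : tail K A i' ⊆ tail K A i₁ := tail_anti h1i'.le
  have hsplit : ∀ {x : ℕ → Tot M}, x ∈ evOut K (tail K A i') → ∃ y z : ℕ → Tot M, y + z = x ∧
      (∀ᶠ i in Filter.atTop, y i ∈ totIn (tail K A i')ᶜ) ∧
      ∀ᶠ i in Filter.atTop, z i ∈ totIn (A \ K i') := fun hx =>
    exists_add_of_eventually_mem_sup ((hx i').mono fun i hi => totIn_union_le
      (hAB.isClosed_tail h0i').isOpen_compl (hAB i' h0i'.le).1 (disjoint_compl_tail le_rfl)
      (totIn_mono (compl_tail_inter_subset i' i') hi))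
  have htail : t ∈ evOut K (tail K A i') := mem_evOut_of_mem_compl (by
    filter_upwards [Filter.eventually_ge_atTop i₁] with i hi
    exact hat i' (le_max_left _ _) _ (fun U c hc => sdHtPow_mem hc i) i hi)
  obtain ⟨y, z, hyz, hy, hz⟩ := hsplit (sub_mem (evOut_anti hi₁i' hu.2.1) htail)
  obtain ⟨f, r, hfr, hf, hr⟩ := hsplit (evOut_anti hi₁i' hu.2.2)
  have hshift := Filter.tendsto_add_atTop_nat 1
  -- x lies off the tail and x' in the end of A, so they cannot cancel; if the sum escapes to
  -- infinity then x does so alone, and off the tail of A it can only escape into B.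
  have hout' : ∀ {x x' : ℕ → Tot M}, (∀ᶠ i in Filter.atTop, x i ∈ totIn (tail K A i')ᶜ) →
      (∀ᶠ i in Filter.atTop, x' i ∈ totIn (A \ K i')) → x + x' ∈ evOut K univ →
      ∀ j, ∀ᶠ i in Filter.atTop, x i ∈ totIn (B \ K j) := by
    intro x x' hx hx' h j
    filter_upwards [hx, hx', h (max i' j)] with i h1 h2 h3
    rw [univ_inter] at h3
    have h4 := mem_totIn_inter h1 (mem_totIn_of_add_mem (disjoint_compl_tail le_rfl) h1 h2 h3)
    exact totIn_mono ((hAB.compl_tail_inter_compl_subset h0i' (le_max_left _ _)).trans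
      (diff_subset_diff_of_le K B (le_max_right _ _))) h4
  have hyzi : ∀ i, c i - t i = y i + z i := fun i => (congrFun hyz i).symm
  have hfri : ∀ i, h i = f i + r i := fun i => (congrFun hfr i).symm
  obtain ⟨g, hg, hg'⟩ := exists_telescope (S := fun j => B \ K j)
    (x := fun i => b i - capTot M (α i) φ') (y := y) (f := f)
    (hout' (x' := fun i => -dTot M (z i)) (by
      filter_upwards [hy, Filter.eventually_ge_atTop i₁] with i h1 h2
      refine sub_mem (sub_mem (hbt i' h1i'.le i (hi₁.le.trans h2)) ?_) (dTot_mem h1)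
      exact hat' i' (le_max_right _ _) LinearMap.id (fun U c hc => hc) i h2)
      (hz.mono fun i hi => neg_mem (dTot_mem hi)) (by
      refine (congrArg (· ∈ evOut K univ) (funext fun i => ?_)).mp hp
      simp only [hyzi, map_add, Pi.add_apply]
      abel))
    (hout' (x' := fun i => z (i + 1) - z i - dTot M (r i)) (by
      filter_upwards [hy, hf, hshift.eventually hy] with i h1 h2 h3
      exact sub_mem (sub_mem h3 h1) (dTot_mem h2)) (by
      filter_upwards [hz, hr, hshift.eventually hz] with i h1 h2 h3
      exact sub_mem (sub_mem h3 h1) (dTot_mem h2)) (by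
      refine (congrArg (· ∈ evOut K univ) (funext fun i => ?_)).mp hq
      simp only [hyzi, hfri, map_add, Pi.add_apply]
      abel))
  exact ⟨φ', hδ, ⟨i₁, hφ'⟩, g, hg, hg'⟩

end EndsTotal

/-! ### Homogeneous components of cochains and caps. -/

section Degrees

variable {X : Type u} [TopologicalSpace X]

/-- A cochain of degree `k` as a cochain of the total complex. -/
def ofDualDeg (X : Type u) [TopologicalSpace X] (k : ℕ) (φ : Cochain ℤ X k) : TotDual X :=
  (show Chain ℤ X k →ₗ[ℤ] ℤ from φ) ∘ₗ toDeg X k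

theorem dualDeg_ofDualDeg (k : ℕ) (φ : Cochain ℤ X k) : dualDeg X k (ofDualDeg X k φ) = φ :=
  cochain_ext fun c => congrArg φ (toDeg_ofDeg k c)

theorem dualDeg_ofDualDeg_of_ne {k j : ℕ} (h : j ≠ k) (φ : Cochain ℤ X k) :
    dualDeg X j (ofDualDeg X k φ) = 0 :=
  cochain_ext fun c => (congrArg φ (toDeg_ofDeg_of_ne h c)).trans (map_zero φ)

theorem totDual_ext {φ ψ : TotDual X} (h : ∀ k, dualDeg X k φ = dualDeg X k ψ) : φ = ψ := by
  refine LinearMap.ext fun c => ?_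
  induction c using tot_induction with
  | h0 => simp
  | hadd x y hx hy => rw [map_add, map_add, hx, hy]
  | h n c => exact DFunLike.congr_fun (h n) c

theorem dDual_ofDualDeg {k : ℕ} {φ : Cochain ℤ X k} (h : cobd ℤ X k φ = 0) :
    dDual X (ofDualDeg X k φ) = 0 := by
  refine totDual_ext fun j => ?_
  rw [map_zero]
  rcases j with _ | j
  · exact dualDeg_dDual_zero _
  · rw [dualDeg_dDual_succ]
    by_cases hj : j = k
    · subst hj
      rw [dualDeg_ofDualDeg, h, smul_zero]
    · rw [dualDeg_ofDualDeg_of_ne hj, map_zero, smul_zero]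

theorem vanishesOn_ofDualDeg {U : Set X} {k : ℕ} {φ : Cochain ℤ X k}
    (h : ∀ c ∈ chainsIn ℤ U k, φ c = 0) : VanishesOn U (ofDualDeg X k φ) :=
  fun _ hc => h _ (toDeg_mem hc)

theorem cobd_dualDeg {φ : TotDual X} (h : dDual X φ = 0) (k : ℕ) :
    cobd ℤ X k (dualDeg X k φ) = 0 := by
  have h1 := dualDeg_dDual_succ k φ
  rw [h, map_zero] at h1
  have h2 := congrArg ((-1 : ℤ) ^ k • ·) h1
  simp only [smul_zero, smul_smul, ← mul_pow] at h2
  simpa using h2.symm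

theorem toDeg_capTot {n k m : ℕ} (h : k + m = n) (c : Chain ℤ X n) (φ : TotDual X) :
    toDeg X m (capTot X (ofDeg X n c) φ) = cap h c (dualDeg X k φ) := by
  subst h
  rw [capTot_ofDeg, capDeg_apply, map_sum, Finset.sum_eq_single (⟨k, by omega⟩ : Fin (k + m + 1))]
  · rw [capPart_congr _ (rfl : k + m = k + m) rfl, capPart_apply, toDeg_ofDeg]
  · intro j _ hj
    rw [capPart_apply, toDeg_ofDeg_of_ne]
    intro h
    refine hj (Fin.ext ?_)
    simp only
    omega
  · exact fun h => absurd (Finset.mem_univ _) h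

theorem toDeg_capTot_of_lt {n m : ℕ} (h : n < m) (c : Chain ℤ X n) (φ : TotDual X) :
    toDeg X m (capTot X (ofDeg X n c) φ) = 0 := by
  rw [capTot_ofDeg, capDeg_apply, map_sum]
  refine Finset.sum_eq_zero fun j _ => ?_
  rw [capPart_apply, toDeg_ofDeg_of_ne (by omega)]

theorem capTot_ofDualDeg {n k m : ℕ} (h : k + m = n) (c : Chain ℤ X n) (φ : Cochain ℤ X k) :
    capTot X (ofDeg X n c) (ofDualDeg X k φ) = ofDeg X m (cap h c φ) := by
  subst h
  rw [capTot_ofDeg, capDeg_apply, Finset.sum_eq_single (⟨k, by omega⟩ : Fin (k + m + 1))]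
  · rw [capPart_congr _ (rfl : k + m = k + m) rfl, capPart_apply, dualDeg_ofDualDeg]
  · intro j _ hj
    rw [capPart_apply, dualDeg_ofDualDeg_of_ne (fun h => hj (Fin.ext h)), map_zero, map_zero]
  · exact fun h => absurd (Finset.mem_univ _) h

theorem capTot_ofDualDeg_of_lt {n k : ℕ} (h : n < k) (c : Chain ℤ X n) (φ : Cochain ℤ X k) :
    capTot X (ofDeg X n c) (ofDualDeg X k φ) = 0 := by
  rw [capTot_ofDeg, capDeg_apply]
  refine Finset.sum_eq_zero fun j _ => ?_
  rw [capPart_apply, dualDeg_ofDualDeg_of_ne (by omega), map_zero, map_zero]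

end Degrees

/-! ### Classes at infinity from sequences of chains. -/

section EndsClasses

variable {X : Type u} [TopologicalSpace X] {K : CompactExhaustion X} {V : Set X} {m : ℕ}

theorem exists_representatives (c : EndChain ℤ K V m) : ∃ b : ℕ → Chain ℤ X m,
    (∀ j, (chainsIn ℤ (V \ K j) m).mkQ (b j) = c.1 j) ∧
      ∀ j, ofDeg X m (b (j + 1)) - ofDeg X m (b j) ∈ totIn (V \ K j) := by
  choose b hb using fun j => Submodule.mkQ_surjective _ (c.1 j)
  refine ⟨b, hb, fun j => ?_⟩
  rw [← map_sub, ofDeg_mem_iff]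
  refine (Submodule.Quotient.eq _).1 ?_
  have := c.2 j (j + 1) (Nat.le_succ j)
  rw [← hb, ← hb] at this
  exact this

/-- The differences may be checked with different representatives at each level; only the bounding
chains g have to be compatible between levels. -/
theorem endHomology_mk_eq {c c' : EndChain ℤ K V m} (hc : c ∈ EndCycles ℤ K V m)
    (hc' : c' ∈ EndCycles ℤ K V m) {g : ℕ → Tot X} (hg : ∀ j, g (j + 1) - g j ∈ totIn (V \ K j))
    (h : ∀ j, ∃ x y : Chain ℤ X m, (chainsIn ℤ (V \ K j) m).mkQ x = c.1 j ∧
      (chainsIn ℤ (V \ K j) m).mkQ y = c'.1 j ∧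
      x - y - bd ℤ X m (toDeg X (m + 1) (g j)) ∈ chainsIn ℤ (V \ K j) m) :
    (Submodule.Quotient.mk ⟨c, hc⟩ : EndHomology ℤ K V m) = Submodule.Quotient.mk ⟨c', hc'⟩ := by
  refine (Submodule.Quotient.eq _).2 ⟨⟨_, mem_endChain_of_succ (K := K) (V := V)
    (a := fun j => toDeg X (m + 1) (g j)) fun j => ?_⟩, Subtype.ext (funext fun j => ?_)⟩
  · rw [← map_sub]
    exact toDeg_mem (hg j)
  · obtain ⟨x, y, hx, hy, hxy⟩ := h j
    change (chainsIn ℤ (V \ K j) m).mkQ (bd ℤ X m (toDeg X (m + 1) (g j))) = c.1 j - c'.1 j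
    rw [← hx, ← hy, ← map_sub]
    exact ((Submodule.Quotient.eq _).2 hxy).symm

theorem endCohomology_mk_eq_zero {k : ℕ} {φ : EndCochain ℤ K V k} (hφ : φ ∈ EndCocycles ℤ K V k)
    {ψ : TotDual X} (hψ : dDual X ψ = ofDualDeg X k φ.1) {i : ℕ} (hv : VanishesOn (V \ K i) ψ) :
    (Submodule.Quotient.mk ⟨φ, hφ⟩ : EndCohomology ℤ K V k) = 0 := by
  refine (Submodule.Quotient.mk_eq_zero _).2 ?_
  have h1 : φ.1 = dualDeg X k (dDual X ψ) := by rw [hψ, dualDeg_ofDualDeg]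
  cases k with
  | zero =>
    rw [dualDeg_dDual_zero] at h1
    exact Subtype.ext h1
  | succ k =>
    rw [dualDeg_dDual_succ] at h1
    have hm : dualDeg X k ψ ∈ EndCochain ℤ K V k := ⟨i, fun c hc => hv _ (ofDeg_mem hc)⟩
    refine ⟨(-1 : ℤ) ^ k • ⟨dualDeg X k ψ, hm⟩, Subtype.ext ?_⟩
    rw [map_smul]
    exact h1.symm

end EndsClasses

/-! ### The duality theorem. -/

section Main

variable {M : Type u} [TopologicalSpace M] [T2Space M] {n : ℕ}
  [ChartedSpace (EuclideanSpace ℝ (Fin n)) M] {K : CompactExhaustion M} {A B : Set M}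

/-- The results for the total complex return inhomogeneous cochains and chains. Passing to
components is harmless, as the degree m part of a cap with an n-chain sees only the cochain
component of degree k. -/
theorem capProduct_bijective (hAB : SeparatedAtInfinity K A B) {μ : EndHomology ℤ K univ n}
    (hμ : IsFundamentalClass K μ) {k m : ℕ} (h : k + m = n) :
    Function.Bijective (capProduct hAB h μ : EndCohomology ℤ K A k → EndHomology ℤ K B m) := by
  obtain ⟨⟨c, hc⟩, rfl⟩ := Submodule.Quotient.mk_surjective _ μ
  obtain ⟨a, ha, hac⟩ := exists_fundamentalSequence hc hμ
  obtain ⟨i₀, h₀⟩ := id hAB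
  replace h₀ : SeparatedFrom K A B i₀ := h₀
  constructor
  · refine (injective_iff_map_eq_zero _).2 fun y hy => ?_
    obtain ⟨⟨φ, hφ⟩, rfl⟩ := Submodule.Quotient.mk_surjective _ y
    obtain ⟨e, he⟩ : ∃ e, endBd ℤ K B m e = endCap hAB h c φ :=
      (Submodule.Quotient.mk_eq_zero _).1 hy
    obtain ⟨g, hge, hg⟩ := exists_representatives e
    obtain ⟨l, hl⟩ := φ.2
    obtain ⟨l₀, hl₀⟩ := capFun_eq hAB h c φ
    have hφ0 : cobd ℤ M k φ.1 = 0 := congrArg Subtype.val hφ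
    obtain ⟨ψ, hψ, i, hv⟩ := h₀.exists_dDual_eq ha (dDual_ofDualDeg hφ0)
      (vanishesOn_ofDualDeg hl) hg fun j => by
        filter_upwards [Filter.eventually_ge_atTop l₀, Filter.eventually_ge_atTop j] with i hi hij
        rw [capTot_ofDualDeg h, dTot_ofDeg_succ, ← map_sub, ofDeg_mem_iff]
        refine (Submodule.Quotient.eq _).1 ?_
        have h1 := hl₀ j i hi hij (a i) (hac i)
        have h2 : relBd ℤ (B \ K j) m (e.1 j) = capFun hAB h c φ j :=
          congrFun (congrArg Subtype.val he) j
        rw [← hge, h1] at h2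
        exact h2.symm
    exact endCohomology_mk_eq_zero hφ hψ hv
  · intro y
    obtain ⟨⟨z, hz⟩, rfl⟩ := Submodule.Quotient.mk_surjective _ y
    obtain ⟨b, hbz, hb⟩ := exists_representatives z
    obtain ⟨φ, hφ, ⟨l, hl⟩, g, hg, hbg⟩ := h₀.exists_capTot_eq ha hb fun j =>
      mkQ_mem_cycles_iff.1 ((hbz j).symm ▸ proj_mem_cycles hz j)
    have hm : dualDeg M k φ ∈ EndCochain ℤ K A k := ⟨l, fun c hc => hl _ (ofDeg_mem hc)⟩
    have hcoc : (⟨_, hm⟩ : EndCochain ℤ K A k) ∈ EndCocycles ℤ K A k :=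
      Subtype.ext (cobd_dualDeg hφ k)
    refine ⟨Submodule.Quotient.mk ⟨_, hcoc⟩, ?_⟩
    refine (endHomology_mk_eq hz (endCap_mem_cycles hAB h hc hcoc) hg fun j => ?_).symm
    obtain ⟨l₀, hl₀⟩ := capFun_eq hAB h c ⟨_, hm⟩
    obtain ⟨i, hi⟩ := ((hbg j).and ((Filter.eventually_ge_atTop l₀).and
      (Filter.eventually_ge_atTop j))).exists
    refine ⟨b i, cap h (a i) (dualDeg M k φ), ?_, (hl₀ j i hi.2.1 hi.2.2 (a i) (hac i)).symm, ?_⟩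
    · rw [← hbz j]
      refine (Submodule.Quotient.eq _).2 ?_
      rw [← ofDeg_mem_iff, map_sub]
      exact sub_mem_of_succ (antitone_diff K B) (b := fun j => ofDeg M m (b j)) hb hi.2.2
    · have h1 := toDeg_mem (n := m) hi.1
      rwa [map_sub, map_sub, toDeg_ofDeg, toDeg_capTot h, toDeg_dTot] at h1

/-- A cochain of degree above n caps every n-chain to zero, so the injectivity statement applies
with zero as bounding sequence. -/
theorem subsingleton_endCohomology (hAB : SeparatedAtInfinity K A B) {μ : EndHomology ℤ K univ n}
    (hμ : IsFundamentalClass K μ) {k : ℕ} (h : n < k) : Subsingleton (EndCohomology ℤ K A k) := by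
  obtain ⟨⟨c, hc⟩, rfl⟩ := Submodule.Quotient.mk_surjective _ μ
  obtain ⟨a, ha, -⟩ := exists_fundamentalSequence hc hμ
  obtain ⟨i₀, h₀⟩ := hAB
  replace h₀ : SeparatedFrom K A B i₀ := h₀
  refine subsingleton_of_forall_eq 0 fun y => ?_
  obtain ⟨⟨φ, hφ⟩, rfl⟩ := Submodule.Quotient.mk_surjective _ y
  obtain ⟨l, hl⟩ := φ.2
  have hφ0 : cobd ℤ M k φ.1 = 0 := congrArg Subtype.val hφ
  obtain ⟨ψ, hψ, i, hv⟩ := h₀.exists_dDual_eq ha (g := 0) (dDual_ofDualDeg hφ0)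
    (vanishesOn_ofDualDeg hl) (fun j => by simp) fun j => Filter.Eventually.of_forall fun i => by
      rw [capTot_ofDualDeg_of_lt h, Pi.zero_apply, map_zero, sub_zero]
      exact zero_mem _
  exact endCohomology_mk_eq_zero hφ hψ hv

/-- By surjectivity every cycle is a cap up to boundaries, and a cap with an n-chain has no
component in degree above n. -/
theorem subsingleton_endHomology (hAB : SeparatedAtInfinity K A B) {μ : EndHomology ℤ K univ n}
    (hμ : IsFundamentalClass K μ) {m : ℕ} (h : n < m) : Subsingleton (EndHomology ℤ K B m) := by
  obtain ⟨⟨c, hc⟩, rfl⟩ := Submodule.Quotient.mk_surjective _ μ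
  obtain ⟨a, ha, -⟩ := exists_fundamentalSequence hc hμ
  obtain ⟨i₀, h₀⟩ := hAB
  replace h₀ : SeparatedFrom K A B i₀ := h₀
  refine subsingleton_of_forall_eq 0 fun y => ?_
  obtain ⟨⟨z, hz⟩, rfl⟩ := Submodule.Quotient.mk_surjective _ y
  obtain ⟨b, hbz, hb⟩ := exists_representatives z
  obtain ⟨φ, -, -, g, hg, hbg⟩ := h₀.exists_capTot_eq ha hb fun j =>
    mkQ_mem_cycles_iff.1 ((hbz j).symm ▸ proj_mem_cycles hz j)
  refine endHomology_mk_eq hz (zero_mem _) hg fun j => ?_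
  obtain ⟨i, hi, hij⟩ := ((hbg j).and (Filter.eventually_ge_atTop j)).exists
  refine ⟨b i, 0, ?_, map_zero _, ?_⟩
  · rw [← hbz j]
    refine (Submodule.Quotient.eq _).2 ?_
    rw [← ofDeg_mem_iff, map_sub]
    exact sub_mem_of_succ (antitone_diff K B) (b := fun j => ofDeg M m (b j)) hb hij
  · have h1 := toDeg_mem (n := m) hi
    rwa [map_sub, map_sub, toDeg_ofDeg, toDeg_capTot_of_lt h, toDeg_dTot] at h1

end Main

end EndsDuality

end

theorem mainTheorem6 {n : ℕ} {M : Type*} [TopologicalSpace M] [T2Space M]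
    [SecondCountableTopology M] [ChartedSpace (EuclideanSpace ℝ (Fin n)) M]
    (hM : ∀ x : M, ¬ IsCompact (connectedComponent x))
    (horient : EndsDuality.IsOrientable n M)
    (K : CompactExhaustion M) (A B : Set M) (hAB : EndsDuality.IsEndsDecomposition K A B) :
    (∃ μ : EndsDuality.EndHomology ℤ K Set.univ n, EndsDuality.IsFundamentalClass K μ) ∧
    ∀ μ : EndsDuality.EndHomology ℤ K Set.univ n, EndsDuality.IsFundamentalClass K μ →
      (∀ (k m : ℕ) (h : k + m = n),
        Function.Bijective (EndsDuality.dualityMap hM hAB μ h :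
          EndsDuality.EndCohomology ℤ K A k → EndsDuality.EndHomology ℤ K B m)) ∧
      (∀ k : ℕ, n < k → Subsingleton (EndsDuality.EndCohomology ℤ K A k)) ∧
      (∀ m : ℕ, n < m → Subsingleton (EndsDuality.EndHomology ℤ K B m)) := by
  have : LocallyConnectedSpace M :=
    ChartedSpace.locallyConnectedSpace (EuclideanSpace ℝ (Fin n)) M
  have hsep := hAB.separatedAtInfinity hM
  exact ⟨EndsDuality.exists_isFundamentalClass horient K, fun μ hμ =>
    ⟨fun _ _ h => EndsDuality.capProduct_bijective hsep hμ h,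
      fun _ h => EndsDuality.subsingleton_endCohomology hsep hμ h,
      fun _ h => EndsDuality.subsingleton_endHomology hsep hμ h⟩⟩
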